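/- Notation. Let $N\ge 1$, $n=\lfloor N/2\rfloor$, $[z]=z-z^{-1}$, let $V=\mathbb C^2$ with canonical basis $|{\uparrow}\rangle=(1,0)^t$, $|{\downarrow}\rangle=(0,1)^t$, and let $\mathcal P$ be the linear operator on $V^{\otimes N}$ with $\mathcal P|\tau_1\tau_2\cdots \tau_N\rangle=|\tau_N\cdots \tau_2\tau_1\rangle$ for all $\tau_i\in\{\uparrow,\downarrow\}$. Let $q\in\mathbb C\setminus\{0,1,-1\}$ and $\beta\in\mathbb C\setminus\{0\}$. For generic $z_1,\dots,z_N\in\mathbb C$ define $$|\Psi_N(z_1,\dots,z_N;\beta)\rangle=\sum_{1\le a_1<\dots<a_n\le N}(\Psi_N)_{a_1,\dots,a_n}(z_1,\dots,z_N;\beta)\,|\tau^{a}_1\cdots \tau^{a}_N\rangle ,$$ where $\tau^{a}_i=\downarrow$ if $i\in\{a_1,\dots,a_n\}$ and $\tau^{a}_i=\uparrow$ otherwise, and $$(\Psi_N)_{a_1,\dots,a_n}(z_1,\dots,z_N;\beta)=(-[q])^n\prod_{1\le i<j\le N}[qz_j/z_i][q^2z_iz_j]\oint\cdots\oint\prod_{\ell=1}^n\frac{\mathrm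 dw_\ell}{\pi\mathrm i\,w_\ell}\,\Xi_{a_1,\dots,a_n}(w_1,\dots,w_n|z_1,\dots,z_N),$$ $$\Xi_{a_1,\dots,a_n}=\frac{\prod_{1\le i<j\le n}[qw_j/w_i][w_i/w_j][qw_iw_j]\prod_{1\le i\le j\le n}[q^2w_iw_j]\prod_{i=1}^n[\beta w_i]}{\prod_{i=1}^n\Bigl(\prod_{j=1}^{a_i}[z_j/w_i]\prod_{j=a_i}^N[qz_j/w_i]\prod_{j=1}^N[q^2w_iz_j]\Bigr)} .$$ The contour of each $w_\ell$ is a collection of positively oriented circles centred at the points $z_1,\dots,z_N$, such that the closed disc around $z_j$ contains none of the points $0$, $z_k$ ($k\ne j$), $-z_k$, $\pm qz_k$, $\pm q^{-2}z_k^{-1}$, $k=1,\dots,N$. Genericity of $z_1,\dots,z_N$ (with respect to $q$) means that such circles exist, that is, $z_j\ne 0$, $z_j\neq z_k$ for $j\ne k$, and $z_j\notin\{-z_k,\pm qz_k,\pm q^{-2}z_k^{-1}\}$ for all $j,k$. (For $N=1$ one has $|\Psi_1\rangle=|{\uparrow}\rangle$.) Proposition. Let $s\in\mathbb C$ satisfy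 $s^4=q^6$, and let $z_1,\dots,z_N$ be such that both $(z_1,\dots,z_N)$ and $(s^{-1}z_N^{-1},\dots,s^{-1}z_1^{-1})$ are generic. Then, for any choice of admissible circles on either side, $$\mathcal P|\Psi_N(z_1,\dots,z_N;\beta)\rangle=\epsilon_N\,|\Psi_N(s^{-1}z_N^{-1},\dots,s^{-1}z_1^{-1};q^2s^{-1}\beta^{-1})\rangle,\qquad \epsilon_N=(q^3s^{-2})^{(N+1)n}.$$ -/

import Mathlib

open scoped TensorProduct

noncomputable section

namespace SpinChain

/-- The bracket `[z] = z - z⁻¹`. -/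
def br (z : ℂ) : ℂ := z - z⁻¹

/-! ### The space of states -/

/-- The orientation of a spin `1/2`. -/
inductive Spin
  | up
  | down

/-- The canonical basis vectors `(1, 0)` (spin up) and `(0, 1)` (spin down) of `V = ℂ²`. -/
def Spin.ket : Spin → (Fin 2 → ℂ)
  | .up => ![1, 0]
  | .down => ![0, 1]

/-- The space `V^N = V ⊗ ⋯ ⊗ V` (`N` factors), with `V = ℂ²`. -/
abbrev Space (N : ℕ) : Type := ⨂[ℂ] _i : Fin N, (Fin 2 → ℂ)

/-- The canonical basis vector `|s₁ ⋯ s_N⟩ = |s₁⟩ ⊗ ⋯ ⊗ |s_N⟩`. -/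
def ket {N : ℕ} (s : Fin N → Spin) : Space N :=
  PiTensorProduct.tprod ℂ fun i => (s i).ket

/-- The parity operator: the linear operator on `V^N` that reverses the order of the tensor
factors. -/
def parity (N : ℕ) : Space N ≃ₗ[ℂ] Space N :=
  PiTensorProduct.reindex ℂ (fun _ : Fin N => Fin 2 → ℂ) Fin.revPerm

/-- `𝒫 |s₁ s₂ ⋯ s_N⟩ = |s_N ⋯ s₂ s₁⟩`. -/
theorem parity_ket {N : ℕ} (s : Fin N → Spin) :
    parity N (ket s) = ket fun i => s i.rev := by
  unfold parity ket
  exact PiTensorProduct.reindex_tprod _ _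

open Classical in
/-- The spin configuration whose down spins are at the positions `a₁, …, a_n`. -/
def config {N n : ℕ} (a : Fin n → Fin N) (i : Fin N) : Spin :=
  if i ∈ Set.range a then Spin.down else Spin.up

/-! ### The contour integrals -/

/-- The meromorphic function `Ξ_{a₁,…,a_n}(w₁,…,w_n | z₁,…,z_N)`. Positions are numbered from `0`,
so that `Finset.Iic (a i)` and `Finset.Ici (a i)` stand for the index ranges `j = 1, …, a_i` and
`j = a_i, …, N`. -/
def Xi {N n : ℕ} (q β : ℂ) (a : Fin n → Fin N) (w : Fin n → ℂ) (z : Fin N → ℂ) : ℂ :=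
  ((∏ i : Fin n, ∏ j ∈ Finset.Ioi i,
        br (q * w j / w i) * br (w i / w j) * br (q * w i * w j)) *
      (∏ i : Fin n, ∏ j ∈ Finset.Ici i, br (q ^ 2 * w i * w j)) *
      ∏ i : Fin n, br (β * w i)) /
    ∏ i : Fin n,
      ((∏ j ∈ Finset.Iic (a i), br (z j / w i)) *
        (∏ j ∈ Finset.Ici (a i), br (q * z j / w i)) *
        ∏ j : Fin N, br (q ^ 2 * w i * z j))

/-- The circles with centres `z_j` and radii `ρ_j`, positively oriented, form an admissible contour:
each closed disc contains the point `z_j` and none of the points `0`, `z_k` (`k ≠ j`), `-z_k`,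
`± q z_k`, `± q⁻² z_k⁻¹`. -/
structure IsContour {N : ℕ} (q : ℂ) (z : Fin N → ℂ) (ρ : Fin N → ℝ) : Prop where
  pos : ∀ j, 0 < ρ j
  zero_notMem : ∀ j, (0 : ℂ) ∉ Metric.closedBall (z j) (ρ j)
  notMem : ∀ j k, k ≠ j → z k ∉ Metric.closedBall (z j) (ρ j)
  neg_notMem : ∀ j k, -z k ∉ Metric.closedBall (z j) (ρ j)
  q_mul_notMem : ∀ j k, q * z k ∉ Metric.closedBall (z j) (ρ j)
  neg_q_mul_notMem : ∀ j k, -(q * z k) ∉ Metric.closedBall (z j) (ρ j)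
  inv_notMem : ∀ j k, (q ^ 2 * z k)⁻¹ ∉ Metric.closedBall (z j) (ρ j)
  neg_inv_notMem : ∀ j k, -(q ^ 2 * z k)⁻¹ ∉ Metric.closedBall (z j) (ρ j)

/-- The multiple contour integral `∮ ⋯ ∮ dw₁ ⋯ dw_n f(w₁,…,w_n)`, where the contour of each `w_ℓ` is
the collection of the positively oriented circles with centres `z_j` and radii `ρ_j`,
`j = 1, …, N`: the sum, over all ways to choose one circle for each variable, of the integrals over
the product of the chosen circles. -/
def multiContour {N n : ℕ} (z : Fin N → ℂ) (ρ : Fin N → ℝ) (f : (Fin n → ℂ) → ℂ) : ℂ :=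
  ∑ c : Fin n → Fin N, torusIntegral f (fun l => z (c l)) (fun l => ρ (c l))

/-- The component `(Ψ_N)_{a₁,…,a_n}(z₁,…,z_N; β)`, computed with the contour given by `ρ`. -/
def component {N n : ℕ} (q β : ℂ) (ρ : Fin N → ℝ) (z : Fin N → ℂ) (a : Fin n → Fin N) : ℂ :=
  (-br q) ^ n *
    (∏ i : Fin N, ∏ j ∈ Finset.Ioi i, br (q * z j / z i) * br (q ^ 2 * z i * z j)) *
    multiContour z ρ fun w =>
      (∏ l : Fin n, 1 / ((Real.pi : ℂ) * Complex.I * w l)) * Xi q β a w z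

open Classical in
/-- The vector `|Ψ_N(z₁,…,z_N; β)⟩`: the sum over all positions `a₁ < ⋯ < a_n` of the
`n = ⌊N/2⌋` down spins of the components times the canonical basis vectors. -/
def Psi {N : ℕ} (q β : ℂ) (ρ : Fin N → ℝ) (z : Fin N → ℂ) : Space N :=
  ∑ a ∈ (Finset.univ : Finset (Fin (N / 2) → Fin N)) with StrictMono a,
    component q β ρ z a • ket (config a)

/-- For `N = 1` the general definition gives `|Ψ₁⟩ = |↑⟩`. -/
theorem Psi_one (q β : ℂ) (ρ : Fin 1 → ℝ) (z : Fin 1 → ℂ) :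
    Psi q β ρ z = ket fun _ => Spin.up := by
  have h : ∀ a : Fin (1 / 2) → Fin 1, component q β ρ z a • ket (config a)
      = ket fun _ => Spin.up := by
    intro a
    have h0 : IsEmpty (Fin (1 / 2)) := Fin.isEmpty'
    have hc : config a = fun _ => Spin.up := by
      funext i
      simp [config]
    have hI : ∏ i : Fin 1, ∏ j ∈ Finset.Ioi i,
        br (q * z j / z i) * br (q ^ 2 * z i * z j) = 1 := by
      rw [Fin.prod_univ_one]
      exact Finset.prod_eq_one fun j hj => absurd (Finset.mem_Ioi.1 hj) (by omega)
    have h1 : component q β ρ z a = 1 := by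
      unfold component multiContour Xi
      rw [hI]
      change (-br q) ^ 0 * 1 * ∑ c : Fin 0 → Fin 1, _ = _
      simp
    rw [h1, hc, one_smul]
  unfold Psi
  rw [Finset.sum_congr rfl fun a _ => h a, Finset.sum_const]
  have : (Finset.univ.filter fun a : Fin (1 / 2) → Fin 1 => StrictMono a) = {fun _ => 0} := by
    ext a
    have h0 : IsEmpty (Fin (1 / 2)) := Fin.isEmpty'
    have ha : a = fun _ => 0 := funext fun x => h0.elim x
    subst ha
    simp only [Finset.mem_filter, Finset.mem_univ, true_and, Finset.mem_singleton, iff_true]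
    exact fun x => h0.elim x
  rw [this]
  simp

/-- Admissible contours exist exactly for generic `z₁, …, z_N`. -/
theorem exists_isContour_iff {N : ℕ} (q : ℂ) (z : Fin N → ℂ) :
    (∃ ρ, IsContour q z ρ) ↔
      ∀ j, z j ≠ 0 ∧ ∀ k, (k ≠ j → z k ≠ z j) ∧ -z k ≠ z j ∧ q * z k ≠ z j ∧
        -(q * z k) ≠ z j ∧ (q ^ 2 * z k)⁻¹ ≠ z j ∧ -(q ^ 2 * z k)⁻¹ ≠ z j := by
  constructor
  · rintro ⟨ρ, h⟩ j
    have key : ∀ x, x ∉ Metric.closedBall (z j) (ρ j) → x ≠ z j := by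
      rintro x hx rfl
      exact hx (Metric.mem_closedBall_self (h.pos j).le)
    exact ⟨(key _ (h.zero_notMem j)).symm, fun k => ⟨fun hk => key _ (h.notMem j k hk),
      key _ (h.neg_notMem j k), key _ (h.q_mul_notMem j k), key _ (h.neg_q_mul_notMem j k),
      key _ (h.inv_notMem j k), key _ (h.neg_inv_notMem j k)⟩⟩
  · intro h
    let S : Set ℂ := {0} ∪ Set.range z ∪ Set.range (fun k => -z k) ∪
      Set.range (fun k => q * z k) ∪ Set.range (fun k => -(q * z k)) ∪
      Set.range (fun k => (q ^ 2 * z k)⁻¹) ∪ Set.range (fun k => -(q ^ 2 * z k)⁻¹)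
    have hS : S.Finite := by
      refine (((((Set.finite_singleton _).union ?_).union ?_).union ?_).union ?_).union ?_ |>.union ?_
      all_goals exact Set.finite_range _
    have hr : ∀ j, ∃ r : ℝ, 0 < r ∧ ∀ x ∈ S, x ≠ z j → x ∉ Metric.closedBall (z j) r := by
      intro j
      have hc : IsClosed (S \ {z j}) := (hS.subset Set.sdiff_subset).isClosed
      have hm : (S \ {z j})ᶜ ∈ nhds (z j) := hc.isOpen_compl.mem_nhds (by simp)
      obtain ⟨r, hr, hsub⟩ := Metric.nhds_basis_closedBall.mem_iff.1 hm
      exact ⟨r, hr, fun x hx hne hmem => hsub hmem ⟨hx, hne⟩⟩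
    choose ρ hρ hav using hr
    refine ⟨ρ, hρ, fun j => hav j _ (by simp [S]) (h j).1.symm,
      fun j k hk => hav j _ (by simp [S]) (((h j).2 k).1 hk),
      fun j k => hav j _ (by simp [S]) ((h j).2 k).2.1,
      fun j k => hav j _ (.inl (.inl (.inl (.inr ⟨k, rfl⟩)))) ((h j).2 k).2.2.1,
      fun j k => hav j _ (.inl (.inl (.inr ⟨k, rfl⟩))) ((h j).2 k).2.2.2.1,
      fun j k => hav j _ (.inl (.inr ⟨k, rfl⟩)) ((h j).2 k).2.2.2.2.1,
      fun j k => hav j _ (.inr ⟨k, rfl⟩) ((h j).2 k).2.2.2.2.2⟩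

end SpinChain

end

noncomputable section

namespace SpinChain

open Polynomial

/-! ### The bracket -/

/-! Put e = q³s⁻². The condition s⁴ = q⁶ says e² = 1, and then [e/x] = -e[x]. For z'_i =
s⁻¹/z_{N+1-i} and β' = q²s⁻¹β⁻¹, the quantities q z'z', q² z'z' and β'z' equal e/(q² zz), e/(q zz)
and e/(qβz) in the reversed parameters. So the reversal exchanges the brackets [q zz] and [q² zz],
and [β'z'] with [qβz], up to factors -e. The theorem compares the component a at z with the reversed
component at z'. It follows from two facts.

The two extreme components are explicit products. If the down spins fill the first n sites, one
single choice of residues survives (`component_first`). If they fill the last n sites, many residues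
contribute. All of the integrand except a one-sided product is antisymmetric or common to all
variables, so that product may be antisymmetrized. The result is a determinant
(`triSum_mul_eq_diagDet`), so the denominator of each variable may be replaced by one that involves
only its own site and the first N - n sites. The resulting sum of residues is a product
(`resSum_eq_resVal`), which gives `component_last`. Both identities are proved by interpolation:
each side is a trigonometric polynomial in one parameter, and the two sides agree at sufficiently
many points. The reversal maps one product to the other, and collecting the factors -e yields ε_N
(`component_last_eq_first`).

The other components are determined by the last one. Exchanging neighbouring parameters z_i, z_{i+1}
gives linear relations between the components with a down spin at i or at i+1
(`IsContour.component_swap_left`, `IsContour.component_swap_right`). They come from the three-term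
identity for the bracket. The reversal turns one relation into the other with the same coefficients,
so moving the down spins step by step carries the equality from the last component to all of them
(`component_eq_revParam`).

The analysis enters only through simple poles at the z_j. A contour integral is both a finite sum of
residues and a limit of finite sums of values of the integrand near the centres. The second form
transfers algebraic identities of integrands to the integrals. -/

theorem br_inv (x : ℂ) : br x⁻¹ = -br x := by simp [br]

theorem br_one : br 1 = 0 := by simp [br]

theorem br_zero : br 0 = 0 := by simp [br]

theorem br_div_comm (x y : ℂ) : br (x / y) = -br (y / x) := by rw [← br_inv, inv_div]

theorem br_div_self (x : ℂ) : br (x / x) = 0 := by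
  rcases eq_or_ne x 0 with rfl | h
  · simp [br]
  · rw [div_self h, br_one]

theorem br_eq_zero_iff {x : ℂ} (hx : x ≠ 0) : br x = 0 ↔ x ^ 2 = 1 := by
  rw [br, sub_eq_zero, sq, mul_eq_one_iff_eq_inv₀ hx]

/-- The three-term identity `[A/w][B/C] + [B/w][C/A] + [C/w][A/B] = 0`. -/
theorem br_three_term {A B C w : ℂ} (hA : A ≠ 0) (hB : B ≠ 0) (hC : C ≠ 0) (hw : w ≠ 0) :
    br (A / w) * br (B / C) + br (B / w) * br (C / A) + br (C / w) * br (A / B) = 0 := by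
  unfold br
  field_simp
  ring

/-! ### Trigonometric polynomials -/

/-- `f` is, away from `0`, of the form `z ^ (-d) * p (z ^ 2)` with a polynomial `p` of degree at
most `d` whose coefficient of degree `d` is `l`. -/
def IsTrig (d : ℕ) (l : ℂ) (f : ℂ → ℂ) : Prop :=
  ∃ p : ℂ[X], p.natDegree ≤ d ∧ p.coeff d = l ∧ ∀ z, z ≠ 0 → f z * z ^ d = p.eval (z ^ 2)

namespace IsTrig

variable {d d' : ℕ} {l l' : ℂ} {f g : ℂ → ℂ}

theorem const (c : ℂ) : IsTrig 0 c fun _ => c :=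
  ⟨C c, by simp, by simp, by simp⟩

theorem br_mul (c : ℂ) : IsTrig 1 c fun z => br (c * z) := by
  refine ⟨C c * X - C c⁻¹, ?_, ?_, fun z hz => ?_⟩
  · compute_degree
  · simp [coeff_C]
  · simp only [br, mul_inv, eval_sub, eval_mul, eval_C, eval_X]
    field_simp

theorem br_div (c : ℂ) : IsTrig 1 (-c⁻¹) fun z => br (c / z) := by
  refine ⟨C c - C c⁻¹ * X, ?_, ?_, fun z hz => ?_⟩
  · compute_degree
  · simp [coeff_C]
  · simp only [br, inv_div, eval_sub, eval_mul, eval_C, eval_X]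
    rw [div_eq_mul_inv z c]
    field_simp

theorem congr (h : IsTrig d l f) (hfg : ∀ z, g z = f z) : IsTrig d l g := by
  rwa [funext hfg]

theorem mul (hf : IsTrig d l f) (hg : IsTrig d' l' g) :
    IsTrig (d + d') (l * l') fun z => f z * g z := by
  obtain ⟨p, hp, rfl, hpe⟩ := hf
  obtain ⟨r, hr, rfl, hre⟩ := hg
  refine ⟨p * r, natDegree_mul_le.trans (add_le_add hp hr),
    coeff_mul_add_eq_of_natDegree_le hp hr, fun z hz => ?_⟩
  rw [eval_mul, ← hpe z hz, ← hre z hz, pow_add]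
  ring

theorem const_mul (c : ℂ) (hf : IsTrig d l f) : IsTrig d (c * l) fun z => c * f z := by
  simpa using (const c).mul hf

theorem add (hf : IsTrig d l f) (hg : IsTrig d l' g) :
    IsTrig d (l + l') fun z => f z + g z := by
  obtain ⟨p, hp, rfl, hpe⟩ := hf
  obtain ⟨r, hr, rfl, hre⟩ := hg
  refine ⟨p + r, natDegree_add_le_of_degree_le hp hr, coeff_add _ _ _, fun z hz => ?_⟩
  rw [eval_add, ← hpe z hz, ← hre z hz]
  ring

theorem zero (d : ℕ) : IsTrig d 0 fun _ => 0 := ⟨0, by simp, by simp, by simp⟩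

theorem sub (hf : IsTrig d l f) (hg : IsTrig d l' g) :
    IsTrig d (l - l') fun z => f z - g z := by
  simpa [sub_eq_add_neg] using hf.add (hg.const_mul (-1))

theorem prod {ι : Type*} (s : Finset ι) {e : ℕ} {l : ι → ℂ} {f : ι → ℂ → ℂ}
    (h : ∀ i ∈ s, IsTrig e (l i) (f i)) :
    IsTrig (s.card * e) (∏ i ∈ s, l i) fun z => ∏ i ∈ s, f i z := by
  classical
  induction s using Finset.induction_on with
  | empty => simpa using const 1
  | insert a s ha ih =>
    simp only [Finset.prod_insert ha, Finset.card_insert_of_notMem ha, add_mul, one_mul]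
    rw [add_comm]
    exact (h a (by simp)).mul (ih fun i hi => h i (by simp [hi]))

theorem sum {ι : Type*} (s : Finset ι) {l : ι → ℂ} {f : ι → ℂ → ℂ}
    (h : ∀ i ∈ s, IsTrig d (l i) (f i)) :
    IsTrig d (∑ i ∈ s, l i) fun z => ∑ i ∈ s, f i z := by
  classical
  induction s using Finset.induction_on with
  | empty => simpa using zero d
  | insert a s ha ih =>
    simp only [Finset.sum_insert ha]
    exact (h a (by simp)).add (ih fun i hi => h i (by simp [hi]))

/-- All exponents of `f` have the parity of `d`, so the degree bound can only be raised in steps of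
2. The lemma shows that terms two degrees too low do not contribute to a top coefficient. -/
theorem raise (hf : IsTrig d l f) : IsTrig (d + 2) 0 f := by
  obtain ⟨p, hp, rfl, hpe⟩ := hf
  refine ⟨p * X, ?_, ?_, fun z hz => ?_⟩
  · exact natDegree_mul_le.trans (by rw [natDegree_X]; omega)
  · rw [coeff_mul_X]
    exact coeff_eq_zero_of_natDegree_lt (by omega)
  · rw [eval_mul, ← hpe z hz, eval_X, pow_add]
    ring

/-- Root counting for a polynomial of degree `d` in `z ^ 2`, whence the condition on the squares of
the nodes. -/
theorem eq_zero_of_card_lt (hf : IsTrig d l f) (S : Finset ℂ) (hS : d < S.card)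
    (hinj : ∀ x ∈ S, ∀ y ∈ S, x ≠ y → x ^ 2 ≠ y ^ 2) (h0 : ∀ x ∈ S, x ≠ 0 ∧ f x = 0)
    {z : ℂ} (hz : z ≠ 0) : f z = 0 := by
  classical
  obtain ⟨p, hp, -, hpe⟩ := hf
  have hp0 : p = 0 := by
    refine eq_zero_of_natDegree_lt_card_of_eval_eq_zero' p (S.image fun x => x ^ 2) ?_ ?_
    · intro y hy
      obtain ⟨x, hx, rfl⟩ := Finset.mem_image.1 hy
      rw [← hpe x (h0 x hx).1, (h0 x hx).2, zero_mul]
    · rw [Finset.card_image_of_injOn]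
      · omega
      · intro x hx y hy hxy
        by_contra hne
        exact hinj x hx y hy hne hxy
  have := hpe z hz
  rw [hp0, eval_zero] at this
  exact (mul_eq_zero.1 this).resolve_right (pow_ne_zero _ hz)

/-- A vanishing top coefficient saves one node. This is needed in the borderline case of the
interpolation. -/
theorem eq_zero_of_card_le (hf : IsTrig d 0 f) (S : Finset ℂ) (hS : d ≤ S.card)
    (hinj : ∀ x ∈ S, ∀ y ∈ S, x ≠ y → x ^ 2 ≠ y ^ 2) (h0 : ∀ x ∈ S, x ≠ 0 ∧ f x = 0)
    {z : ℂ} (hz : z ≠ 0) : f z = 0 := by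
  classical
  obtain ⟨p, hp, hl, hpe⟩ := hf
  have hp0 : p = 0 := by
    by_contra hne
    refine hne (eq_zero_of_natDegree_lt_card_of_eval_eq_zero' p (S.image fun x => x ^ 2) ?_ ?_)
    · intro y hy
      obtain ⟨x, hx, rfl⟩ := Finset.mem_image.1 hy
      rw [← hpe x (h0 x hx).1, (h0 x hx).2, zero_mul]
    · rw [Finset.card_image_of_injOn]
      · refine lt_of_lt_of_le (lt_of_le_of_ne hp fun h => hne ?_) hS
        rw [← leadingCoeff_eq_zero, leadingCoeff, h, hl]
      · intro x hx y hy hxy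
        by_contra hne
        exact hinj x hx y hy hne hxy
  have := hpe z hz
  rw [hp0, eval_zero] at this
  exact (mul_eq_zero.1 this).resolve_right (pow_ne_zero _ hz)

end IsTrig

/-! ### The residue sum of the last component -/

/-- The parameters in `S` are generic with respect to `q`. -/
structure Generic (q : ℂ) (S : Finset ℂ) : Prop where
  ne_zero : ∀ x ∈ S, x ≠ 0
  br_div : ∀ x ∈ S, ∀ y ∈ S, x ≠ y → br (x / y) ≠ 0
  br_q_div : ∀ x ∈ S, ∀ y ∈ S, br (q * x / y) ≠ 0
  br_q_mul : ∀ x ∈ S, ∀ y ∈ S, br (q ^ 2 * x * y) ≠ 0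

theorem Generic.mono {q : ℂ} {S T : Finset ℂ} (h : Generic q T) (hST : S ⊆ T) : Generic q S :=
  ⟨fun x hx => h.ne_zero x (hST hx), fun x hx y hy => h.br_div x (hST hx) y (hST hy),
    fun x hx y hy => h.br_q_div x (hST hx) y (hST hy),
    fun x hx y hy => h.br_q_mul x (hST hx) y (hST hy)⟩

/-- The antisymmetric factor `∏_{i<j} [w_i/w_j][q w_i w_j][q² w_i w_j]`. -/
def antisymProd (q : ℂ) {n : ℕ} (w : Fin n → ℂ) : ℂ :=
  ∏ i : Fin n, ∏ j ∈ Finset.Ioi i,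
    br (w i / w j) * br (q * w i * w j) * br (q ^ 2 * w i * w j)

theorem prod_pairs_cons {α : Type*} (F : α → α → ℂ) {n : ℕ} (x : α) (w : Fin n → α) :
    (∏ i : Fin (n + 1), ∏ j ∈ Finset.Ioi i,
      F ((Fin.cons x w : Fin (n + 1) → α) i) ((Fin.cons x w : Fin (n + 1) → α) j)) =
      (∏ l, F x (w l)) * ∏ i : Fin n, ∏ j ∈ Finset.Ioi i, F (w i) (w j) := by
  rw [Fin.prod_univ_succ, Fin.prod_Ioi_zero]
  simp [Fin.prod_Ioi_succ]

theorem antisymProd_cons (q : ℂ) {n : ℕ} (x : ℂ) (w : Fin n → ℂ) :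
    antisymProd q (Fin.cons x w : Fin (n + 1) → ℂ) =
      (∏ l, br (x / w l) * br (q * x * w l) * br (q ^ 2 * x * w l)) * antisymProd q w :=
  prod_pairs_cons (fun x y => br (x / y) * br (q * x * y) * br (q ^ 2 * x * y)) x w

/-- In each pair factor `[w_i/w_j]` is odd under exchange and the other two brackets are symmetric.
-/
theorem antisymProd_comp (q : ℂ) {n : ℕ} (w : Fin n → ℂ) (σ : Equiv.Perm (Fin n)) :
    antisymProd q (w ∘ σ) = σ.sign * antisymProd q w := by
  refine σ.prod_Ioi_comp_eq_sign_mul_prod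
    (f := fun i j => br (w i / w j) * br (q * w i * w j) * br (q ^ 2 * w i * w j)) fun i j => ?_
  rw [br_div_comm, mul_right_comm q (w i), mul_right_comm (q ^ 2) (w i)]
  ring

theorem antisymProd_eq_zero (q : ℂ) {n : ℕ} (w : Fin n → ℂ) (hw : ¬ Function.Injective w) :
    antisymProd q w = 0 := by
  simp only [Function.Injective, not_forall] at hw
  obtain ⟨i, j, hij, hne⟩ := hw
  wlog h : i < j generalizing i j
  · exact this j i hij.symm (Ne.symm hne) (lt_of_le_of_ne (not_lt.1 h) (Ne.symm hne))
  refine Finset.prod_eq_zero (Finset.mem_univ i) (Finset.prod_eq_zero (Finset.mem_Ioi.2 h) ?_)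
  rw [hij, br_div_self, zero_mul, zero_mul]

/-- The weight of the residue at `x` of the integrand in the variable that belongs to the
position with parameter `b₀`. -/
def resWeight (q β : ℂ) (A : Finset ℂ) {n : ℕ} (b : Fin n → ℂ) (b₀ x : ℂ) : ℂ :=
  br (β * x) * br (q ^ 2 * x * x) /
    ((∏ y ∈ (insert b₀ A).erase x, br (y / x)) * br (q * b₀ / x) *
      (∏ a ∈ A, br (q ^ 2 * a * x)) * ∏ k, br (q ^ 2 * b k * x))

/-- The sum over residues of the diagonal form of the integrand of the last component. -/
def resSum (q β : ℂ) (A : Finset ℂ) {n : ℕ} (b : Fin n → ℂ) : ℂ :=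
  ∑ w ∈ Fintype.piFinset fun i => insert (b i) A,
    antisymProd q w * ∏ i, resWeight q β A b (b i) (w i)

/-- Exchanging the variables `i` and `j` preserves the range of summation and the weights, because
`b i = b j`, but flips the sign of `antisymProd`. This supplies the interpolation nodes `b₀ = b k`.
-/
theorem resSum_eq_zero (q β : ℂ) (A : Finset ℂ) {n : ℕ} (b : Fin n → ℂ) {i j : Fin n}
    (hij : i ≠ j) (hb : b i = b j) : resSum q β A b = 0 := by
  set σ := Equiv.swap i j with hσ
  have hbσ : ∀ k, b (σ k) = b k := by
    intro k
    rcases eq_or_ne k i with rfl | h1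
    · rw [hσ, Equiv.swap_apply_left, hb]
    rcases eq_or_ne k j with rfl | h2
    · rw [hσ, Equiv.swap_apply_right, hb]
    · rw [hσ, Equiv.swap_apply_of_ne_of_ne h1 h2]
  have key : resSum q β A b = -resSum q β A b := by
    conv_lhs => unfold resSum
    unfold resSum
    rw [← Finset.sum_neg_distrib]
    refine Finset.sum_nbij' (fun w => w ∘ σ) (fun w => w ∘ σ) ?_ ?_ ?_ ?_ ?_
    · intro w hw
      simp only [Fintype.mem_piFinset, Function.comp] at hw ⊢
      intro k
      rw [← hbσ k]
      exact hw _
    · intro w hw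
      simp only [Fintype.mem_piFinset, Function.comp] at hw ⊢
      intro k
      rw [← hbσ k]
      exact hw _
    · intro w _
      funext k
      simp [hσ]
    · intro w _
      funext k
      simp [hσ]
    · intro w _
      rw [antisymProd_comp, hσ, Equiv.Perm.sign_swap hij]
      have : ∏ k, resWeight q β A b (b k) ((w ∘ σ) k) = ∏ k, resWeight q β A b (b k) (w k) := by
        rw [← Equiv.prod_comp σ fun k => resWeight q β A b (b k) (w k)]
        exact Finset.prod_congr rfl fun k _ => by rw [hbσ, Function.comp]
      rw [← hσ, this]
      simp
  exact self_eq_neg.1 key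

/-- Isolates the dependence on `b₀`. The other variables do not range over `b₀`, and their weights
see it only through the brackets `[q² b₀ w_l]`. -/
theorem resSum_cons (q β : ℂ) (A : Finset ℂ) {n : ℕ} (b₀ : ℂ) (b : Fin n → ℂ) :
    resSum q β A (Fin.cons b₀ b : Fin (n + 1) → ℂ) =
      ∑ w ∈ Fintype.piFinset fun i => insert (b i) A,
        (antisymProd q w * ∏ i, resWeight q β A b (b i) (w i)) *
        ∑ x ∈ insert b₀ A,
          (∏ l, br (x / w l) * br (q * x * w l) * br (q ^ 2 * x * w l)) *
            resWeight q β A (Fin.cons b₀ b : Fin (n + 1) → ℂ) b₀ x *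
            (∏ l, br (q ^ 2 * b₀ * w l))⁻¹ := by
  simp_rw [Finset.mul_sum]
  rw [← Finset.sum_product', resSum]
  refine Finset.sum_nbij' (fun w => (Fin.tail w, w 0)) (fun p => Fin.cons p.2 p.1) ?_ ?_ ?_ ?_ ?_
  · intro w hw
    rw [Fintype.mem_piFinset] at hw
    simp only [Finset.mem_product, Fintype.mem_piFinset]
    exact ⟨fun i => by simpa [Fin.tail] using hw i.succ, by simpa using hw 0⟩
  · rintro ⟨w, x⟩ hw
    simp only [Finset.mem_product, Fintype.mem_piFinset] at hw
    rw [Fintype.mem_piFinset]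
    intro i
    refine Fin.cases ?_ (fun i => ?_) i
    · simpa using hw.2
    · simpa using hw.1 i
  · intro w _
    exact Fin.cons_self_tail w
  · rintro ⟨w, x⟩ _
    simp
  · intro w _
    have h : ∀ i, resWeight q β A (Fin.cons b₀ b : Fin (n + 1) → ℂ) (b i) (Fin.tail w i) =
        resWeight q β A b (b i) (Fin.tail w i) * (br (q ^ 2 * b₀ * Fin.tail w i))⁻¹ := by
      intro i
      simp only [resWeight, Fin.prod_univ_succ, Fin.cons_zero, Fin.cons_succ, div_eq_mul_inv,
        mul_inv]
      ring
    have h2 : ∏ i, resWeight q β A (Fin.cons b₀ b : Fin (n + 1) → ℂ)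
        ((Fin.cons b₀ b : Fin (n + 1) → ℂ) i) (w i) =
        resWeight q β A (Fin.cons b₀ b : Fin (n + 1) → ℂ) b₀ (w 0) *
          ((∏ i, resWeight q β A b (b i) (Fin.tail w i)) *
            (∏ l, br (q ^ 2 * b₀ * Fin.tail w l))⁻¹) := by
      rw [Fin.prod_univ_succ, Fin.cons_zero, ← Finset.prod_inv_distrib,
        ← Finset.prod_mul_distrib]
      congr 1
      exact Finset.prod_congr rfl fun i _ => by rw [Fin.cons_succ, ← h]; rfl
    rw [h2]
    have h3 := antisymProd_cons q (w 0) (Fin.tail w)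
    rw [Fin.cons_self_tail] at h3
    rw [h3]
    ring

/-! ### Clearing the denominators -/

/-- The common denominator in the parameter `b₀`. -/
def clearing (q : ℂ) (A : Finset ℂ) {n : ℕ} (b : Fin n → ℂ) (b₀ : ℂ) : ℂ :=
  (∏ a ∈ A, br (a / b₀) * br (q ^ 2 * a * b₀) * br (q * b₀ / a)) * ∏ k, br (q ^ 2 * b k * b₀)

/-- The contribution of the residue at `b₀`, with its denominators cleared. -/
def ownTerm (q β : ℂ) (A : Finset ℂ) {n : ℕ} (w : Fin n → ℂ) (b₀ : ℂ) : ℂ :=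
  (br q)⁻¹ * (br (β * b₀) * (∏ l, br ((w l)⁻¹ * b₀) * br (q * w l * b₀)) * ∏ a ∈ A, br (q / a * b₀))

/-- The contribution of the residue at `a ∈ A`, with its denominators cleared, up to factors that
do not depend on `b₀`. -/
def otherTerm (q : ℂ) (A : Finset ℂ) {n : ℕ} (b w : Fin n → ℂ) (a b₀ : ℂ) : ℂ :=
  (∏ x ∈ A.erase a, br (x / b₀) * br (q / x * b₀)) *
    ∏ y ∈ ((A ∪ Finset.univ.image b).erase a) \ Finset.univ.image w, br (q ^ 2 * y * b₀)

/-- The factors of the contribution of the residue at `a ∈ A` that do not depend on `b₀`. -/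
def otherCoeff (q β : ℂ) (A : Finset ℂ) {n : ℕ} (b w : Fin n → ℂ) (a : ℂ) : ℂ :=
  -(br (β * a) * (∏ l, br (a / w l) * br (q * a * w l) * br (q ^ 2 * a * w l)) /
    ((∏ x ∈ A.erase a, br (x / a) * br (q ^ 2 * x * a)) * ∏ k, br (q ^ 2 * b k * a)))

theorem otherCoeff_eq_zero (q β : ℂ) (A : Finset ℂ) {n : ℕ} (b w : Fin n → ℂ) {a : ℂ}
    (h : ∃ l, w l = a) : otherCoeff q β A b w a = 0 := by
  obtain ⟨l, rfl⟩ := h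
  have : ∏ k, br (w l / w k) * br (q * w l * w k) * br (q ^ 2 * w l * w k) = 0 :=
    Finset.prod_eq_zero (Finset.mem_univ l) (by rw [br_div_self]; ring)
  rw [otherCoeff, this]
  simp

section Clear

variable {q β : ℂ} {A : Finset ℂ} {n : ℕ} {b w : Fin n → ℂ} {b₀ : ℂ}

/-- For `x = b₀` the brackets `[q² b₀ w_l]` cancel against the pair factors, `[q² b₀ b₀]` occurs in
numerator and denominator, and `[q b₀/b₀] = [q]`. All the remaining denominators in `b₀` are factors
of `clearing`. -/
theorem clearing_mul_own (hG : Generic q (insert b₀ (A ∪ Finset.univ.image b)))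
    (hb₀ : b₀ ∉ A) (hw : ∀ l, w l ∈ A ∪ Finset.univ.image b) :
    clearing q A b b₀ * ((∏ l, br (b₀ / w l) * br (q * b₀ * w l) * br (q ^ 2 * b₀ * w l)) *
      resWeight q β A (Fin.cons b₀ b : Fin (n + 1) → ℂ) b₀ b₀ *
        (∏ l, br (q ^ 2 * b₀ * w l))⁻¹) = ownTerm q β A w b₀ := by
  have hb0 : b₀ ≠ 0 := hG.ne_zero _ (by simp)
  have hA : ∀ a ∈ A, a ∈ insert b₀ (A ∪ Finset.univ.image b) := fun a ha => by simp [ha]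
  have h1 : ∏ a ∈ A, br (a / b₀) ≠ 0 := Finset.prod_ne_zero_iff.2 fun a ha =>
    hG.br_div _ (hA a ha) _ (by simp) (by rintro rfl; exact hb₀ ha)
  have h2 : ∏ a ∈ A, br (q ^ 2 * a * b₀) ≠ 0 := Finset.prod_ne_zero_iff.2 fun a ha =>
    hG.br_q_mul _ (hA a ha) _ (by simp)
  have h3 : ∏ k, br (q ^ 2 * b k * b₀) ≠ 0 := Finset.prod_ne_zero_iff.2 fun k _ =>
    hG.br_q_mul _ (by simp) _ (by simp)
  have h4 : br (q ^ 2 * b₀ * b₀) ≠ 0 := hG.br_q_mul _ (by simp) _ (by simp)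
  have h5 : ∏ l, br (q ^ 2 * b₀ * w l) ≠ 0 := Finset.prod_ne_zero_iff.2 fun l _ =>
    hG.br_q_mul _ (by simp) _ (Finset.mem_insert_of_mem (hw l))
  have hq : br q ≠ 0 := by
    have := hG.br_q_div b₀ (by simp) b₀ (by simp)
    rwa [mul_div_assoc, div_self hb0, mul_one] at this
  have e1 : ∏ l, br ((w l)⁻¹ * b₀) * br (q * w l * b₀) =
      (∏ l, br (b₀ / w l)) * ∏ l, br (q * b₀ * w l) := by
    rw [← Finset.prod_mul_distrib]
    exact Finset.prod_congr rfl fun l _ => by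
      rw [div_eq_mul_inv, mul_comm b₀, mul_right_comm q b₀]
  have e2 : ∏ a ∈ A, br (q / a * b₀) = ∏ a ∈ A, br (q * b₀ / a) :=
    Finset.prod_congr rfl fun a _ => by rw [div_mul_eq_mul_div]
  rw [clearing, ownTerm, resWeight, Finset.erase_insert hb₀, Fin.prod_univ_succ, Fin.cons_zero, e1,
    e2, mul_div_assoc q b₀ b₀, div_self hb0, mul_one]
  simp only [Fin.cons_succ, Finset.prod_mul_distrib]
  generalize (∏ a ∈ A, br (a / b₀)) = p1 at *
  generalize (∏ a ∈ A, br (q ^ 2 * a * b₀)) = p2 at *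
  generalize (∏ k, br (q ^ 2 * b k * b₀)) = p3 at *
  generalize (∏ l, br (q ^ 2 * b₀ * w l)) = p4 at *
  generalize br (q ^ 2 * b₀ * b₀) = p5 at *
  generalize br q = p6 at *
  field_simp

theorem clearing_aux {t1 t2 t3 t4 p4 : ℂ} (t5 u1 u2 v p1 p2 p3 c : ℂ) (h1 : t1 ≠ 0) (h2 : t2 ≠ 0)
    (h3 : t3 ≠ 0) (h4 : t4 ≠ 0) (h5 : p4 ≠ 0) :
    t1 * u1 * (t2 * u2) * (t4 * (p4 * c)) *
      (v * (t5 * t3 / (-t1 * p1 * t2 * (t3 * p2) * (t4 * p3))) * p4⁻¹) =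
    -(t5 * v / (p1 * p2 * p3)) * (u1 * u2 * c) := by
  have h : -t1 * p1 * t2 * (t3 * p2) * (t4 * p3) = -(t1 * t2 * t3 * t4) * (p1 * p2 * p3) := by ring
  rw [h, div_eq_mul_inv, mul_inv, div_eq_mul_inv]
  generalize (p1 * p2 * p3)⁻¹ = r
  field_simp

/-- If `a` is one of the `w l`, both sides vanish. Otherwise the `w l` are distinct elements of `(A
∪ b) \ {a}`, so the denominator `∏ [q² b₀ w_l]` divides the product of the `[q² y b₀]` in
`clearing`. The elements `y` that are not used up form the second product of `otherTerm`. -/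
theorem clearing_mul_other (hG : Generic q (insert b₀ (A ∪ Finset.univ.image b)))
    (hb₀ : b₀ ∉ A) (hw : ∀ l, w l ∈ A ∪ Finset.univ.image b) (hinj : Function.Injective w)
    (hb : Function.Injective b) (hdisj : ∀ k, b k ∉ A) {a : ℂ} (ha : a ∈ A) :
    clearing q A b b₀ * ((∏ l, br (a / w l) * br (q * a * w l) * br (q ^ 2 * a * w l)) *
      resWeight q β A (Fin.cons b₀ b : Fin (n + 1) → ℂ) b₀ a *
        (∏ l, br (q ^ 2 * b₀ * w l))⁻¹) = otherCoeff q β A b w a * otherTerm q A b w a b₀ := by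
  by_cases hwa : ∃ l, w l = a
  · rw [otherCoeff_eq_zero q β A b w hwa]
    obtain ⟨l, rfl⟩ := hwa
    have : ∏ k, br (w l / w k) * br (q * w l * w k) * br (q ^ 2 * w l * w k) = 0 :=
      Finset.prod_eq_zero (Finset.mem_univ l) (by rw [br_div_self]; ring)
    rw [this]
    simp
  have hb0 : b₀ ≠ 0 := hG.ne_zero _ (by simp)
  have hA : ∀ a ∈ A, a ∈ insert b₀ (A ∪ Finset.univ.image b) := fun a ha => by simp [ha]
  have hab : a ≠ b₀ := by rintro rfl; exact hb₀ ha
  have h1 : br (a / b₀) ≠ 0 := hG.br_div _ (hA a ha) _ (by simp) hab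
  have h2 : br (q * b₀ / a) ≠ 0 := hG.br_q_div _ (by simp) _ (hA a ha)
  have h3 : br (q ^ 2 * a * a) ≠ 0 := hG.br_q_mul _ (hA a ha) _ (hA a ha)
  have h4 : br (q ^ 2 * a * b₀) ≠ 0 := hG.br_q_mul _ (hA a ha) _ (by simp)
  have h5 : ∏ l, br (q ^ 2 * b₀ * w l) ≠ 0 := Finset.prod_ne_zero_iff.2 fun l _ =>
    hG.br_q_mul _ (by simp) _ (Finset.mem_insert_of_mem (hw l))
  have e1 : (insert b₀ A).erase a = insert b₀ (A.erase a) := by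
    rw [Finset.erase_insert_of_ne hab.symm]
  have hn : b₀ ∉ A.erase a := fun h => hb₀ (Finset.mem_of_mem_erase h)
  have e2 : (∏ x ∈ A, br (q ^ 2 * x * b₀)) * ∏ k, br (q ^ 2 * b k * b₀) =
      br (q ^ 2 * a * b₀) * ((∏ l, br (q ^ 2 * b₀ * w l)) *
      ∏ y ∈ ((A ∪ Finset.univ.image b).erase a) \ Finset.univ.image w, br (q ^ 2 * y * b₀)) := by
    have f1 : ∏ k, br (q ^ 2 * b k * b₀) = ∏ y ∈ Finset.univ.image b, br (q ^ 2 * y * b₀) := by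
      rw [Finset.prod_image fun x _ y _ h => hb h]
    have f2 : ∏ l, br (q ^ 2 * b₀ * w l) = ∏ y ∈ Finset.univ.image w, br (q ^ 2 * y * b₀) := by
      rw [Finset.prod_image fun x _ y _ h => hinj h]
      exact Finset.prod_congr rfl fun l _ => by rw [mul_right_comm]
    have hd : Disjoint A (Finset.univ.image b) := by
      rw [Finset.disjoint_right]
      intro x hx
      obtain ⟨k, -, rfl⟩ := Finset.mem_image.1 hx
      exact hdisj k
    rw [f1, f2, ← Finset.prod_union hd, ← Finset.mul_prod_erase _ _ (Finset.mem_union_left _ ha),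
      ← Finset.prod_sdiff (s₁ := Finset.univ.image w)
        (s₂ := (A ∪ Finset.univ.image b).erase a), mul_comm (∏ y ∈ Finset.univ.image w, _)]
    intro x hx
    obtain ⟨l, -, rfl⟩ := Finset.mem_image.1 hx
    exact Finset.mem_erase.2 ⟨fun h => hwa ⟨l, h⟩, hw l⟩
  have e3 : ∏ x ∈ A.erase a, br (q / x * b₀) = ∏ x ∈ A.erase a, br (q * b₀ / x) :=
    Finset.prod_congr rfl fun a _ => by rw [div_mul_eq_mul_div]
  have e4 : ∏ k, br (q ^ 2 * (Fin.cons b₀ b : Fin (n + 1) → ℂ) k * a) =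
      br (q ^ 2 * a * b₀) * ∏ k, br (q ^ 2 * b k * a) := by
    rw [Fin.prod_univ_succ, Fin.cons_zero, mul_right_comm]
    simp
  have e5 : clearing q A b b₀ = (br (a / b₀) * ∏ x ∈ A.erase a, br (x / b₀)) *
      (br (q * b₀ / a) * ∏ x ∈ A.erase a, br (q * b₀ / x)) *
      ((∏ x ∈ A, br (q ^ 2 * x * b₀)) * ∏ k, br (q ^ 2 * b k * b₀)) := by
    rw [clearing, Finset.mul_prod_erase A (fun x => br (x / b₀)) ha,
      Finset.mul_prod_erase A (fun x => br (q * b₀ / x)) ha]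
    simp only [Finset.prod_mul_distrib]
    ring
  rw [e5, e2, otherCoeff, otherTerm, resWeight, e1, e4, Finset.prod_insert hn,
    ← Finset.mul_prod_erase A (fun x => br (q ^ 2 * x * a)) ha, br_div_comm b₀ a]
  simp only [Finset.prod_mul_distrib, e3]
  exact clearing_aux _ _ _ _ _ _ _ _ h1 h2 h3 h4 h5

theorem clearing_mul_resSum (hG : Generic q (insert b₀ (A ∪ Finset.univ.image b)))
    (hb₀ : b₀ ∉ A) (hb : Function.Injective b) (hdisj : ∀ k, b k ∉ A) :
    clearing q A b b₀ * resSum q β A (Fin.cons b₀ b : Fin (n + 1) → ℂ) =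
      ∑ w ∈ Fintype.piFinset fun i => insert (b i) A,
        (antisymProd q w * ∏ i, resWeight q β A b (b i) (w i)) *
        (ownTerm q β A w b₀ + ∑ a ∈ A, otherCoeff q β A b w a * otherTerm q A b w a b₀) := by
  rw [resSum_cons, Finset.mul_sum]
  refine Finset.sum_congr rfl fun w hw => ?_
  by_cases hinj : Function.Injective w
  · have hw' : ∀ l, w l ∈ A ∪ Finset.univ.image b := by
      intro l
      have := Fintype.mem_piFinset.1 hw l
      rcases Finset.mem_insert.1 this with h | h
      · rw [h]; simp
      · simp [h]
    rw [Finset.sum_insert hb₀, mul_left_comm, mul_add, clearing_mul_own hG hb₀ hw',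
      Finset.mul_sum (s := A)]
    congr 2
    exact Finset.sum_congr rfl fun a ha => clearing_mul_other hG hb₀ hw' hinj hb hdisj ha
  · rw [antisymProd_eq_zero q w hinj]
    simp

end Clear

/-! ### The value of the residue sum -/

/-- The product of `[q x y] / [q² x y]` over the unordered pairs `{x, y}` in `A`. -/
def pairRatio (q : ℂ) (A : Finset ℂ) : ℂ :=
  ∏ s ∈ A.powersetCard 2, br (q * ∏ x ∈ s, x) / br (q ^ 2 * ∏ x ∈ s, x)

theorem prod_powersetCard_two_insert (F : ℂ → ℂ) {A : Finset ℂ} {a : ℂ} (ha : a ∉ A) :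
    ∏ s ∈ (insert a A).powersetCard 2, F (∏ x ∈ s, x) =
      (∏ s ∈ A.powersetCard 2, F (∏ x ∈ s, x)) * ∏ x ∈ A, F (a * x) := by
  rw [Finset.powersetCard_succ_insert ha, Finset.prod_union, Finset.prod_image]
  · congr 1
    rw [Finset.powersetCard_one, Finset.prod_map]
    refine Finset.prod_congr rfl fun x hx => ?_
    have : a ≠ x := by rintro rfl; exact ha hx
    simp [this]
  · intro s hs t ht hst
    have h1 : a ∉ s := fun h => ha ((Finset.mem_powersetCard.1 hs).1 h)
    have h2 : a ∉ t := fun h => ha ((Finset.mem_powersetCard.1 ht).1 h)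
    rw [← Finset.erase_insert h1, hst, Finset.erase_insert h2]
  · rw [Finset.disjoint_left]
    intro s hs ht
    obtain ⟨t, -, rfl⟩ := Finset.mem_image.1 ht
    exact ha ((Finset.mem_powersetCard.1 hs).1 (Finset.mem_insert_self _ _))

theorem pairRatio_erase (q : ℂ) {A : Finset ℂ} {a : ℂ} (ha : a ∈ A) :
    pairRatio q A = pairRatio q (A.erase a) *
      ∏ x ∈ A.erase a, br (q * (a * x)) / br (q ^ 2 * (a * x)) := by
  conv_lhs => rw [← Finset.insert_erase ha]
  exact prod_powersetCard_two_insert (fun y => br (q * y) / br (q ^ 2 * y))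
    (Finset.notMem_erase a A)

/-- The product formula for `resSum`. -/
def resVal (q β : ℂ) (A : Finset ℂ) {n : ℕ} (b : Fin n → ℂ) : ℂ :=
  (br q)⁻¹ ^ n * (∏ i : Fin n, ∏ j ∈ Finset.Ioi i, br (b i / b j)) * (∏ i, br (q * β * b i)) *
    pairRatio q A / ∏ i, ∏ a ∈ A, br (a / (q * b i)) * br (q ^ 2 * a * b i)

theorem resVal_cons (q β : ℂ) (A : Finset ℂ) {n : ℕ} (b₀ : ℂ) (b : Fin n → ℂ) :
    resVal q β A (Fin.cons b₀ b : Fin (n + 1) → ℂ) =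
      (br q)⁻¹ * (∏ k, br (b₀ / b k)) * br (q * β * b₀) /
        (∏ a ∈ A, br (a / (q * b₀)) * br (q ^ 2 * a * b₀)) * resVal q β A b := by
  rw [resVal, resVal, prod_pairs_cons (fun x y => br (x / y)), Fin.prod_univ_succ,
    Fin.prod_univ_succ (n := n) (f := fun i => ∏ a ∈ A, _)]
  simp only [Fin.cons_zero, Fin.cons_succ, pow_succ, div_eq_mul_inv, mul_inv]
  ring

theorem resVal_erase (q β : ℂ) {A : Finset ℂ} {n : ℕ} (b : Fin n → ℂ) {a : ℂ} (ha : a ∈ A) :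
    resVal q β A b = resVal q β (A.erase a) b *
      ((∏ x ∈ A.erase a, br (q * (a * x)) / br (q ^ 2 * (a * x))) /
        ∏ i, br (a / (q * b i)) * br (q ^ 2 * a * b i)) := by
  have : ∏ i, ∏ a ∈ A, br (a / (q * b i)) * br (q ^ 2 * a * b i) =
      (∏ i, br (a / (q * b i)) * br (q ^ 2 * a * b i)) *
        ∏ i, ∏ x ∈ A.erase a, br (x / (q * b i)) * br (q ^ 2 * x * b i) := by
    rw [← Finset.prod_mul_distrib]
    exact Finset.prod_congr rfl fun i _ => (Finset.mul_prod_erase A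
      (fun x => br (x / (q * b i)) * br (q ^ 2 * x * b i)) ha).symm
  rw [resVal, resVal, this, pairRatio_erase q ha]
  simp only [div_eq_mul_inv, mul_inv]
  ring

/-- `resVal` with its denominators cleared, up to a factor that does not depend on `b₀`. -/
def valTerm (q β : ℂ) (A : Finset ℂ) {n : ℕ} (b : Fin n → ℂ) (b₀ : ℂ) : ℂ :=
  (br q)⁻¹ * (-1) ^ A.card * ((∏ k, br ((b k)⁻¹ * b₀)) * br (q * β * b₀) *
    (∏ a ∈ A, br (a / b₀)) * ∏ k, br (q ^ 2 * b k * b₀))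

theorem clearing_mul_resVal {q : ℂ} (β : ℂ) {A : Finset ℂ} {n : ℕ} {b : Fin n → ℂ} {b₀ : ℂ}
    (hG : Generic q (insert b₀ (A ∪ Finset.univ.image b))) :
    clearing q A b b₀ * resVal q β A (Fin.cons b₀ b : Fin (n + 1) → ℂ) =
      valTerm q β A b b₀ * resVal q β A b := by
  have hA : ∀ a ∈ A, a ∈ insert b₀ (A ∪ Finset.univ.image b) := fun a ha => by simp [ha]
  have h1 : ∏ a ∈ A, br (q ^ 2 * a * b₀) ≠ 0 := Finset.prod_ne_zero_iff.2 fun a ha =>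
    hG.br_q_mul _ (hA a ha) _ (by simp)
  have h2 : ∏ a ∈ A, br (q * b₀ / a) ≠ 0 := Finset.prod_ne_zero_iff.2 fun a ha =>
    hG.br_q_div _ (by simp) _ (hA a ha)
  have e1 : ∏ a ∈ A, br (a / (q * b₀)) = (-1) ^ A.card * ∏ a ∈ A, br (q * b₀ / a) := by
    rw [← Finset.prod_const, ← Finset.prod_mul_distrib]
    exact Finset.prod_congr rfl fun a _ => by rw [br_div_comm]; ring
  have e2 : ∏ k, br ((b k)⁻¹ * b₀) = ∏ k, br (b₀ / b k) :=
    Finset.prod_congr rfl fun k _ => by rw [div_eq_mul_inv, mul_comm]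
  have e3 : ((-1 : ℂ) ^ A.card) ^ 2 = 1 := by rw [← pow_mul, mul_comm, pow_mul]; norm_num
  rw [resVal_cons, clearing, valTerm, e2]
  simp only [Finset.prod_mul_distrib]
  rw [e1]
  generalize ∏ a ∈ A, br (q ^ 2 * a * b₀) = p1 at *
  generalize ∏ a ∈ A, br (q * b₀ / a) = p2 at *
  generalize (-1 : ℂ) ^ A.card = ε at *
  have hε : ε ≠ 0 := by rintro rfl; simp at e3
  have e4 : p2 / (ε * p2 * p1) = ε / p1 := by
    rw [div_eq_div_iff (by simp [*]) h1]
    linear_combination (-p1 * p2) * e3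
  have : ∀ X Y Z U V : ℂ, X * p1 * p2 * Y * (U * Z * V / (ε * p2 * p1) * resVal q β A b) =
      p1 * X * Y * U * Z * V * resVal q β A b * (p2 / (ε * p2 * p1)) := by
    intros
    ring
  rw [this, e4]
  field_simp

/-! ### The interpolation -/

/-- Two ways to multiply `g` over `(A ∪ b) \ {a}`: split into `A \ {a}` and the `b k`, or into the
`w l` and the rest. -/
theorem prod_erase_mul_prod {A : Finset ℂ} {n : ℕ} {b w : Fin n → ℂ} (g : ℂ → ℂ)
    (hw : ∀ l, w l ∈ A ∪ Finset.univ.image b) (hinj : Function.Injective w)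
    (hb : Function.Injective b) (hdisj : ∀ k, b k ∉ A) {a : ℂ} (ha : a ∈ A)
    (hwa : ∀ l, w l ≠ a) :
    (∏ x ∈ A.erase a, g x) * ∏ k, g (b k) = (∏ l, g (w l)) *
      ∏ y ∈ ((A ∪ Finset.univ.image b).erase a) \ Finset.univ.image w, g y := by
  have f1 : ∏ k, g (b k) = ∏ y ∈ Finset.univ.image b, g y := by
    rw [Finset.prod_image fun x _ y _ h => hb h]
  have f2 : ∏ l, g (w l) = ∏ y ∈ Finset.univ.image w, g y := by
    rw [Finset.prod_image fun x _ y _ h => hinj h]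
  have hab : a ∉ Finset.univ.image b := by
    intro h
    obtain ⟨k, -, rfl⟩ := Finset.mem_image.1 h
    exact hdisj k ha
  have hd : Disjoint (A.erase a) (Finset.univ.image b) := by
    rw [Finset.disjoint_right]
    intro x hx
    obtain ⟨k, -, rfl⟩ := Finset.mem_image.1 hx
    exact fun h => hdisj k (Finset.mem_of_mem_erase h)
  have he : (A ∪ Finset.univ.image b).erase a = A.erase a ∪ Finset.univ.image b := by
    rw [Finset.erase_union_distrib, Finset.erase_eq_of_notMem hab]
  rw [f1, f2, ← Finset.prod_union hd, ← he, ← Finset.prod_sdiff (s₁ := Finset.univ.image w)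
    (s₂ := (A ∪ Finset.univ.image b).erase a), mul_comm]
  intro x hx
  obtain ⟨l, -, rfl⟩ := Finset.mem_image.1 hx
  exact Finset.mem_erase.2 ⟨hwa l, hw l⟩

section Interpolation

variable {q β : ℂ} {A : Finset ℂ} {n : ℕ} {b w : Fin n → ℂ}

/-- The `w l` drop out of the top coefficient. After summation over `w` it therefore multiplies the
residue sum `resSum q β A b` with one parameter fewer. -/
theorem isTrig_ownTerm (hq : q ≠ 0) (hw : ∀ l, w l ≠ 0) :
    IsTrig (2 * n + 1 + A.card) ((br q)⁻¹ * (β * q ^ n * ∏ a ∈ A, q / a)) (ownTerm q β A w) := by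
  have h1 : IsTrig (Finset.univ.card * 2) (∏ l : Fin n, (w l)⁻¹ * (q * w l))
      fun z => ∏ l, br ((w l)⁻¹ * z) * br (q * w l * z) :=
    IsTrig.prod _ fun l _ => (IsTrig.br_mul (w l)⁻¹).mul (IsTrig.br_mul (q * w l))
  have h2 : IsTrig (A.card * 1) (∏ a ∈ A, q / a) fun z => ∏ a ∈ A, br (q / a * z) :=
    IsTrig.prod _ fun a _ => IsTrig.br_mul (q / a)
  have h3 := ((((IsTrig.br_mul β).mul h1).mul h2)).const_mul (br q)⁻¹
  have e : ∏ l : Fin n, (w l)⁻¹ * (q * w l) = q ^ n := by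
    rw [Finset.prod_congr rfl (g := fun _ => q)]
    · simp
    · intro l _
      have := hw l
      field_simp
  rw [e] at h3
  have e2 : 1 + (Finset.univ : Finset (Fin n)).card * 2 + A.card * 1 = 2 * n + 1 + A.card := by
    rw [Finset.card_univ, Fintype.card_fin]; ring
  rw [e2] at h3
  exact h3

/-- The degree is `2 (|A| - 1)` from `A \ {a}` plus `(|A| + n - 1) - n` from the elements that are
not among the `w l`. -/
theorem isTrig_otherTerm (hw : ∀ l, w l ∈ A ∪ Finset.univ.image b)
    (hinj : Function.Injective w) (hb : Function.Injective b) (hdisj : ∀ k, b k ∉ A) {a : ℂ}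
    (ha : a ∈ A) (hwa : ∀ l, w l ≠ a) :
    ∃ l, IsTrig (3 * (A.card - 1)) l (otherTerm q A b w a) := by
  have h1 := IsTrig.prod (A.erase a) fun x _ => (IsTrig.br_div x).mul (IsTrig.br_mul (q / x))
  have h2 := IsTrig.prod (((A ∪ Finset.univ.image b).erase a) \ Finset.univ.image w)
    fun y _ => IsTrig.br_mul (q ^ 2 * y)
  have e : (A.erase a).card * (1 + 1) +
      (((A ∪ Finset.univ.image b).erase a) \ Finset.univ.image w).card * 1 = 3 * (A.card - 1) := by
    have hd : Disjoint A (Finset.univ.image b) := by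
      rw [Finset.disjoint_right]
      intro x hx
      obtain ⟨k, -, rfl⟩ := Finset.mem_image.1 hx
      exact hdisj k
    rw [Finset.card_sdiff_of_subset, Finset.card_erase_of_mem ha,
      Finset.card_erase_of_mem (Finset.mem_union_left _ ha), Finset.card_union_of_disjoint hd,
      Finset.card_image_of_injective _ hb, Finset.card_image_of_injective _ hinj,
      Finset.card_univ, Fintype.card_fin]
    · have : 0 < A.card := Finset.card_pos.2 ⟨a, ha⟩
      omega
    · intro x hx
      obtain ⟨l, -, rfl⟩ := Finset.mem_image.1 hx
      exact Finset.mem_erase.2 ⟨hwa l, hw l⟩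
  have h3 := h1.mul h2
  rw [e] at h3
  exact ⟨_, h3⟩

theorem isTrig_valTerm :
    IsTrig (2 * n + 1 + A.card) ((br q)⁻¹ * (-1) ^ A.card *
      ((∏ k, (b k)⁻¹) * (q * β) * (∏ a ∈ A, -a⁻¹) * ∏ k, q ^ 2 * b k)) (valTerm q β A b) := by
  have h1 : IsTrig (Finset.univ.card * 1) (∏ k, (b k)⁻¹) fun z => ∏ k, br ((b k)⁻¹ * z) :=
    IsTrig.prod _ fun k _ => IsTrig.br_mul (b k)⁻¹
  have h2 : IsTrig (A.card * 1) (∏ a ∈ A, -a⁻¹) fun z => ∏ a ∈ A, br (a / z) :=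
    IsTrig.prod _ fun a _ => IsTrig.br_div a
  have h3 : IsTrig (Finset.univ.card * 1) (∏ k, q ^ 2 * b k) fun z => ∏ k, br (q ^ 2 * b k * z) :=
    IsTrig.prod _ fun k _ => IsTrig.br_mul (q ^ 2 * b k)
  have h4 := ((((h1.mul (IsTrig.br_mul (q * β))).mul h2)).mul h3).const_mul
    ((br q)⁻¹ * (-1) ^ A.card)
  have e2 : (Finset.univ : Finset (Fin n)).card * 1 + 1 + A.card * 1 +
      (Finset.univ : Finset (Fin n)).card * 1 = 2 * n + 1 + A.card := by
    rw [Finset.card_univ, Fintype.card_fin]; ring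
  rw [e2] at h4
  exact h4

theorem Generic.br_q_ne_zero {S : Finset ℂ} (hG : Generic q S) {x : ℂ} (hx : x ∈ S) :
    br q ≠ 0 := by
  have := hG.br_q_div x hx x hx
  rwa [mul_div_assoc, div_self (hG.ne_zero x hx), mul_one] at this

theorem Generic.q_ne_zero {S : Finset ℂ} (hG : Generic q S) {x : ℂ} (hx : x ∈ S) :
    q ≠ 0 := by
  rintro rfl
  exact hG.br_q_ne_zero hx br_zero

/-- The terms at `b₀ = a` cancel. -/
theorem ownTerm_add_otherTerm_eq_zero (hG : Generic q (A ∪ Finset.univ.image b))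
    (hw : ∀ l, w l ∈ A ∪ Finset.univ.image b) (hinj : Function.Injective w)
    (hb : Function.Injective b) (hdisj : ∀ k, b k ∉ A) {a : ℂ} (ha : a ∈ A) :
    ownTerm q β A w a + ∑ x ∈ A, otherCoeff q β A b w x * otherTerm q A b w x a = 0 := by
  have ha0 : a ≠ 0 := hG.ne_zero _ (by simp [ha])
  rw [Finset.sum_eq_single_of_mem a ha]
  swap
  · intro x hx hxa
    rw [otherTerm, Finset.prod_eq_zero (i := a) (Finset.mem_erase.2 ⟨hxa.symm, ha⟩)]
    · simp
    · rw [br_div_self, zero_mul]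
  by_cases hwa : ∃ l, w l = a
  · rw [otherCoeff_eq_zero q β A b w hwa, zero_mul, add_zero]
    obtain ⟨l, rfl⟩ := hwa
    rw [ownTerm, Finset.prod_eq_zero (Finset.mem_univ l)]
    · simp
    · rw [inv_mul_cancel₀ ha0, br_one, zero_mul]
  push Not at hwa
  have hA : ∀ x ∈ A, x ∈ A ∪ Finset.univ.image b := fun x hx => by simp [hx]
  -- This makes the brackets `[q² y a]` of `otherTerm` cancel those in the denominator of
  -- `otherCoeff`. What is left is the negative of `ownTerm`: the residues at `b₀` and at `a` cancel
  -- when the two points collide.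
  have key := prod_erase_mul_prod (fun y => br (q ^ 2 * y * a)) hw hinj hb hdisj ha hwa
  have hq := hG.br_q_ne_zero (hA a ha)
  have h1 : ∏ x ∈ A.erase a, br (x / a) ≠ 0 := Finset.prod_ne_zero_iff.2 fun x hx =>
    hG.br_div _ (hA x (Finset.mem_of_mem_erase hx)) _ (hA a ha) (Finset.ne_of_mem_erase hx)
  have h2 : ∏ x ∈ A.erase a, br (q ^ 2 * x * a) ≠ 0 := Finset.prod_ne_zero_iff.2 fun x hx =>
    hG.br_q_mul _ (hA x (Finset.mem_of_mem_erase hx)) _ (hA a ha)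
  have h3 : ∏ k, br (q ^ 2 * b k * a) ≠ 0 := Finset.prod_ne_zero_iff.2 fun k _ =>
    hG.br_q_mul _ (by simp) _ (hA a ha)
  have e1 : ∏ l, br ((w l)⁻¹ * a) * br (q * w l * a) =
      (∏ l, br (a / w l)) * ∏ l, br (q * a * w l) := by
    rw [← Finset.prod_mul_distrib]
    exact Finset.prod_congr rfl fun l _ => by
      rw [div_eq_mul_inv, mul_comm a, mul_right_comm q a]
  have e2 : ∏ l, br (q ^ 2 * a * w l) = ∏ l, br (q ^ 2 * w l * a) :=
    Finset.prod_congr rfl fun l _ => by rw [mul_right_comm]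
  have e3 : ∏ x ∈ A, br (q / x * a) = br q * ∏ x ∈ A.erase a, br (q / x * a) := by
    rw [← Finset.mul_prod_erase A (fun x => br (q / x * a)) ha, div_mul_cancel₀ _ ha0]
  rw [ownTerm, otherCoeff, otherTerm, e1, e3]
  simp only [Finset.prod_mul_distrib, e2]
  simp only at key
  generalize ∏ x ∈ A.erase a, br (x / a) = p1 at *
  generalize ∏ x ∈ A.erase a, br (q ^ 2 * x * a) = p2 at *
  generalize ∏ k, br (q ^ 2 * b k * a) = p3 at *
  generalize ∏ l, br (q ^ 2 * w l * a) = p4 at *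
  generalize ∏ l, br (a / w l) = p5 at *
  generalize ∏ l, br (q * a * w l) = p6 at *
  generalize ∏ x ∈ A.erase a, br (q / x * a) = p7 at *
  generalize ∏ y ∈ ((A ∪ Finset.univ.image b).erase a) \ Finset.univ.image w,
    br (q ^ 2 * y * a) = p8 at *
  have : -(br (β * a) * (p5 * p6 * p4) / (p1 * p2 * p3)) * (p1 * p7 * p8) =
      -(br (β * a) * p5 * p6 * p7) * ((p4 * p8) / (p2 * p3)) := by field_simp
  rw [this, ← key, div_self (mul_ne_zero h2 h3)]
  field_simp
  ring

theorem resWeight_erase {a b₀ x : ℂ} (ha : a ∈ A) (hab : a ≠ b₀) (hxa : x ≠ a) :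
    resWeight q β A b b₀ x =
      resWeight q β (A.erase a) b b₀ x * (br (a / x) * br (q ^ 2 * a * x))⁻¹ := by
  have e : (insert b₀ A).erase x = insert a ((insert b₀ (A.erase a)).erase x) := by
    ext y
    simp only [Finset.mem_erase, Finset.mem_insert]
    constructor
    · rintro ⟨h1, h2⟩
      by_cases hy : y = a
      · exact .inl hy
      · exact .inr ⟨h1, h2.imp_right fun h => ⟨hy, h⟩⟩
    · rintro (rfl | ⟨h1, h2⟩)
      · exact ⟨hxa.symm, .inr ha⟩
      · exact ⟨h1, h2.imp_right fun h => h.2⟩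
  have hn : a ∉ (insert b₀ (A.erase a)).erase x := by
    simp [hab]
  rw [resWeight, resWeight, e, Finset.prod_insert hn,
    ← Finset.mul_prod_erase A (fun a => br (q ^ 2 * a * x)) ha]
  simp only [div_eq_mul_inv, mul_inv]
  ring

/-- The sum at `b₀ = a / q` is a residue sum with fewer parameters. -/
theorem sum_terms_div (hG : Generic q (A ∪ Finset.univ.image b))
    (hb : Function.Injective b) (hdisj : ∀ k, b k ∉ A) {a : ℂ} (ha : a ∈ A) :
    (∑ w ∈ Fintype.piFinset fun i => insert (b i) A,
      (antisymProd q w * ∏ i, resWeight q β A b (b i) (w i)) *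
      (ownTerm q β A w (a / q) +
        ∑ x ∈ A, otherCoeff q β A b w x * otherTerm q A b w x (a / q))) =
    -(br (β * a) * ((∏ x ∈ A.erase a, br (q * x / a) * br (a / x) * br (q * x * a) /
      (br (x / a) * br (q ^ 2 * x * a))) * ∏ k, br (q * b k * a) / br (q ^ 2 * b k * a))) *
      resSum q β (A.erase a) b := by
  have hA : ∀ x ∈ A, x ∈ A ∪ Finset.univ.image b := fun x hx => by simp [hx]
  have hq0 := hG.q_ne_zero (hA a ha)
  have ha0 : a ≠ 0 := hG.ne_zero _ (hA a ha)
  have hqa : q / a * (a / q) = 1 := by field_simp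
  have hsub : (Fintype.piFinset fun i => insert (b i) (A.erase a)) ⊆
      Fintype.piFinset fun i => insert (b i) A :=
    Fintype.piFinset_subset _ _ fun i => Finset.insert_subset_insert _ (Finset.erase_subset _ _)
  have hterm : ∀ w : Fin n → ℂ, ownTerm q β A w (a / q) +
      ∑ x ∈ A, otherCoeff q β A b w x * otherTerm q A b w x (a / q) =
      otherCoeff q β A b w a * otherTerm q A b w a (a / q) := by
    intro w
    -- At `b₀ = a / q` the bracket `[q b₀ / a] = [1]` kills every term that contains it, so only the
    -- residue at `x = a` remains.
    rw [ownTerm, Finset.prod_eq_zero ha (by rw [hqa, br_one]), mul_zero, mul_zero, zero_add,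
      Finset.sum_eq_single_of_mem a ha]
    intro x hx hxa
    rw [otherTerm, Finset.prod_eq_zero (i := a) (Finset.mem_erase.2 ⟨hxa.symm, ha⟩)]
    · simp
    · rw [hqa, br_one, mul_zero]
  simp_rw [hterm]
  -- Since one variable sits at `a`, configurations in which another one does contribute 0. The
  -- others range over `A \ {a}`.
  rw [← Finset.sum_subset hsub, resSum, Finset.mul_sum]
  swap
  · intro w hw hw'
    have : ∃ l, w l = a := by
      by_contra! h
      refine hw' (Fintype.mem_piFinset.2 fun i => ?_)
      rcases Finset.mem_insert.1 (Fintype.mem_piFinset.1 hw i) with h1 | h1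
      · simp [h1]
      · exact Finset.mem_insert_of_mem (Finset.mem_erase.2 ⟨h i, h1⟩)
    rw [otherCoeff_eq_zero q β A b w this]
    simp
  refine Finset.sum_congr rfl fun w hw => ?_
  by_cases hinj : Function.Injective w
  swap
  · rw [antisymProd_eq_zero q w hinj]
    simp
  have hab : ∀ i, a ≠ b i := by
    rintro i rfl
    exact hdisj i ha
  have hwa : ∀ l, w l ≠ a := by
    intro l h
    rcases Finset.mem_insert.1 (Fintype.mem_piFinset.1 hw l) with h1 | h1
    · exact hab l (h ▸ h1)
    · exact Finset.ne_of_mem_erase h1 h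
  have hw' : ∀ l, w l ∈ A ∪ Finset.univ.image b := by
    intro l
    rcases Finset.mem_insert.1 (Fintype.mem_piFinset.1 hw l) with h1 | h1
    · rw [h1]; simp
    · exact hA _ (Finset.mem_of_mem_erase h1)
  have key := prod_erase_mul_prod (fun y => br (q * y * a)) hw' hinj hb hdisj ha hwa
  have e0 : ∏ i, resWeight q β A b (b i) (w i) = (∏ i, resWeight q β (A.erase a) b (b i) (w i)) *
      ((∏ i, br (a / w i)) * ∏ i, br (q ^ 2 * a * w i))⁻¹ := by
    rw [← Finset.prod_mul_distrib, ← Finset.prod_inv_distrib, ← Finset.prod_mul_distrib]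
    exact Finset.prod_congr rfl fun i _ => resWeight_erase ha (hab i) (hwa i)
  have h1 : ∏ i, br (a / w i) ≠ 0 := Finset.prod_ne_zero_iff.2 fun i _ =>
    hG.br_div _ (hA a ha) _ (hw' i) (hwa i).symm
  have h2 : ∏ i, br (q ^ 2 * a * w i) ≠ 0 := Finset.prod_ne_zero_iff.2 fun i _ =>
    hG.br_q_mul _ (hA a ha) _ (hw' i)
  have e1 : ∏ x ∈ A.erase a, br (x / (a / q)) = ∏ x ∈ A.erase a, br (q * x / a) :=
    Finset.prod_congr rfl fun x _ => by rw [div_div_eq_mul_div, mul_comm]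
  have e2 : ∏ x ∈ A.erase a, br (q / x * (a / q)) = ∏ x ∈ A.erase a, br (a / x) :=
    Finset.prod_congr rfl fun x _ => by congr 1; field_simp
  have e3 : ∀ s : Finset ℂ, ∏ y ∈ s, br (q ^ 2 * y * (a / q)) = ∏ y ∈ s, br (q * y * a) :=
    fun s => Finset.prod_congr rfl fun x _ => by congr 1; field_simp
  have e4 : ∏ l, br (q * w l * a) = ∏ l, br (q * a * w l) :=
    Finset.prod_congr rfl fun l _ => by rw [mul_right_comm]
  rw [otherCoeff, otherTerm, e0]
  simp only [Finset.prod_mul_distrib, Finset.prod_div_distrib, e1, e2, e3]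
  simp only [e4] at key
  generalize ∏ i, resWeight q β (A.erase a) b (b i) (w i) = r at *
  generalize ∏ i, br (a / w i) = p1 at *
  generalize ∏ i, br (q ^ 2 * a * w i) = p2 at *
  generalize ∏ l, br (q * a * w l) = p3 at *
  generalize ∏ y ∈ ((A ∪ Finset.univ.image b).erase a) \ Finset.univ.image w,
    br (q * y * a) = p4 at *
  generalize ∏ x ∈ A.erase a, br (q * x * a) = p5 at *
  generalize ∏ k, br (q * b k * a) = p6 at *
  simp only [div_eq_mul_inv, mul_inv]
  linear_combination (exp := 1) (-antisymProd q w * r * br (β * a) *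
    (∏ x ∈ A.erase a, br (x * a⁻¹))⁻¹ * (∏ x ∈ A.erase a, br (q ^ 2 * x * a))⁻¹ *
    (∏ k, br (q ^ 2 * b k * a))⁻¹ * (∏ x ∈ A.erase a, br (q * x * a⁻¹)) *
    (∏ x ∈ A.erase a, br (a * x⁻¹))) * (p3 * p4 * (mul_inv_cancel₀ (mul_ne_zero h1 h2)) - key)

end Interpolation

/-! ### Zeros and degree of the difference between the residue sum and the product -/

section Evaluation

variable {q β : ℂ} {A : Finset ℂ} {n : ℕ} {b : Fin n → ℂ}

/-- At `b₀ = a / q`, `valTerm` obeys the same recursion as the sum of the terms. -/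
theorem valTerm_div (hG : Generic q (A ∪ Finset.univ.image b)) {a : ℂ} (ha : a ∈ A) :
    valTerm q β A b (a / q) * resVal q β A b =
      -(br (β * a) * ((∏ x ∈ A.erase a, br (q * x / a) * br (a / x) * br (q * x * a) /
        (br (x / a) * br (q ^ 2 * x * a))) * ∏ k, br (q * b k * a) / br (q ^ 2 * b k * a))) *
        resVal q β (A.erase a) b := by
  have hA : ∀ x ∈ A, x ∈ A ∪ Finset.univ.image b := fun x hx => by simp [hx]
  have hq0 := hG.q_ne_zero (hA a ha)
  have hq := hG.br_q_ne_zero (hA a ha)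
  have ha0 : a ≠ 0 := hG.ne_zero _ (hA a ha)
  have hb0 : ∀ k, b k ≠ 0 := fun k => hG.ne_zero _ (by simp)
  have h1 : ∏ k, br (a / (q * b k)) ≠ 0 := Finset.prod_ne_zero_iff.2 fun k _ => by
    rw [br_div_comm]
    exact neg_ne_zero.2 (hG.br_q_div _ (by simp) _ (hA a ha))
  have h2 : ∀ x ∈ A.erase a, br (a / x) ≠ 0 := fun x hx =>
    hG.br_div _ (hA a ha) _ (hA x (Finset.mem_of_mem_erase hx)) (Finset.ne_of_mem_erase hx).symm
  have e1 : ∏ k, br ((b k)⁻¹ * (a / q)) = ∏ k, br (a / (q * b k)) :=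
    Finset.prod_congr rfl fun k _ => by
      have := hb0 k
      congr 1
      field_simp
  have e2 : ∏ x ∈ A, br (x / (a / q)) = br q * ∏ x ∈ A.erase a, br (q * x / a) := by
    rw [← Finset.mul_prod_erase A _ ha, div_div_cancel₀ ha0]
    congr 1
    exact Finset.prod_congr rfl fun x _ => by rw [div_div_eq_mul_div, mul_comm]
  have e3 : ∏ k, br (q ^ 2 * b k * (a / q)) = ∏ k, br (q * b k * a) :=
    Finset.prod_congr rfl fun x _ => by congr 1; field_simp
  have e4 : q * β * (a / q) = β * a := by field_simp
  have e5 : ∏ x ∈ A.erase a, br (q * x / a) * br (a / x) * br (q * x * a) /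
      (br (x / a) * br (q ^ 2 * x * a)) = (-1) ^ (A.erase a).card *
      ((∏ x ∈ A.erase a, br (q * x / a)) *
        ∏ x ∈ A.erase a, br (q * (a * x)) / br (q ^ 2 * (a * x))) := by
    rw [← Finset.prod_const, ← Finset.prod_mul_distrib, ← Finset.prod_mul_distrib]
    refine Finset.prod_congr rfl fun x hx => ?_
    have := h2 x hx
    rw [br_div_comm x a, mul_assoc q x a, mul_assoc (q ^ 2) x a, mul_comm x a]
    field_simp
  have e6 : ∏ i, br (q ^ 2 * a * b i) = ∏ i, br (q ^ 2 * b i * a) :=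
    Finset.prod_congr rfl fun x _ => by rw [mul_right_comm]
  have e7 : (-1 : ℂ) ^ A.card = -(-1) ^ (A.erase a).card := by
    rw [← Finset.card_erase_add_one ha, pow_succ]
    ring
  rw [resVal_erase q β b ha, valTerm, e1, e2, e3, e4, e5, e7]
  simp only [Finset.prod_mul_distrib, Finset.prod_div_distrib, e6]
  generalize ∏ k, br (a / (q * b k)) = p1 at *
  generalize ∏ x ∈ A.erase a, br (q * (a * x)) = p2
  generalize ∏ x ∈ A.erase a, br (q ^ 2 * (a * x)) = p3
  generalize ∏ k, br (q ^ 2 * b k * a) = p4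
  generalize br q = t at *
  field_simp

/-- The interpolation nodes. -/
def nodes (q : ℂ) (A : Finset ℂ) {n : ℕ} (b : Fin n → ℂ) : Finset ℂ :=
  (A ∪ Finset.univ.image b) ∪ A.image fun a => a / q

theorem sq_ne_sq_of_br_div {x y : ℂ} (hy : y ≠ 0) (h : br (x / y) ≠ 0) : x ^ 2 ≠ y ^ 2 := by
  intro hxy
  have hx : x ≠ 0 := by
    rintro rfl
    exact pow_ne_zero 2 hy (by rw [← hxy]; simp)
  refine h ((br_eq_zero_iff (div_ne_zero hx hy)).2 ?_)
  rw [div_pow, hxy, div_self (pow_ne_zero 2 hy)]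

theorem Generic.sq_ne_sq {S : Finset ℂ} (hG : Generic q S) {x y : ℂ} (hx : x ∈ S) (hy : y ∈ S)
    (hxy : x ≠ y) : x ^ 2 ≠ y ^ 2 :=
  sq_ne_sq_of_br_div (hG.ne_zero y hy) (hG.br_div x hx y hy hxy)

theorem Generic.sq_ne_sq_div {S : Finset ℂ} (hG : Generic q S) {x y : ℂ} (hx : x ∈ S)
    (hy : y ∈ S) : x ^ 2 ≠ (y / q) ^ 2 := by
  have h := sq_ne_sq_of_br_div (hG.ne_zero y hy) (hG.br_q_div x hx y hy)
  have hq := hG.q_ne_zero hx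
  intro h2
  apply h
  rw [mul_pow, h2]
  field_simp

theorem nodes_sq_ne (hG : Generic q (A ∪ Finset.univ.image b)) {x y : ℂ} (hx : x ∈ nodes q A b)
    (hy : y ∈ nodes q A b) (hxy : x ≠ y) : x ^ 2 ≠ y ^ 2 := by
  have hA : ∀ x ∈ A, x ∈ A ∪ Finset.univ.image b := fun x hx => by simp [hx]
  rcases Finset.mem_union.1 hx with hx | hx <;> rcases Finset.mem_union.1 hy with hy | hy
  · exact hG.sq_ne_sq hx hy hxy
  · obtain ⟨a, ha, rfl⟩ := Finset.mem_image.1 hy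
    exact hG.sq_ne_sq_div hx (hA a ha)
  · obtain ⟨a, ha, rfl⟩ := Finset.mem_image.1 hx
    exact (hG.sq_ne_sq_div hy (hA a ha)).symm
  · obtain ⟨a, ha, rfl⟩ := Finset.mem_image.1 hx
    obtain ⟨a', ha', rfl⟩ := Finset.mem_image.1 hy
    have hq := hG.q_ne_zero (hA a ha)
    have := hG.sq_ne_sq (hA a ha) (hA a' ha') fun h => hxy (by rw [h])
    intro h
    apply this
    rw [div_pow, div_pow] at h
    field_simp at h
    exact h

theorem card_nodes (hG : Generic q (A ∪ Finset.univ.image b)) (hb : Function.Injective b)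
    (hdisj : ∀ k, b k ∉ A) : (nodes q A b).card = 2 * A.card + n := by
  have hA : ∀ x ∈ A, x ∈ A ∪ Finset.univ.image b := fun x hx => by simp [hx]
  have hd : Disjoint A (Finset.univ.image b) := by
    rw [Finset.disjoint_right]
    intro x hx
    obtain ⟨k, -, rfl⟩ := Finset.mem_image.1 hx
    exact hdisj k
  have hd' : Disjoint (A ∪ Finset.univ.image b) (A.image fun a => a / q) := by
    rw [Finset.disjoint_right]
    intro x hx hx'
    obtain ⟨a, ha, rfl⟩ := Finset.mem_image.1 hx
    exact hG.sq_ne_sq_div hx' (hA a ha) rfl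
  rw [nodes, Finset.card_union_of_disjoint hd', Finset.card_union_of_disjoint hd,
    Finset.card_image_of_injective _ hb, Finset.card_image_of_injOn, Finset.card_univ,
    Fintype.card_fin]
  · ring
  · intro x hx y hy hxy
    have hq := hG.q_ne_zero (hA x hx)
    exact (div_left_inj' hq).1 hxy

theorem nodes_ne_zero (hG : Generic q (A ∪ Finset.univ.image b)) {x : ℂ} (hx : x ∈ nodes q A b) :
    x ≠ 0 := by
  rcases Finset.mem_union.1 hx with hx | hx
  · exact hG.ne_zero x hx
  · obtain ⟨a, ha, rfl⟩ := Finset.mem_image.1 hx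
    have ha' : a ∈ A ∪ Finset.univ.image b := by simp [ha]
    exact div_ne_zero (hG.ne_zero a ha') (hG.q_ne_zero ha')

/-- The difference between the two sides of the product formula, with denominators cleared. -/
def gap (q β : ℂ) (A : Finset ℂ) {n : ℕ} (b : Fin n → ℂ) (b₀ : ℂ) : ℂ :=
  (∑ w ∈ Fintype.piFinset fun i => insert (b i) A,
    (antisymProd q w * ∏ i, resWeight q β A b (b i) (w i)) *
      (ownTerm q β A w b₀ + ∑ a ∈ A, otherCoeff q β A b w a * otherTerm q A b w a b₀)) -
    valTerm q β A b b₀ * resVal q β A b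

/-- There are three kinds of nodes. For `x ∈ A` two residues cancel and `valTerm` contains `[x/x]`.
For `x = b k` antisymmetry applies and `valTerm` contains `[1]`. For `x = a / q` both sides obey the
same recursion to `A \ {a}`, where `ih` applies. -/
theorem gap_eq_zero_of_mem_nodes (hG : Generic q (A ∪ Finset.univ.image b))
    (hb : Function.Injective b) (hdisj : ∀ k, b k ∉ A)
    (ih : ∀ a ∈ A, resSum q β (A.erase a) b = resVal q β (A.erase a) b) {x : ℂ}
    (hx : x ∈ nodes q A b) : gap q β A b x = 0 := by
  rw [nodes, Finset.mem_union, Finset.mem_union] at hx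
  rcases hx with (hx | hx) | hx
  · have h1 : valTerm q β A b x = 0 := by
      rw [valTerm, Finset.prod_eq_zero (s := A) hx (br_div_self x)]
      simp
    rw [gap, h1, zero_mul, sub_zero]
    refine Finset.sum_eq_zero fun w hw => ?_
    by_cases hinj : Function.Injective w
    · rw [ownTerm_add_otherTerm_eq_zero hG _ hinj hb hdisj hx, mul_zero]
      intro l
      rcases Finset.mem_insert.1 (Fintype.mem_piFinset.1 hw l) with h1 | h1
      · rw [h1]; simp
      · simp [h1]
    · rw [antisymProd_eq_zero q w hinj]
      simp
  · have hG' : Generic q (insert x (A ∪ Finset.univ.image b)) := by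
      rwa [Finset.insert_eq_of_mem (Finset.mem_union_right _ hx)]
    obtain ⟨k, -, rfl⟩ := Finset.mem_image.1 hx
    have h1 : valTerm q β A b (b k) = 0 := by
      rw [valTerm, Finset.prod_eq_zero (Finset.mem_univ k)]
      · simp
      · rw [inv_mul_cancel₀ (hG.ne_zero _ (by simp)), br_one]
    rw [gap, h1, zero_mul, sub_zero, ← clearing_mul_resSum hG' (hdisj k) hb hdisj,
      resSum_eq_zero q β A _ (i := 0) (j := k.succ), mul_zero]
    · exact (Fin.succ_ne_zero k).symm
    · simp
  · obtain ⟨a, ha, rfl⟩ := Finset.mem_image.1 hx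
    rw [gap, sum_terms_div hG hb hdisj ha, valTerm_div hG ha, ih a ha, sub_self]

/-- Both `ownTerm` and `valTerm` have degree `2n + 1 + |A|`, whereas `otherTerm` has degree `3 (|A|
- 1)`. For `|A| = n + 2` these are equal. For `|A| = n + 1` the latter is two lower, so the top
coefficient of `gap` is proportional to `resSum q β A b - resVal q β A b`, which vanishes by
assumption. -/
theorem isTrig_gap (hG : Generic q (A ∪ Finset.univ.image b)) (hA : A.Nonempty)
    (hb : Function.Injective b) (hdisj : ∀ k, b k ∉ A)
    (h : A.card = n + 2 ∨ A.card = n + 1 ∧ resSum q β A b = resVal q β A b) :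
    ∃ l, IsTrig (2 * n + 1 + A.card) l (gap q β A b) ∧ (A.card = n + 1 → l = 0) := by
  obtain ⟨a₀, ha₀⟩ := hA
  have hq0 := hG.q_ne_zero (show a₀ ∈ A ∪ Finset.univ.image b by simp [ha₀])
  have hb0 : ∀ k, b k ≠ 0 := fun k => hG.ne_zero _ (by simp)
  have h1 : ∀ w ∈ Fintype.piFinset fun i => insert (b i) A, Function.Injective w →
      ∀ a ∈ A, ∃ l, IsTrig (2 * n + 1 + A.card) l
        (fun z => otherCoeff q β A b w a * otherTerm q A b w a z) ∧ (A.card = n + 1 → l = 0) := by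
    intro w hw hinj a ha
    by_cases hwa : ∃ l, w l = a
    · rw [otherCoeff_eq_zero q β A b w hwa]
      simp only [zero_mul]
      exact ⟨0, IsTrig.zero _, fun _ => rfl⟩
    push Not at hwa
    obtain ⟨l, hl⟩ := isTrig_otherTerm (q := q) (A := A) (b := b) (w := w) (fun l => by
      rcases Finset.mem_insert.1 (Fintype.mem_piFinset.1 hw l) with h1 | h1
      · rw [h1]; simp
      · simp [h1]) hinj hb hdisj ha hwa
    rcases h with h | ⟨h, -⟩
    · refine ⟨otherCoeff q β A b w a * l, ?_, fun h' => absurd (h.symm.trans h') (by omega)⟩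
      have := hl.const_mul (otherCoeff q β A b w a)
      convert this using 1
      omega
    · refine ⟨0, ?_, fun _ => rfl⟩
      have := (hl.const_mul (otherCoeff q β A b w a)).raise
      convert this using 1
      omega
  have h2 : ∀ w ∈ Fintype.piFinset fun i => insert (b i) A, ∃ l, IsTrig (2 * n + 1 + A.card) l
      (fun z => (antisymProd q w * ∏ i, resWeight q β A b (b i) (w i)) *
      (ownTerm q β A w z + ∑ a ∈ A, otherCoeff q β A b w a * otherTerm q A b w a z)) ∧
      (A.card = n + 1 → l = (antisymProd q w * ∏ i, resWeight q β A b (b i) (w i)) *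
        ((br q)⁻¹ * (β * q ^ n * ∏ a ∈ A, q / a))) := by
    intro w hw
    by_cases hinj : Function.Injective w
    · choose! l hl hl0 using h1 w hw hinj
      have hw0 : ∀ l, w l ≠ 0 := by
        intro l
        rcases Finset.mem_insert.1 (Fintype.mem_piFinset.1 hw l) with h1 | h1
        · rw [h1]; exact hb0 l
        · exact hG.ne_zero _ (by simp [h1])
      refine ⟨_, ((isTrig_ownTerm hq0 hw0).add (IsTrig.sum A hl)).const_mul _, fun hc => ?_⟩
      rw [Finset.sum_eq_zero fun a ha => hl0 a ha hc, add_zero]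
    · rw [antisymProd_eq_zero q w hinj]
      simp only [zero_mul]
      exact ⟨0, IsTrig.zero _, fun _ => rfl⟩
  choose! l hl hl0 using h2
  have h3 := (IsTrig.sum _ hl).sub ((isTrig_valTerm (q := q) (β := β) (A := A)
    (b := b)).const_mul (resVal q β A b))
  refine ⟨_, h3.congr fun z => ?_, fun hc => ?_⟩
  · rw [gap, mul_comm (valTerm q β A b z)]
  · have hJ : resSum q β A b = resVal q β A b := by
      rcases h with h | ⟨-, h⟩
      · omega
      · exact h
    rw [Finset.sum_congr rfl fun w hw => hl0 w hw hc, ← Finset.sum_mul, ← resSum, hJ]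
    have e1 : ∏ a ∈ A, q / a = q ^ (n + 1) * ∏ a ∈ A, a⁻¹ := by
      rw [← hc, ← Finset.prod_const, ← Finset.prod_mul_distrib]
      rfl
    have e2 : (-1) ^ A.card * ∏ a ∈ A, -a⁻¹ = ∏ a ∈ A, a⁻¹ := by
      rw [← Finset.prod_const, ← Finset.prod_mul_distrib]
      simp
    have e3 : (∏ k, (b k)⁻¹) * ∏ k, q ^ 2 * b k = q ^ (2 * n) := by
      rw [← Finset.prod_mul_distrib, Finset.prod_congr rfl (g := fun _ => q ^ 2)]
      · simp [pow_mul]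
      · intro k _
        have := hb0 k
        field_simp
    rw [e1]
    linear_combination (-resVal q β A b * (br q)⁻¹ * (∏ k, (b k)⁻¹) * (q * β) *
      (∏ k, q ^ 2 * b k)) * e2 - (resVal q β A b * (br q)⁻¹ * (q * β) * ∏ a ∈ A, a⁻¹) * e3

end Evaluation

/-- The residue sum of the last component is a product. -/
theorem resSum_eq_resVal {q β : ℂ} {n : ℕ} : ∀ {A : Finset ℂ} {b : Fin n → ℂ},
    Generic q (A ∪ Finset.univ.image b) → Function.Injective b → (∀ k, b k ∉ A) →
    (A.card = n ∨ A.card = n + 1) → resSum q β A b = resVal q β A b := by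
  induction n with
  | zero =>
    intro A b _ _ _ hc
    -- Here `A` has at most one element, so there are no pairs and both sides are 1.
    have h1 : A.powersetCard 2 = ∅ := Finset.powersetCard_eq_empty.2 (by omega)
    simp [resSum, resVal, pairRatio, h1, antisymProd]
  | succ n ih =>
    intro A b hG hb hdisj hc
    obtain ⟨b₀, b, rfl⟩ : ∃ (x : ℂ) (b' : Fin n → ℂ), b = Fin.cons x b' :=
      ⟨b 0, Fin.tail b, (Fin.cons_self_tail b).symm⟩
    have himg : Finset.univ.image (Fin.cons b₀ b : Fin (n + 1) → ℂ) =
        insert b₀ (Finset.univ.image b) := by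
      ext x
      simp [Fin.exists_fin_succ, eq_comm]
    rw [himg, Finset.union_insert] at hG
    have hb₀ : b₀ ∉ A := by simpa using hdisj 0
    have hdisj' : ∀ k, b k ∉ A := fun k => by simpa using hdisj k.succ
    have hb' : Function.Injective b := (Fin.cons_injective_iff.1 hb).2
    have hG' : Generic q (A ∪ Finset.univ.image b) := hG.mono (Finset.subset_insert _ _)
    have hA : A.Nonempty := Finset.card_pos.1 (by omega)
    have ih1 : ∀ a ∈ A, resSum q β (A.erase a) b = resVal q β (A.erase a) b := by
      intro a ha
      refine ih (hG'.mono ?_) hb' (fun k h => hdisj' k (Finset.mem_of_mem_erase h)) ?_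
      · exact Finset.union_subset_union_left (Finset.erase_subset _ _)
      · rw [Finset.card_erase_of_mem ha]
        omega
    have h0 : ∀ x ∈ nodes q A b, x ≠ 0 ∧ gap q β A b x = 0 := fun x hx =>
      ⟨nodes_ne_zero hG' hx, gap_eq_zero_of_mem_nodes hG' hb' hdisj' ih1 hx⟩
    have hb00 : b₀ ≠ 0 := hG.ne_zero _ (by simp)
    have hgap : gap q β A b b₀ = 0 := by
      rcases hc with hc | hc
      -- The degree and the number of nodes are both `3n + 2`, so the vanishing of the top
      -- coefficient is needed. It uses the induction hypothesis for `b` with `|A| = n + 1`; this is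
      -- why the two cardinalities are treated together.
      · obtain ⟨l, hl, hl0⟩ := isTrig_gap hG' hA hb' hdisj'
          (.inr ⟨hc, ih hG' hb' hdisj' (.inr hc)⟩)
        rw [hl0 hc] at hl
        refine hl.eq_zero_of_card_le (nodes q A b) ?_ (fun x hx y hy => nodes_sq_ne hG' hx hy) h0
          hb00
        rw [card_nodes hG' hb' hdisj']
        omega
      -- Here the degree is `3n + 3` and there are `3n + 4` nodes.
      · obtain ⟨l, hl, -⟩ := isTrig_gap (β := β) hG' hA hb' hdisj' (.inl hc)
        refine hl.eq_zero_of_card_lt (nodes q A b) ?_ (fun x hx y hy => nodes_sq_ne hG' hx hy) h0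
          hb00
        rw [card_nodes hG' hb' hdisj']
        omega
    have hclear : clearing q A b b₀ ≠ 0 := by
      refine mul_ne_zero (Finset.prod_ne_zero_iff.2 fun a ha => ?_)
        (Finset.prod_ne_zero_iff.2 fun k _ => hG.br_q_mul _ (by simp) _ (by simp))
      have ha' : a ∈ insert b₀ (A ∪ Finset.univ.image b) := by simp [ha]
      exact mul_ne_zero (mul_ne_zero
        (hG.br_div _ ha' _ (by simp) (by rintro rfl; exact hb₀ ha))
        (hG.br_q_mul _ ha' _ (by simp))) (hG.br_q_div _ (by simp) _ ha')
    rw [gap, sub_eq_zero, ← clearing_mul_resSum hG hb₀ hb' hdisj', ← clearing_mul_resVal β hG]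
      at hgap
    exact mul_left_cancel₀ hclear hgap

/-! ### Antisymmetrization of the integrand of the last component -/

/-- The weight of the variable `x` at the position `i`, with common factors removed. -/
def triWeight (q : ℂ) {n : ℕ} (b : Fin n → ℂ) (i : Fin n) (x : ℂ) : ℂ :=
  ∏ k, if i < k then br (b k / x) else if k < i then br (q * b k / x) else 1

/-- The weight of the variable `x` at the position `i` in the diagonal form. -/
def diagWeight (q : ℂ) {n : ℕ} (b : Fin n → ℂ) (i : Fin n) (x : ℂ) : ℂ :=
  ∏ k, if k = i then 1 else br (b k / x) * br (q * b k / x)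

/-- The antisymmetrization of the triangular weights. -/
def triSum (q : ℂ) {n : ℕ} (b w : Fin n → ℂ) : ℂ :=
  ∑ σ : Equiv.Perm (Fin n), (σ.sign : ℂ) *
    ((∏ i : Fin n, ∏ j ∈ Finset.Ioi i, br (q * w (σ j) / w (σ i))) *
      ∏ i, triWeight q b i (w (σ i)))

/-- The antisymmetrization of the diagonal weights, as a determinant. -/
def diagDet (q : ℂ) {n : ℕ} (b w : Fin n → ℂ) : ℂ :=
  Matrix.det (Matrix.of fun a i : Fin n => diagWeight q b i (w a))

theorem diagDet_eq_sum (q : ℂ) {n : ℕ} (b w : Fin n → ℂ) :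
    diagDet q b w = ∑ σ : Equiv.Perm (Fin n), (σ.sign : ℂ) * ∏ i, diagWeight q b i (w (σ i)) := by
  rw [diagDet, Matrix.det_apply']
  rfl

theorem diagDet_eq_zero (q : ℂ) {n : ℕ} (b w : Fin n → ℂ) {i j : Fin n} (hij : i ≠ j)
    (h : b i = b j) : diagDet q b w = 0 := by
  refine Matrix.det_zero_of_column_eq hij fun a => ?_
  simp only [Matrix.of_apply, diagWeight]
  rw [← Equiv.prod_comp (Equiv.swap i j)]
  refine Finset.prod_congr rfl fun k _ => ?_
  rcases eq_or_ne k i with rfl | h1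
  · rw [Equiv.swap_apply_left, h]
    simp [hij, hij.symm]
  rcases eq_or_ne k j with rfl | h2
  · simp
  · rw [Equiv.swap_apply_of_ne_of_ne h1 h2]
    simp [h1, h2]

/-- The variables that remain after `w p` has been put first. -/
def remaining {n : ℕ} (w : Fin (n + 1) → ℂ) (p : Fin (n + 1)) (j : Fin n) : ℂ :=
  w (Equiv.swap 0 p j.succ)

theorem sum_perm_succ {n : ℕ} (f : Equiv.Perm (Fin (n + 1)) → ℂ) :
    ∑ σ, f σ = ∑ p, ∑ e, f (Equiv.Perm.decomposeFin.symm (p, e)) := by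
  rw [← Equiv.sum_comp Equiv.Perm.decomposeFin.symm f, Fintype.sum_prod_type]

/-- Expansion according to the variable `w p` placed at the first position. The sign is that of the
transposition of `0` and `p`. -/
theorem triSum_cons (q : ℂ) {n : ℕ} (x : ℂ) (b : Fin n → ℂ) (w : Fin (n + 1) → ℂ) :
    triSum q (Fin.cons x b : Fin (n + 1) → ℂ) w = ∑ p, (if p = 0 then 1 else -1) *
      ((∏ j, br (q * remaining w p j / w p)) * (∏ k, br (b k / w p)) *
        (∏ j, br (q * x / remaining w p j)) * triSum q b (remaining w p)) := by
  rw [triSum, sum_perm_succ]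
  refine Finset.sum_congr rfl fun p _ => ?_
  rw [triSum, Finset.mul_sum, Finset.mul_sum]
  refine Finset.sum_congr rfl fun e _ => ?_
  have h1 : (∏ i : Fin (n + 1), ∏ j ∈ Finset.Ioi i,
      br (q * w (Equiv.Perm.decomposeFin.symm (p, e) j) /
        w (Equiv.Perm.decomposeFin.symm (p, e) i))) =
      (∏ j, br (q * remaining w p j / w p)) * ∏ i : Fin n, ∏ j ∈ Finset.Ioi i,
        br (q * remaining w p (e j) / remaining w p (e i)) := by
    rw [Fin.prod_univ_succ, Fin.prod_Ioi_zero,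
      ← Equiv.prod_comp e fun j => br (q * remaining w p j / w p)]
    simp [Fin.prod_Ioi_succ, remaining]
  have h2 : ∏ i, triWeight q (Fin.cons x b : Fin (n + 1) → ℂ) i
      (w (Equiv.Perm.decomposeFin.symm (p, e) i)) = (∏ k, br (b k / w p)) *
        ((∏ j, br (q * x / remaining w p j)) *
          ∏ i, triWeight q b i (remaining w p (e i))) := by
    rw [Fin.prod_univ_succ, ← Equiv.prod_comp e fun j => br (q * x / remaining w p j),
      ← Finset.prod_mul_distrib]
    simp [triWeight, Fin.prod_univ_succ, remaining]
  rw [h1, h2, Equiv.Perm.decomposeFin.symm_sign]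
  split_ifs <;> push_cast <;> ring

theorem diagDet_cons (q : ℂ) {n : ℕ} (x : ℂ) (b : Fin n → ℂ) (w : Fin (n + 1) → ℂ) :
    diagDet q (Fin.cons x b : Fin (n + 1) → ℂ) w = ∑ p, (if p = 0 then 1 else -1) *
      ((∏ k, br (b k / w p) * br (q * b k / w p)) *
        (∏ j, br (x / remaining w p j) * br (q * x / remaining w p j)) *
          diagDet q b (remaining w p)) := by
  rw [diagDet_eq_sum, sum_perm_succ]
  refine Finset.sum_congr rfl fun p _ => ?_
  rw [diagDet_eq_sum, Finset.mul_sum, Finset.mul_sum]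
  refine Finset.sum_congr rfl fun e _ => ?_
  have h2 : ∏ i, diagWeight q (Fin.cons x b : Fin (n + 1) → ℂ) i
      (w (Equiv.Perm.decomposeFin.symm (p, e) i)) =
        (∏ k, br (b k / w p) * br (q * b k / w p)) *
        ((∏ j, br (x / remaining w p j) * br (q * x / remaining w p j)) *
          ∏ i, diagWeight q b i (remaining w p (e i))) := by
    rw [Fin.prod_univ_succ, ← Equiv.prod_comp e fun j => br (x / remaining w p j) *
      br (q * x / remaining w p j), ← Finset.prod_mul_distrib]
    simp [diagWeight, Fin.prod_univ_succ, remaining, (Fin.succ_ne_zero _).symm]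
  rw [h2, Equiv.Perm.decomposeFin.symm_sign]
  split_ifs <;> push_cast <;> ring

/-- The antisymmetrization of the triangular weights is, up to a factor, a determinant. -/
theorem triSum_mul_eq_diagDet {q : ℂ} (hq : q ≠ 0) : ∀ {n : ℕ} (b w : Fin n → ℂ),
    (∀ i, b i ≠ 0) → (∀ i, w i ≠ 0) → (∀ i j, i ≠ j → b i ^ 2 ≠ b j ^ 2) →
    (∀ i j, i ≠ j → w i ^ 2 ≠ w j ^ 2) → (∀ i j, b i ^ 2 ≠ (w j / q) ^ 2) →
    triSum q b w * (∏ i : Fin n, ∏ j ∈ Finset.Ioi i, br (b i / b j)) = diagDet q b w := by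
  intro n
  induction n with
  | zero =>
    intro b w _ _ _ _ _
    simp [triSum, diagDet]
  | succ n ih =>
    intro b w hb hw hbb hww hbw
    obtain ⟨x, b, rfl⟩ : ∃ (x : ℂ) (b' : Fin n → ℂ), b = Fin.cons x b' :=
      ⟨b 0, Fin.tail b, (Fin.cons_self_tail b).symm⟩
    have hb' : ∀ i, b i ≠ 0 := fun i => by simpa using hb i.succ
    have hbb' : ∀ i j, i ≠ j → b i ^ 2 ≠ b j ^ 2 := fun i j hij => by
      simpa using hbb i.succ j.succ (by simpa using hij)
    have hbw' : ∀ i j, b i ^ 2 ≠ (w j / q) ^ 2 := fun i j => by simpa using hbw i.succ j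
    set P : ℂ := ∏ i : Fin n, ∏ j ∈ Finset.Ioi i, br (b i / b j) with hP
    have ih' : ∀ p, diagDet q b (remaining w p) = triSum q b (remaining w p) * P := fun p =>
      (ih b (remaining w p) hb' (fun i => hw _) hbb'
        (fun i j hij => hww _ _ fun h => hij (by simpa using h)) (fun i j => hbw' i _)).symm
    -- The difference of the two sides as a function of the first parameter. It has degree `2n` and
    -- is shown to vanish at the `n` points `b i` and the `n + 1` points `w i / q`.
    let f : ℂ → ℂ := fun y => triSum q (Fin.cons y b : Fin (n + 1) → ℂ) w * ((∏ k, br (y / b k)) * P)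
      - diagDet q (Fin.cons y b : Fin (n + 1) → ℂ) w
    have hf : ∀ y, f y = ∑ p, ((if p = 0 then 1 else -1) * triSum q b (remaining w p) * P *
        (∏ k, br (b k / w p))) *
        ((∏ j, br (q * remaining w p j / w p)) * ((∏ k, br ((b k)⁻¹ * y)) *
          ∏ j, br (q / remaining w p j * y)) -
        (∏ k, br (q * b k / w p)) * ((∏ j, br ((remaining w p j)⁻¹ * y)) *
          ∏ j, br (q / remaining w p j * y))) := by
      intro y
      simp only [f]
      rw [triSum_cons, diagDet_cons, Finset.sum_mul, ← Finset.sum_sub_distrib]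
      refine Finset.sum_congr rfl fun p _ => ?_
      rw [ih' p]
      simp only [Finset.prod_mul_distrib]
      have e1 : ∀ u : ℂ, u⁻¹ * y = y / u := fun u => by rw [div_eq_mul_inv, mul_comm]
      have e2 : ∀ u : ℂ, q / u * y = q * y / u := fun u => by rw [div_mul_eq_mul_div]
      simp only [e1, e2]
      ring
    have hT : ∃ l, IsTrig (2 * n) l f := by
      have h1 : ∀ v : Fin n → ℂ, IsTrig n _ fun y => ∏ k, br (v k * y) := fun v => by
        have := IsTrig.prod Finset.univ fun k (_ : k ∈ Finset.univ) => IsTrig.br_mul (v k)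
        rwa [Finset.card_univ, Fintype.card_fin, mul_one] at this
      have h2 : ∀ p, ∃ l, IsTrig (2 * n) l fun y =>
          ((if p = 0 then 1 else -1) * triSum q b (remaining w p) * P * (∏ k, br (b k / w p))) *
          ((∏ j, br (q * remaining w p j / w p)) * ((∏ k, br ((b k)⁻¹ * y)) *
            ∏ j, br (q / remaining w p j * y)) -
          (∏ k, br (q * b k / w p)) * ((∏ j, br ((remaining w p j)⁻¹ * y)) *
            ∏ j, br (q / remaining w p j * y))) := by
        intro p
        rw [two_mul]
        exact ⟨_, ((((h1 fun k => (b k)⁻¹).mul (h1 fun j => q / remaining w p j)).const_mul _).sub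
          (((h1 fun j => (remaining w p j)⁻¹).mul
            (h1 fun j => q / remaining w p j)).const_mul _)).const_mul _⟩
      choose l hl using h2
      exact ⟨_, (IsTrig.sum Finset.univ fun p _ => hl p).congr hf⟩
    obtain ⟨l, hl⟩ := hT
    have hbinj : Function.Injective b := fun i j h => by
      by_contra hne
      exact hbb' i j hne (by rw [h])
    have hwinj : Function.Injective fun i => w i / q := fun i j h => by
      by_contra hne
      exact hww i j hne (by rw [(div_left_inj' hq).1 h])
    have hwq : ∀ i j, i ≠ j → (w i / q) ^ 2 ≠ (w j / q) ^ 2 := by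
      intro i j hij h
      apply hww i j hij
      rw [div_pow, div_pow] at h
      field_simp at h
      exact h
    have h0 : f x = 0 := by
      refine hl.eq_zero_of_card_lt
        (Finset.univ.image b ∪ Finset.univ.image fun i => w i / q) ?_ ?_ ?_ (by simpa using hb 0)
      · rw [Finset.card_union_of_disjoint, Finset.card_image_of_injective _ hbinj,
          Finset.card_image_of_injective _ hwinj, Finset.card_univ, Finset.card_univ,
          Fintype.card_fin, Fintype.card_fin]
        · omega
        · rw [Finset.disjoint_left]
          intro y hy hy'
          obtain ⟨i, -, rfl⟩ := Finset.mem_image.1 hy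
          obtain ⟨j, -, hj⟩ := Finset.mem_image.1 hy'
          exact hbw' i j (by rw [hj])
      · intro y hy y' hy' hne
        rcases Finset.mem_union.1 hy with hy | hy <;> rcases Finset.mem_union.1 hy' with hy' | hy' <;>
          obtain ⟨i, -, rfl⟩ := Finset.mem_image.1 hy <;>
          obtain ⟨j, -, rfl⟩ := Finset.mem_image.1 hy'
        · exact hbb' i j fun h => hne (by rw [h])
        · exact hbw' i j
        · exact (hbw' j i).symm
        · exact hwq i j fun h => hne (by rw [h])
      · intro y hy
        rcases Finset.mem_union.1 hy with hy | hy <;> obtain ⟨i, -, rfl⟩ := Finset.mem_image.1 hy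
        · refine ⟨hb' i, ?_⟩
          simp only [f]
          -- At `y = b i` the determinant has two equal columns and the factor `∏ [y/b_k]` vanishes.
          rw [diagDet_eq_zero q _ w (i := 0) (j := i.succ) (Fin.succ_ne_zero i).symm (by simp),
            Finset.prod_eq_zero (Finset.mem_univ i) (br_div_self _)]
          simp
        · refine ⟨div_ne_zero (hw i) hq, ?_⟩
          rw [hf]
          refine Finset.sum_eq_zero fun p _ => ?_
          have e1 : ∀ u : ℂ, q / u * (w i / q) = w i / u := fun u => by field_simp
          simp only [e1]
          -- At `y = w i / q` the terms with `p ≠ i` vanish, because `w i` is among the remaining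
          -- variables. For `p = i` the `n` brackets `[y/b_k]` and the `n` brackets `[y/w_j]` become
          -- `-[q b_k/w_i]` and `-[q w_j/w_i]`, so the two products agree.
          by_cases hp : p = i
          · subst hp
            have e2 : ∀ u : ℂ, br (u⁻¹ * (w p / q)) = -br (q * u / w p) := fun u => by
              rw [← br_inv]
              congr 1
              simp only [div_eq_mul_inv, mul_inv, inv_inv]
              ring
            simp only [e2, Finset.prod_neg, Finset.card_univ, Fintype.card_fin]
            ring
          · have : ∏ j, br (w i / remaining w p j) = 0 := by
              have h1 : Equiv.swap 0 p i ≠ 0 := by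
                intro h
                apply hp
                have := congrArg (Equiv.swap 0 p) h
                simpa using this.symm
              obtain ⟨j, hj⟩ := Fin.exists_succ_eq.2 h1
              refine Finset.prod_eq_zero (Finset.mem_univ j) ?_
              rw [remaining, hj, Equiv.swap_apply_self, br_div_self]
            rw [this]
            ring
    have h1 : (∏ i : Fin (n + 1), ∏ j ∈ Finset.Ioi i,
        br ((Fin.cons x b : Fin (n + 1) → ℂ) i / (Fin.cons x b : Fin (n + 1) → ℂ) j)) =
        (∏ k, br (x / b k)) * P := prod_pairs_cons (fun x y => br (x / y)) x b
    rw [h1]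
    exact sub_eq_zero.1 h0

end SpinChain

namespace SpinChain

open Filter Topology Metric

/-! ### Cauchy's integral formula on polydiscs -/

theorem torusMap_mem_sphere {n : ℕ} {c : Fin n → ℂ} {R : Fin n → ℝ} (hR : ∀ i, 0 < R i)
    (θ : Fin n → ℝ) (i : Fin n) : torusMap c R θ i ∈ sphere (c i) (R i) := by
  simp [torusMap, Complex.norm_exp_ofReal_mul_I, abs_of_pos (hR i)]

theorem torusIntegral_congr_sphere {n : ℕ} {c : Fin n → ℂ} {R : Fin n → ℝ} (hR : ∀ i, 0 < R i)
    {f g : (Fin n → ℂ) → ℂ} (h : ∀ w, (∀ i, w i ∈ sphere (c i) (R i)) → f w = g w) :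
    torusIntegral f c R = torusIntegral g c R := by
  unfold torusIntegral
  congr 1
  funext θ
  rw [h _ (torusMap_mem_sphere hR θ)]

theorem torusIntegral_cauchy {n : ℕ} : ∀ {c : Fin n → ℂ} {R : Fin n → ℝ}, (∀ i, 0 < R i) →
    ∀ {h : (Fin n → ℂ) → ℂ},
    (∀ w, (∀ i, w i ∈ closedBall (c i) (R i)) → DifferentiableAt ℂ h w) →
    torusIntegral (fun w => (∏ i, (w i - c i)⁻¹) * h w) c R =
      (2 * Real.pi * Complex.I) ^ n * h c := by
  induction n with
  | zero =>
    intro c R _ h _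
    simp
  | succ n ih =>
    intro c R hR h hd
    have hint : TorusIntegrable (fun w => (∏ i, (w i - c i)⁻¹) * h w) c R := by
      refine ContinuousOn.integrableOn_compact isCompact_Icc ?_
      refine Continuous.continuousOn ?_
      rw [continuous_iff_continuousAt]
      intro θ
      have hs := torusMap_mem_sphere (c := c) hR θ
      have hm : Continuous (torusMap c R) := by
        unfold torusMap
        fun_prop
      have h1 : ContinuousAt (fun w : Fin (n + 1) → ℂ => (∏ i, (w i - c i)⁻¹) * h w)
          (torusMap c R θ) := by
        refine ContinuousAt.mul ?_ (hd _ fun i => sphere_subset_closedBall (hs i)).continuousAt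
        refine tendsto_finsetProd _ fun i _ => ?_
        refine ContinuousAt.inv₀ ((continuous_apply i).sub continuous_const).continuousAt ?_
        rw [sub_ne_zero]
        intro h0
        have := hs i
        rw [h0, mem_sphere, dist_self] at this
        exact (hR i).ne this
      exact ContinuousAt.comp (f := torusMap c R) h1 hm.continuousAt
    rw [torusIntegral_succ hint]
    have hcons : ∀ x ∈ closedBall (c 0) (R 0), ∀ y : Fin n → ℂ,
        (∀ i, y i ∈ closedBall (c i.succ) (R i.succ)) →
        DifferentiableAt ℂ h (Fin.cons x y : Fin (n + 1) → ℂ) := by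
      intro x hx y hy
      refine hd _ fun i => ?_
      refine Fin.cases ?_ (fun i => ?_) i
      · simpa using hx
      · simpa using hy i
    have hinner : ∀ x ∈ sphere (c 0) (R 0),
        torusIntegral (fun y : Fin n → ℂ =>
          (∏ i, ((Fin.cons x y : Fin (n + 1) → ℂ) i - c i)⁻¹) * h (Fin.cons x y : Fin (n + 1) → ℂ))
          (c ∘ Fin.succ) (R ∘ Fin.succ) =
        (x - c 0)⁻¹ • ((2 * Real.pi * Complex.I) ^ n *
          h (Fin.cons x (c ∘ Fin.succ) : Fin (n + 1) → ℂ)) := by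
      intro x hx
      have h1 := ih (c := c ∘ Fin.succ) (R := R ∘ Fin.succ) (fun i => hR i.succ)
        (h := fun y => h (Fin.cons x y : Fin (n + 1) → ℂ)) (by
          intro y hy
          refine DifferentiableAt.comp (f := fun y : Fin n → ℂ => (Fin.cons x y : Fin (n + 1) → ℂ)) y
            (hcons x (sphere_subset_closedBall hx) y hy) ?_
          rw [differentiableAt_pi]
          intro i
          refine Fin.cases ?_ (fun i => ?_) i
          · simp
          · simp only [Fin.cons_succ]
            fun_prop)
      rw [smul_eq_mul, ← h1, ← torusIntegral_const_mul]
      congr 1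
      funext y
      rw [Fin.prod_univ_succ]
      simp only [Fin.cons_zero, Fin.cons_succ, Function.comp]
      ring
    have hc0 : c 0 ∈ ball (c 0) (R 0) := mem_ball_self (hR 0)
    rw [circleIntegral.integral_congr (hR 0).le hinner]
    have hdx : ∀ x ∈ closedBall (c 0) (R 0), DifferentiableAt ℂ (fun x => (2 * Real.pi *
        Complex.I) ^ n * h (Fin.cons x (c ∘ Fin.succ) : Fin (n + 1) → ℂ)) x := by
      intro x hx
      refine DifferentiableAt.const_mul ?_ _
      refine DifferentiableAt.comp
        (f := fun x : ℂ => (Fin.cons x (c ∘ Fin.succ) : Fin (n + 1) → ℂ)) x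
        (hcons x hx _ fun i => mem_closedBall_self (hR i.succ).le) ?_
      rw [differentiableAt_pi]
      intro i
      refine Fin.cases ?_ (fun i => ?_) i
      · simp only [Fin.cons_zero]
        fun_prop
      · simp
    rw [Complex.circleIntegral_sub_inv_smul_of_differentiable_on_off_countable
      Set.countable_empty hc0 (fun x hx => (hdx x hx).continuousAt.continuousWithinAt)
      (fun x hx => hdx x (ball_subset_closedBall hx.1)), smul_eq_mul]
    have : (Fin.cons (c 0) (c ∘ Fin.succ) : Fin (n + 1) → ℂ) = c := Fin.cons_self_tail c
    rw [this, pow_succ]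
    ring

section Regular

variable {n : ℕ} {c : Fin n → ℂ} {R : Fin n → ℝ} {f h : (Fin n → ℂ) → ℂ}

/-- The torus integral of an integrand with at most simple poles at the centres. -/
theorem torusIntegral_eq_of_regular (hR : ∀ i, 0 < R i)
    (hd : ∀ w, (∀ i, w i ∈ closedBall (c i) (R i)) → DifferentiableAt ℂ h w)
    (hf : ∀ w, (∀ i, w i ∈ closedBall (c i) (R i)) → (∀ i, w i ≠ c i) →
      f w = (∏ i, (w i - c i)⁻¹) * h w) :
    torusIntegral f c R = (2 * Real.pi * Complex.I) ^ n * h c := by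
  rw [← torusIntegral_cauchy hR hd]
  refine torusIntegral_congr_sphere hR fun w hw => ?_
  refine hf w (fun i => sphere_subset_closedBall (hw i)) fun i h0 => ?_
  have := hw i
  rw [h0, mem_sphere, dist_self] at this
  exact (hR i).ne this

/-- An integrand with at most simple poles at the centres: the torus integral is a limit of values
of the integrand. -/
theorem tendsto_torusIntegral (hR : ∀ i, 0 < R i)
    (hd : ∀ w, (∀ i, w i ∈ closedBall (c i) (R i)) → DifferentiableAt ℂ h w)
    (hf : ∀ w, (∀ i, w i ∈ closedBall (c i) (R i)) → (∀ i, w i ≠ c i) →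
      f w = (∏ i, (w i - c i)⁻¹) * h w) :
    Tendsto (fun t : ℂ => (2 * Real.pi * Complex.I * t) ^ n * f fun i => c i + t) (𝓝[≠] 0)
      (𝓝 (torusIntegral f c R)) := by
  have hcont : Tendsto (fun t : ℂ => (2 * Real.pi * Complex.I) ^ n * h fun i => c i + t) (𝓝[≠] 0)
      (𝓝 ((2 * Real.pi * Complex.I) ^ n * h c)) := by
    refine Tendsto.const_mul _ ?_
    have h1 : ContinuousAt (fun t : ℂ => h fun i => c i + t) 0 := by
      have h2 : ContinuousAt h fun i => c i + 0 := by
        simp only [add_zero]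
        exact (hd c fun i => mem_closedBall_self (hR i).le).continuousAt
      exact ContinuousAt.comp (f := fun (t : ℂ) i => c i + t) h2 (by fun_prop)
    have h3 := h1.tendsto
    simp only [add_zero] at h3
    exact h3.mono_left nhdsWithin_le_nhds
  rw [torusIntegral_eq_of_regular hR hd hf]
  refine hcont.congr' ?_
  have hball : ∀ᶠ t : ℂ in 𝓝[≠] 0, ∀ i, c i + t ∈ closedBall (c i) (R i) := by
    rw [eventually_all]
    intro i
    refine nhdsWithin_le_nhds ?_
    have : Tendsto (fun t : ℂ => c i + t) (𝓝 0) (𝓝 (c i)) := by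
      simpa using (tendsto_const_nhds (x := c i)).add (tendsto_id (x := 𝓝 (0 : ℂ)))
    exact this (closedBall_mem_nhds _ (hR i))
  filter_upwards [hball, self_mem_nhdsWithin] with t ht ht0
  have ht0' : t ≠ 0 := ht0
  rw [hf _ ht fun i => by simpa using ht0']
  simp only [add_sub_cancel_left, Finset.prod_const, Finset.card_univ, Fintype.card_fin, mul_pow]
  have := pow_ne_zero n ht0'
  rw [inv_pow]
  field_simp

end Regular

/-! ### Residues of the integrands -/

/-- The denominator that belongs to one variable of integration. -/
def den (q : ℂ) {N : ℕ} (z : Fin N → ℂ) (T U : Finset (Fin N)) (w : ℂ) : ℂ :=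
  (∏ j ∈ T, br (z j / w)) * (∏ j ∈ U, br (q * z j / w)) * ∏ j, br (q ^ 2 * w * z j)

/-- `2 π i` times the residue at `z_k` of `1 / (π i w den(w))`. -/
def residue (q : ℂ) {N : ℕ} (z : Fin N → ℂ) (T U : Finset (Fin N)) (k : Fin N) : ℂ :=
  if k ∈ T then -(den q z (T.erase k) U (z k))⁻¹ else 0

/-- The numerator of `Xi`. -/
def xiNum (q β : ℂ) {n : ℕ} (w : Fin n → ℂ) : ℂ :=
  (∏ i : Fin n, ∏ j ∈ Finset.Ioi i,
      br (q * w j / w i) * br (w i / w j) * br (q * w i * w j)) *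
    (∏ i : Fin n, ∏ j ∈ Finset.Ici i, br (q ^ 2 * w i * w j)) * ∏ i : Fin n, br (β * w i)

/-- With the diagonal brackets `j = i` split off, the only factor that is neither antisymmetric nor
symmetric is `∏ [q w_j/w_i]`. -/
theorem xiNum_eq (q β : ℂ) {n : ℕ} (w : Fin n → ℂ) :
    xiNum q β w = (∏ i : Fin n, ∏ j ∈ Finset.Ioi i, br (q * w j / w i)) * antisymProd q w *
      ∏ i, br (β * w i) * br (q ^ 2 * w i * w i) := by
  have : ∀ i : Fin n, ∏ j ∈ Finset.Ici i, br (q ^ 2 * w i * w j) =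
      br (q ^ 2 * w i * w i) * ∏ j ∈ Finset.Ioi i, br (q ^ 2 * w i * w j) := fun i => by
    rw [← Finset.Ioi_insert, Finset.prod_insert (by simp)]
  rw [xiNum, antisymProd]
  simp only [this, Finset.prod_mul_distrib]
  ring

theorem differentiableAt_br {E : Type*} [NormedAddCommGroup E] [NormedSpace ℂ E] {f : E → ℂ}
    {x : E} (hf : DifferentiableAt ℂ f x) (h : f x ≠ 0) :
    DifferentiableAt ℂ (fun x => br (f x)) x := by
  unfold br
  exact hf.sub (hf.inv h)

theorem differentiableAt_prod {E ι : Type*} [NormedAddCommGroup E] [NormedSpace ℂ E]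
    {s : Finset ι} {f : ι → E → ℂ} {x : E} (h : ∀ i ∈ s, DifferentiableAt ℂ (f i) x) :
    DifferentiableAt ℂ (fun x => ∏ i ∈ s, f i x) x := by
  classical
  induction s using Finset.induction_on with
  | empty => simp
  | insert a s ha ih =>
    simp only [Finset.prod_insert ha]
    exact (h a (by simp)).mul (ih fun i hi => h i (by simp [hi]))

theorem br_ne_zero {x : ℂ} (h0 : x ≠ 0) (h1 : x ≠ 1) (h2 : x ≠ -1) : br x ≠ 0 := by
  rw [Ne, br_eq_zero_iff h0, sq_eq_one_iff]
  tauto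

section Contour

variable {q : ℂ} {N : ℕ} {z : Fin N → ℂ} {ρ : Fin N → ℝ}

theorem IsContour.mem_self (h : IsContour q z ρ) (j : Fin N) : z j ∈ closedBall (z j) (ρ j) :=
  mem_closedBall_self (h.pos j).le

theorem IsContour.ne_zero (h : IsContour q z ρ) (j : Fin N) : z j ≠ 0 := fun h0 =>
  h.zero_notMem j (h0 ▸ h.mem_self j)

theorem IsContour.ne_zero_of_mem (h : IsContour q z ρ) {j : Fin N} {w : ℂ}
    (hw : w ∈ closedBall (z j) (ρ j)) : w ≠ 0 := by
  rintro rfl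
  exact h.zero_notMem j hw

theorem IsContour.br_div_ne_zero (h : IsContour q z ρ) {j k : Fin N} {w : ℂ}
    (hw : w ∈ closedBall (z j) (ρ j)) (hk : k ≠ j ∨ w ≠ z j) : br (z k / w) ≠ 0 := by
  have hw0 := h.ne_zero_of_mem hw
  refine br_ne_zero (div_ne_zero (h.ne_zero k) hw0) ?_ ?_
  · rw [Ne, div_eq_one_iff_eq hw0]
    rintro rfl
    rcases hk with hk | hk
    · exact h.notMem j k hk hw
    · rcases eq_or_ne k j with rfl | hkj
      · exact hk rfl
      · exact h.notMem j k hkj hw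
  · rw [Ne, div_eq_iff hw0]
    intro h1
    refine h.neg_notMem j k ?_
    rwa [h1, neg_one_mul, neg_neg]

theorem IsContour.q_ne_zero (h : IsContour q z ρ) (hq : q ≠ 0) {j k : Fin N} {w : ℂ}
    (hw : w ∈ closedBall (z j) (ρ j)) : br (q * z k / w) ≠ 0 := by
  have hw0 := h.ne_zero_of_mem hw
  refine br_ne_zero (div_ne_zero (mul_ne_zero hq (h.ne_zero k)) hw0) ?_ ?_
  · rw [Ne, div_eq_one_iff_eq hw0]
    rintro rfl
    exact h.q_mul_notMem j k hw
  · rw [Ne, div_eq_iff hw0]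
    intro h1
    refine h.neg_q_mul_notMem j k ?_
    rwa [h1, neg_one_mul, neg_neg]

theorem IsContour.q_mul_ne_zero (h : IsContour q z ρ) (hq : q ≠ 0) {j k : Fin N} {w : ℂ}
    (hw : w ∈ closedBall (z j) (ρ j)) : br (q ^ 2 * w * z k) ≠ 0 := by
  have hw0 := h.ne_zero_of_mem hw
  have hz0 := h.ne_zero k
  have hqz : q ^ 2 * z k ≠ 0 := mul_ne_zero (pow_ne_zero 2 hq) hz0
  rw [mul_right_comm]
  refine br_ne_zero (mul_ne_zero hqz hw0) ?_ ?_
  · intro h1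
    refine h.inv_notMem j k ?_
    rwa [← eq_inv_of_mul_eq_one_right h1]
  · intro h1
    refine h.neg_inv_notMem j k ?_
    have : q ^ 2 * z k * -w = 1 := by rw [mul_neg, h1, neg_neg]
    rwa [← eq_inv_of_mul_eq_one_right this, neg_neg]

theorem IsContour.den_ne_zero (h : IsContour q z ρ) (hq : q ≠ 0) {j : Fin N} {w : ℂ}
    (hw : w ∈ closedBall (z j) (ρ j)) {T : Finset (Fin N)} (U : Finset (Fin N))
    (hT : j ∉ T ∨ w ≠ z j) : den q z T U w ≠ 0 := by
  refine mul_ne_zero (mul_ne_zero ?_ ?_) ?_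
  · refine Finset.prod_ne_zero_iff.2 fun k hk => h.br_div_ne_zero hw ?_
    rcases hT with hT | hT
    · exact .inl fun hkj => hT (hkj ▸ hk)
    · exact .inr hT
  · exact Finset.prod_ne_zero_iff.2 fun k _ => h.q_ne_zero hq hw
  · exact Finset.prod_ne_zero_iff.2 fun k _ => h.q_mul_ne_zero hq hw

theorem IsContour.differentiableAt_den (h : IsContour q z ρ) (hq : q ≠ 0) {j : Fin N} {w : ℂ}
    (hw : w ∈ closedBall (z j) (ρ j)) (T U : Finset (Fin N)) :
    DifferentiableAt ℂ (den q z T U) w := by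
  have hw0 := h.ne_zero_of_mem hw
  refine ((differentiableAt_prod fun k _ => ?_).mul (differentiableAt_prod fun k _ => ?_)).mul
    (differentiableAt_prod fun k _ => ?_)
  · exact differentiableAt_br ((differentiableAt_const _).div differentiableAt_id hw0)
      (div_ne_zero (h.ne_zero k) hw0)
  · exact differentiableAt_br ((differentiableAt_const _).div differentiableAt_id hw0)
      (div_ne_zero (mul_ne_zero hq (h.ne_zero k)) hw0)
  · exact differentiableAt_br (by fun_prop)
      (mul_ne_zero (mul_ne_zero (pow_ne_zero 2 hq) hw0) (h.ne_zero k))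

/-- The one-variable factors of the integrands have at most a simple pole at `z_k`. -/
theorem IsContour.exists_regular (h : IsContour q z ρ) (hq : q ≠ 0) (T U : Finset (Fin N))
    (k : Fin N) : ∃ e : ℂ → ℂ, (∀ w ∈ closedBall (z k) (ρ k), DifferentiableAt ℂ e w) ∧
      (∀ w ∈ closedBall (z k) (ρ k), w ≠ z k →
        2 * w⁻¹ * (den q z T U w)⁻¹ = (w - z k)⁻¹ * e w) ∧ e (z k) = residue q z T U k := by
  have hz0 := h.ne_zero k
  by_cases hk : k ∈ T
  -- From `[z_k/w] = -(w - z_k)(z_k + w)/(z_k w)`. The factor `z_k + w` has no zero in the disc,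
  -- since `-z_k` is excluded.
  · refine ⟨fun w => -(2 * z k / (z k + w)) * (den q z (T.erase k) U w)⁻¹, ?_, ?_, ?_⟩
    · intro w hw
      have h1 : z k + w ≠ 0 := fun h1 => h.neg_notMem k k (by
        rwa [neg_eq_of_add_eq_zero_right h1])
      exact ((((differentiableAt_const _).div (by fun_prop) h1).neg).mul
        ((h.differentiableAt_den hq hw _ _).inv (h.den_ne_zero hq hw U (by simp))))
    · intro w hw hwz
      have hw0 := h.ne_zero_of_mem hw
      have h1 : z k + w ≠ 0 := fun h1 => h.neg_notMem k k (by
        rwa [neg_eq_of_add_eq_zero_right h1])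
      have h2 : w - z k ≠ 0 := sub_ne_zero.2 hwz
      have h3 : den q z T U w = br (z k / w) * den q z (T.erase k) U w := by
        rw [den, den, ← Finset.mul_prod_erase T _ hk]
        ring
      have h4 : br (z k / w) = -((w - z k) * (z k + w) / (z k * w)) := by
        rw [br]
        field_simp
        ring
      rw [h3, h4, mul_inv, inv_neg, inv_div]
      beta_reduce
      generalize (den q z (T.erase k) U w)⁻¹ = d
      field_simp
    · beta_reduce
      rw [residue, if_pos hk, ← two_mul, div_self (mul_ne_zero two_ne_zero hz0)]
      ring
  -- There is no pole in this case. The factor `w - z k` gives the function the required form, with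
  -- value 0 at the centre.
  · refine ⟨fun w => 2 * w⁻¹ * (den q z T U w)⁻¹ * (w - z k), ?_, ?_, ?_⟩
    · intro w hw
      have hw0 := h.ne_zero_of_mem hw
      exact (((differentiableAt_id.inv hw0).const_mul 2).mul
        ((h.differentiableAt_den hq hw _ _).inv (h.den_ne_zero hq hw U (.inl hk)))).mul
        (by fun_prop)
    · intro w hw hwz
      have h2 : w - z k ≠ 0 := sub_ne_zero.2 hwz
      field_simp
    · beta_reduce
      rw [residue, if_neg hk, sub_self, mul_zero]

/-- An integrand with the numerator `f`. -/
def integrand (q : ℂ) {N n : ℕ} (z : Fin N → ℂ) (T U : Fin n → Finset (Fin N))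
    (f : (Fin n → ℂ) → ℂ) (w : Fin n → ℂ) : ℂ :=
  (∏ l : Fin n, 1 / ((Real.pi : ℂ) * Complex.I * w l)) *
    (f w / ∏ i, den q z (T i) (U i) (w i))

variable {n : ℕ} {T U : Fin n → Finset (Fin N)} {f : (Fin n → ℂ) → ℂ}

theorem integrand_eq (w : Fin n → ℂ) : integrand q z T U f w =
    (2 * Real.pi * Complex.I)⁻¹ ^ n *
      (f w * ∏ i, (2 * (w i)⁻¹ * (den q z (T i) (U i) (w i))⁻¹)) := by
  have hpi : (Real.pi : ℂ) ≠ 0 := by exact_mod_cast Real.pi_ne_zero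
  have : ∀ l, 1 / ((Real.pi : ℂ) * Complex.I * w l) =
      (2 * Real.pi * Complex.I)⁻¹ * (2 * (w l)⁻¹) := fun l => by
    have := Complex.I_ne_zero
    rw [one_div, mul_inv, mul_inv, mul_inv, mul_inv]
    field_simp
  rw [integrand]
  simp only [this, Finset.prod_mul_distrib, Finset.prod_const, Finset.card_univ, Fintype.card_fin,
    Finset.prod_inv_distrib, div_eq_mul_inv]
  ring

/-- The sum of residues serves for evaluations and the limit for transferring identities between
integrands. All variables are shifted by the same `t`, so that permuting the centres permutes the
shifted points. -/
theorem IsContour.tendsto_integrand (h : IsContour q z ρ) (hq : q ≠ 0)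
    (hf : ∀ w, (∀ i, w i ≠ 0) → DifferentiableAt ℂ f w) (c : Fin n → Fin N) :
    Tendsto (fun t : ℂ => (2 * Real.pi * Complex.I * t) ^ n *
        integrand q z T U f fun i => z (c i) + t) (𝓝[≠] 0)
      (𝓝 (torusIntegral (integrand q z T U f) (fun l => z (c l)) fun l => ρ (c l))) ∧
    torusIntegral (integrand q z T U f) (fun l => z (c l)) (fun l => ρ (c l)) =
      f (fun l => z (c l)) * ∏ i, residue q z (T i) (U i) (c i) := by
  choose e he1 he2 he3 using fun i => h.exists_regular hq (T i) (U i) (c i)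
  have hpi : (2 * Real.pi * Complex.I : ℂ) ≠ 0 := Complex.two_pi_I_ne_zero
  have hd : ∀ w : Fin n → ℂ, (∀ i, w i ∈ closedBall (z (c i)) (ρ (c i))) → DifferentiableAt ℂ
      (fun w => (2 * Real.pi * Complex.I)⁻¹ ^ n * (f w * ∏ i, e i (w i))) w := by
    intro w hw
    refine ((hf w fun i => h.ne_zero_of_mem (hw i)).mul
      (differentiableAt_prod fun i _ => ?_)).const_mul _
    exact (he1 i (w i) (hw i)).comp (f := fun w : Fin n → ℂ => w i) w (by fun_prop)
  have hfw : ∀ w : Fin n → ℂ, (∀ i, w i ∈ closedBall (z (c i)) (ρ (c i))) →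
      (∀ i, w i ≠ z (c i)) → integrand q z T U f w = (∏ i, (w i - z (c i))⁻¹) *
        ((2 * Real.pi * Complex.I)⁻¹ ^ n * (f w * ∏ i, e i (w i))) := by
    intro w hw hwz
    rw [integrand_eq, Finset.prod_congr rfl fun i _ => he2 i (w i) (hw i) (hwz i),
      Finset.prod_mul_distrib]
    ring
  have hR : ∀ i, 0 < ρ (c i) := fun i => h.pos _
  refine ⟨tendsto_torusIntegral hR hd hfw, ?_⟩
  rw [torusIntegral_eq_of_regular hR hd hfw, Finset.prod_congr rfl fun i _ => he3 i]
  rw [inv_pow, ← mul_assoc, mul_inv_cancel₀ (pow_ne_zero n hpi), one_mul]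

/-- The contour integral as a limit of finite sums. -/
theorem IsContour.tendsto_multiContour (h : IsContour q z ρ) (hq : q ≠ 0)
    (hf : ∀ w, (∀ i, w i ≠ 0) → DifferentiableAt ℂ f w) :
    Tendsto (fun t : ℂ => ∑ c : Fin n → Fin N, (2 * Real.pi * Complex.I * t) ^ n *
        integrand q z T U f fun i => z (c i) + t) (𝓝[≠] 0)
      (𝓝 (multiContour z ρ (integrand q z T U f))) :=
  tendsto_finsetSum _ fun c _ => (h.tendsto_integrand hq hf c).1

/-- The contour integral as a sum of residues. -/
theorem IsContour.multiContour_eq (h : IsContour q z ρ) (hq : q ≠ 0)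
    (hf : ∀ w, (∀ i, w i ≠ 0) → DifferentiableAt ℂ f w) :
    multiContour z ρ (integrand q z T U f) =
      ∑ c : Fin n → Fin N, f (fun l => z (c l)) * ∏ i, residue q z (T i) (U i) (c i) :=
  Finset.sum_congr rfl fun c _ => (h.tendsto_integrand hq hf c).2

theorem differentiableAt_antisymProd (hq : q ≠ 0) {w : Fin n → ℂ} (hw : ∀ i, w i ≠ 0) :
    DifferentiableAt ℂ (antisymProd q) w := by
  have hp : ∀ k, DifferentiableAt ℂ (fun w : Fin n → ℂ => w k) w := fun k => by fun_prop
  refine differentiableAt_prod fun i _ => differentiableAt_prod fun j _ => ?_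
  have hi := hw i
  have hj := hw j
  refine ((differentiableAt_br ?_ ?_).mul (differentiableAt_br ?_ ?_)).mul
    (differentiableAt_br ?_ ?_)
  · simp only [div_eq_mul_inv]
    exact (hp i).mul ((hp j).inv hj)
  · positivity
  · fun_prop
  · positivity
  · fun_prop
  · positivity

theorem differentiableAt_xiNum (hq : q ≠ 0) {β : ℂ} (hβ : β ≠ 0) {w : Fin n → ℂ}
    (hw : ∀ i, w i ≠ 0) : DifferentiableAt ℂ (xiNum q β) w := by
  have hp : ∀ k, DifferentiableAt ℂ (fun w : Fin n → ℂ => w k) w := fun k => by fun_prop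
  rw [funext (xiNum_eq q β)]
  refine ((differentiableAt_prod fun i _ => differentiableAt_prod fun j _ => ?_).mul
    (differentiableAt_antisymProd hq hw)).mul (differentiableAt_prod fun i _ => ?_)
  · have hi := hw i
    have hj := hw j
    refine differentiableAt_br ?_ (by positivity)
    simp only [div_eq_mul_inv]
    exact ((hp j).const_mul q).mul ((hp i).inv hi)
  · have hi := hw i
    exact (differentiableAt_br (by fun_prop) (by positivity)).mul
      (differentiableAt_br (by fun_prop) (by positivity))

/-- The factor in front of the contour integral. -/
def prefactor (q : ℂ) {N : ℕ} (z : Fin N → ℂ) : ℂ :=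
  ∏ i : Fin N, ∏ j ∈ Finset.Ioi i, br (q * z j / z i) * br (q ^ 2 * z i * z j)

theorem component_eq (β : ℂ) (a : Fin n → Fin N) : component q β ρ z a =
    (-br q) ^ n * prefactor q z * multiContour z ρ (integrand q z (fun i => Finset.Iic (a i))
      (fun i => Finset.Ici (a i)) (xiNum q β)) := rfl

end Contour

/-! ### Products over pairs -/

section Pairs

variable {N n : ℕ}

theorem prod_Iio_eq_prod_Ioi (F : Fin N → Fin N → ℂ) :
    ∏ i, ∏ j ∈ Finset.Iio i, F i j = ∏ i, ∏ j ∈ Finset.Ioi i, F j i :=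
  Finset.prod_comm' (by simp)

theorem prod_univ_eq_Iio_Ioi (F : Fin N → ℂ) (i : Fin N) :
    ∏ j, F j = (∏ j ∈ Finset.Iio i, F j) * F i * ∏ j ∈ Finset.Ioi i, F j := by
  rw [mul_assoc, ← Finset.prod_insert (s := Finset.Ioi i) (by simp), Finset.Ioi_insert,
    ← Finset.prod_union]
  · congr 1
    ext j
    simp [lt_or_ge]
  · rw [Finset.disjoint_left]
    intro j hj hj'
    simp only [Finset.mem_Iio, Finset.mem_Ici] at hj hj'
    exact absurd hj (not_lt.2 hj')

theorem prod_comp_eq_prod_ite {a : Fin n → Fin N} (ha : StrictMono a) {p : Fin N → Prop}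
    [DecidablePred p] (hp : ∀ i, p i ↔ ∃ l, a l = i) (F : Fin N → ℂ) :
    ∏ l, F (a l) = ∏ i, if p i then F i else 1 := by
  rw [← Finset.prod_filter]
  have : Finset.univ.filter p = Finset.univ.image a := by
    ext i
    simp [hp]
  rw [this, Finset.prod_image fun x _ y _ h => ha.injective h]

theorem prod_pairs_comp_eq_prod_ite {a : Fin n → Fin N} (ha : StrictMono a) {p : Fin N → Prop}
    [DecidablePred p] (hp : ∀ i, p i ↔ ∃ l, a l = i) (F : Fin N → Fin N → ℂ) :
    ∏ l, ∏ l' ∈ Finset.Ioi l, F (a l) (a l') =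
      ∏ i, ∏ j ∈ Finset.Ioi i, if p i ∧ p j then F i j else 1 := by
  have h1 : ∀ l, ∏ l' ∈ Finset.Ioi l, F (a l) (a l') =
      ∏ j, if p j then (if a l < j then F (a l) j else 1) else 1 := by
    intro l
    rw [← prod_comp_eq_prod_ite ha hp fun j => if a l < j then F (a l) j else 1]
    simp only [ha.lt_iff_lt]
    rw [← Finset.prod_filter]
    congr 1
    ext l'
    simp
  simp only [h1]
  rw [prod_comp_eq_prod_ite ha hp fun i => ∏ j, if p j then (if i < j then F i j else 1) else 1]
  refine Finset.prod_congr rfl fun i _ => ?_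
  have h2 : Finset.Ioi i = Finset.univ.filter fun j => i < j := by
    ext j
    simp
  rw [h2, Finset.prod_filter]
  split_ifs with hi
  · refine Finset.prod_congr rfl fun j _ => ?_
    by_cases hj : p j <;> by_cases hij : i < j <;> simp [hi, hj, hij]
  · simp [hi]

end Pairs

/-- The product of the pair factors of the first (`k = n`) and the last (`k = N - n`) component. -/
def pairProd (q : ℂ) {N : ℕ} (z : Fin N → ℂ) (k : ℕ) : ℂ :=
  ∏ i : Fin N, ∏ j ∈ Finset.Ioi i,
    if (j : ℕ) < k then br (q * z j / z i) * br (q * z i * z j)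
    else if (i : ℕ) < k then 1
    else br (q * z j / z i) * br (q ^ 2 * z i * z j)

/-! ### The first component -/

section First

variable {q : ℂ} {N n : ℕ} {z : Fin N → ℂ} {ρ : Fin N → ℝ}

/-- By strong induction the values below `k` are already taken, which leaves only `k` for `c k ≤ k`.
-/
theorem eq_castLE_of_le (hn : n ≤ N) {c : Fin n → Fin N} (hc : Function.Injective c)
    (hle : ∀ i, c i ≤ Fin.castLE hn i) : c = Fin.castLE hn := by
  have key : ∀ k : ℕ, ∀ h : k < n, (c ⟨k, h⟩ : ℕ) = k := by
    intro k
    induction k using Nat.strong_induction_on with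
    | _ k ih =>
      intro h
      have h1 : (c ⟨k, h⟩ : ℕ) ≤ k := by simpa [Fin.le_def] using hle ⟨k, h⟩
      by_contra hne
      have h2 : (c ⟨k, h⟩ : ℕ) < k := lt_of_le_of_ne h1 hne
      have h3 := ih _ h2 (h2.trans h)
      have h4 := hc (Fin.ext h3)
      rw [Fin.mk.injEq] at h4
      omega
  funext i
  exact Fin.ext (key i i.2)

/-- The `i`-th variable has poles only at `z_j` with `j ≤ i`, and no two variables may sit at the
same point because of `antisymProd`. So the `i`-th variable sits at `z_i`. The remaining product is
simplified pair by pair. -/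
theorem component_first (h : IsContour q z ρ) (hq : q ≠ 0) {β : ℂ} (hβ : β ≠ 0) (hn : n ≤ N) :
    component q β ρ z (Fin.castLE hn) =
      (∏ l : Fin n, br (β * z (Fin.castLE hn l))) * pairProd q z n := by
  set a : Fin n → Fin N := Fin.castLE hn with ha
  have hmono : StrictMono a := Fin.strictMono_castLE hn
  rw [component_eq, h.multiContour_eq hq fun w hw => differentiableAt_xiNum hq hβ hw,
    Finset.sum_eq_single a]
  rotate_left
  · intro c _ hca
    by_cases hinj : Function.Injective c
    · have : ∃ i, ¬ c i ≤ a i := by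
        by_contra! hle
        exact hca (eq_castLE_of_le hn hinj hle)
      obtain ⟨i, hi⟩ := this
      rw [Finset.prod_eq_zero (Finset.mem_univ i), mul_zero]
      rw [residue, if_neg (by simpa using hi)]
    · rw [xiNum_eq, antisymProd_eq_zero]
      · simp
      · intro h1
        exact hinj fun x y hxy => h1 (by simp only [hxy])
  · simp
  have hres : ∀ i, residue q z (Finset.Iic (a i)) (Finset.Ici (a i)) (a i) =
      -(den q z (Finset.Iio (a i)) (Finset.Ici (a i)) (z (a i)))⁻¹ := by
    intro i
    rw [residue, if_pos (by simp), Finset.Iic_erase]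
  have hden : ∏ i, den q z (Finset.Iio (a i)) (Finset.Ici (a i)) (z (a i)) ≠ 0 :=
    Finset.prod_ne_zero_iff.2 fun i _ => h.den_ne_zero hq (h.mem_self (a i)) _ (.inl (by simp))
  simp only [hres]
  rw [Finset.prod_neg, Finset.card_univ, Fintype.card_fin, Finset.prod_inv_distrib]
  -- The sign of `(-[q])^n` cancels that of the `n` residues. Multiplied by the denominators, the
  -- claim is an identity between products over pairs.
  have key : br q ^ n * prefactor q z * xiNum q β (fun l => z (a l)) =
      (∏ l : Fin n, br (β * z (a l))) * pairProd q z n *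
        ∏ i, den q z (Finset.Iio (a i)) (Finset.Ici (a i)) (z (a i)) := by
    have hp : ∀ i : Fin N, ((i : ℕ) < n) ↔ ∃ l, a l = i := by
      intro i
      constructor
      · intro hi
        exact ⟨⟨i, hi⟩, by simp [ha]⟩
      · rintro ⟨l, rfl⟩
        simp [ha]
    have hdd : ∀ i, den q z (Finset.Iio (a i)) (Finset.Ici (a i)) (z (a i)) =
        br q * br (q ^ 2 * z (a i) * z (a i)) *
        ((∏ j ∈ Finset.Iio (a i), br (z j / z (a i)) * br (q ^ 2 * z (a i) * z j)) *
          ∏ j ∈ Finset.Ioi (a i), br (q * z j / z (a i)) * br (q ^ 2 * z (a i) * z j)) := by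
      intro i
      rw [den, ← Finset.Ioi_insert, Finset.prod_insert (by simp), mul_div_assoc,
        div_self (h.ne_zero _), mul_one, prod_univ_eq_Iio_Ioi _ (a i)]
      simp only [Finset.prod_mul_distrib]
      ring
    have e1 : ∏ l, ∏ j ∈ Finset.Iio (a l), br (z j / z (a l)) * br (q ^ 2 * z (a l) * z j) =
        ∏ i : Fin N, ∏ j ∈ Finset.Ioi i,
          if (j : ℕ) < n then br (z i / z j) * br (q ^ 2 * z j * z i) else 1 := by
      rw [prod_comp_eq_prod_ite hmono hp fun i : Fin N => ∏ j ∈ Finset.Iio i, br (z j / z i) *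
        br (q ^ 2 * z i * z j), ← prod_Iio_eq_prod_Ioi fun i j : Fin N =>
        if (i : ℕ) < n then br (z j / z i) * br (q ^ 2 * z i * z j) else 1]
      refine Finset.prod_congr rfl fun i _ => ?_
      split_ifs <;> simp
    have e2 : ∏ l, ∏ j ∈ Finset.Ioi (a l), br (q * z j / z (a l)) * br (q ^ 2 * z (a l) * z j) =
        ∏ i : Fin N, ∏ j ∈ Finset.Ioi i,
          if (i : ℕ) < n then br (q * z j / z i) * br (q ^ 2 * z i * z j) else 1 := by
      rw [prod_comp_eq_prod_ite hmono hp fun i : Fin N => ∏ j ∈ Finset.Ioi i, br (q * z j / z i) *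
        br (q ^ 2 * z i * z j)]
      refine Finset.prod_congr rfl fun i _ => ?_
      split_ifs <;> simp
    have e3 := prod_pairs_comp_eq_prod_ite hmono hp fun i j => br (q * z j / z i) *
      (br (z i / z j) * br (q * z i * z j) * br (q ^ 2 * z i * z j))
    have e4 : prefactor q z * (∏ i : Fin N, ∏ j ∈ Finset.Ioi i,
        if (i : ℕ) < n ∧ (j : ℕ) < n then br (q * z j / z i) *
          (br (z i / z j) * br (q * z i * z j) * br (q ^ 2 * z i * z j)) else 1) =
        pairProd q z n * ((∏ i : Fin N, ∏ j ∈ Finset.Ioi i,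
          if (j : ℕ) < n then br (z i / z j) * br (q ^ 2 * z j * z i) else 1) *
        ∏ i : Fin N, ∏ j ∈ Finset.Ioi i,
          if (i : ℕ) < n then br (q * z j / z i) * br (q ^ 2 * z i * z j) else 1) := by
      rw [prefactor, pairProd]
      simp only [← Finset.prod_mul_distrib]
      refine Finset.prod_congr rfl fun i _ => Finset.prod_congr rfl fun j hj => ?_
      have hij : (i : ℕ) < j := Fin.lt_def.1 (Finset.mem_Ioi.1 hj)
      by_cases hj' : (j : ℕ) < n
      · have hi' : (i : ℕ) < n := hij.trans hj'
        simp only [hj', hi', and_self, if_true]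
        rw [mul_right_comm (q ^ 2) (z j)]
        ring
      · by_cases hi' : (i : ℕ) < n <;> simp [hi', hj']
    have e5 : xiNum q β (fun l => z (a l)) =
        (∏ i : Fin n, ∏ j ∈ Finset.Ioi i, br (q * z (a j) / z (a i)) *
          (br (z (a i) / z (a j)) * br (q * z (a i) * z (a j)) *
            br (q ^ 2 * z (a i) * z (a j)))) *
          ((∏ l, br (β * z (a l))) * ∏ l, br (q ^ 2 * z (a l) * z (a l))) := by
      rw [xiNum_eq, antisymProd]
      simp only [Finset.prod_mul_distrib]
    rw [e5, e3]
    simp only [hdd]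
    rw [Finset.prod_mul_distrib, Finset.prod_mul_distrib, Finset.prod_mul_distrib, e1, e2,
      Finset.prod_const, Finset.card_univ, Fintype.card_fin]
    linear_combination (br q ^ n * (∏ l, br (β * z (a l))) *
      ∏ l, br (q ^ 2 * z (a l) * z (a l))) * e4
  have hsign : (-br q) ^ n * (-1) ^ n = br q ^ n := by
    rw [← mul_pow]
    simp
  have e6 : ∀ X Y D : ℂ, D ≠ 0 → D * ((-br q) ^ n * X * (Y * ((-1) ^ n * D⁻¹))) =
      ((-br q) ^ n * (-1) ^ n) * X * Y := by
    intro X Y D hD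
    field_simp
  rw [← mul_right_inj' hden, e6 _ _ _ hden, hsign, key]
  ring

end First

/-! ### The last component -/

section Antisymmetrization

variable {N n : ℕ}

/-- Two functions that have proportional antisymmetrizations have proportional sums against an
antisymmetric weight. -/
theorem sum_mul_eq_of_antisymm {A Φ Φ' : (Fin n → ℂ) → ℂ} {p : ℂ} (u : Fin N → ℂ)
    (hA : ∀ w (σ : Equiv.Perm (Fin n)), A (w ∘ σ) = (σ.sign : ℂ) * A w)
    (h : ∀ c : Fin n → Fin N, A (u ∘ c) ≠ 0 →
      (∑ σ : Equiv.Perm (Fin n), (σ.sign : ℂ) * Φ ((u ∘ c) ∘ σ)) * p =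
        ∑ σ : Equiv.Perm (Fin n), (σ.sign : ℂ) * Φ' ((u ∘ c) ∘ σ)) :
    (∑ c : Fin n → Fin N, A (u ∘ c) * Φ (u ∘ c)) * p =
      ∑ c : Fin n → Fin N, A (u ∘ c) * Φ' (u ∘ c) := by
  -- Averaging over permutations: replacing `c` by `c ∘ σ` moves the sign of `σ` from `A` to `Ψ`.
  have key : ∀ Ψ : (Fin n → ℂ) → ℂ,
      ((n.factorial : ℕ) : ℂ) * ∑ c : Fin n → Fin N, A (u ∘ c) * Ψ (u ∘ c) =
        ∑ c : Fin n → Fin N, A (u ∘ c) *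
          ∑ σ : Equiv.Perm (Fin n), (σ.sign : ℂ) * Ψ ((u ∘ c) ∘ σ) := by
    intro Ψ
    have h1 : ∀ σ : Equiv.Perm (Fin n), ∑ c : Fin n → Fin N, A (u ∘ c) * Ψ (u ∘ c) =
        ∑ c : Fin n → Fin N, A (u ∘ c) * ((σ.sign : ℂ) * Ψ ((u ∘ c) ∘ σ)) := by
      intro σ
      rw [← Equiv.sum_comp (Equiv.arrowCongr σ.symm (Equiv.refl (Fin N)))]
      refine Finset.sum_congr rfl fun c _ => ?_
      have : u ∘ (Equiv.arrowCongr σ.symm (Equiv.refl (Fin N)) c) = (u ∘ c) ∘ σ := by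
        funext i
        simp
      rw [this, hA]
      ring
    simp only [Finset.mul_sum]
    rw [Finset.sum_comm]
    simp only [← Finset.mul_sum]
    simp only [Finset.mul_sum]
    rw [Finset.sum_congr rfl fun σ _ => (h1 σ).symm, Finset.sum_const, Finset.card_univ,
      Fintype.card_perm, Fintype.card_fin, nsmul_eq_mul, Finset.mul_sum]
  have hn : ((n.factorial : ℕ) : ℂ) ≠ 0 := by exact_mod_cast n.factorial_ne_zero
  rw [← mul_right_inj' hn, ← mul_assoc, key, key, Finset.sum_mul]
  refine Finset.sum_congr rfl fun c _ => ?_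
  by_cases hc : A (u ∘ c) = 0
  · simp [hc]
  · rw [mul_assoc, h c hc]

end Antisymmetrization

/-- The positions of the last `n` spins. -/
def lastPos {N n : ℕ} (hn : n ≤ N) (l : Fin n) : Fin N := ⟨N - n + l, by omega⟩

/-- The remaining positions. -/
def firstSet (N n : ℕ) : Finset (Fin N) := Finset.univ.filter fun j => (j : ℕ) < N - n

section Last

variable {q : ℂ} {N n : ℕ} {z : Fin N → ℂ} {ρ : Fin N → ℝ}

theorem strictMono_lastPos (hn : n ≤ N) : StrictMono (lastPos hn) := fun i j hij => by
  rw [Fin.lt_def] at hij ⊢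
  simp only [lastPos]
  omega

theorem lt_iff_not_exists_lastPos (hn : n ≤ N) (i : Fin N) :
    ¬ (i : ℕ) < N - n ↔ ∃ l, lastPos hn l = i := by
  constructor
  · intro hi
    exact ⟨⟨i - (N - n), by omega⟩, Fin.ext (by simp only [lastPos]; omega)⟩
  · rintro ⟨l, rfl⟩
    simp [lastPos]

theorem prod_eq_firstSet_lastPos (hn : n ≤ N) (F : Fin N → ℂ) :
    ∏ j, F j = (∏ j ∈ firstSet N n, F j) * ∏ l, F (lastPos hn l) := by
  rw [prod_comp_eq_prod_ite (strictMono_lastPos hn) (lt_iff_not_exists_lastPos hn), firstSet,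
    Finset.prod_filter, ← Finset.prod_mul_distrib]
  refine Finset.prod_congr rfl fun i _ => ?_
  split_ifs <;> simp

theorem prod_Iic_lastPos (hn : n ≤ N) (F : Fin N → ℂ) (i : Fin n) :
    ∏ j ∈ Finset.Iic (lastPos hn i), F j =
      (∏ j ∈ firstSet N n, F j) * ∏ k, if k ≤ i then F (lastPos hn k) else 1 := by
  have h1 : Finset.Iic (lastPos hn i) = Finset.univ.filter (· ≤ lastPos hn i) := by
    ext; simp
  rw [h1, Finset.prod_filter, prod_eq_firstSet_lastPos hn]
  congr 1
  · refine Finset.prod_congr rfl fun j hj => if_pos ?_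
    simp only [firstSet, Finset.mem_filter] at hj
    rw [Fin.le_def]
    simp only [lastPos]
    omega
  · simp only [(strictMono_lastPos hn).le_iff_le]

theorem prod_Ici_lastPos (hn : n ≤ N) (F : Fin N → ℂ) (i : Fin n) :
    ∏ j ∈ Finset.Ici (lastPos hn i), F j = ∏ k, if i ≤ k then F (lastPos hn k) else 1 := by
  have h1 : Finset.Ici (lastPos hn i) = Finset.univ.filter (lastPos hn i ≤ ·) := by
    ext; simp
  rw [h1, Finset.prod_filter, prod_eq_firstSet_lastPos hn, Finset.prod_eq_one, one_mul]
  · simp only [(strictMono_lastPos hn).le_iff_le]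
  · intro j hj
    refine if_neg ?_
    simp only [firstSet, Finset.mem_filter] at hj
    rw [Fin.le_def]
    simp only [lastPos]
    omega

/-- The common denominator of the triangular and of the diagonal form. -/
def commonDen (q : ℂ) (z : Fin N → ℂ) (hn : n ≤ N) (x : ℂ) : ℂ :=
  den q z Finset.univ (Finset.univ.image (lastPos hn)) x

/-- `triWeight` supplies the brackets that the denominator at position `i` lacks. All positions, and
the diagonal form as well, thus get the same denominator, and only the weights have to be
antisymmetrized. -/
theorem den_mul_triWeight (hn : n ≤ N) (i : Fin n) (x : ℂ) :
    den q z (Finset.Iic (lastPos hn i)) (Finset.Ici (lastPos hn i)) x *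
      triWeight q (fun l => z (lastPos hn l)) i x = commonDen q z hn x := by
  rw [commonDen, den, den, prod_Iic_lastPos, prod_Ici_lastPos, triWeight,
    prod_eq_firstSet_lastPos hn fun j => br (z j / x),
    Finset.prod_image fun _ _ _ _ h => (strictMono_lastPos hn).injective h]
  have : (∏ k, if k ≤ i then br (z (lastPos hn k) / x) else 1) *
      (∏ k, if i ≤ k then br (q * z (lastPos hn k) / x) else 1) *
      (∏ k, if i < k then br (z (lastPos hn k) / x)
        else if k < i then br (q * z (lastPos hn k) / x) else 1) =
      (∏ k, br (z (lastPos hn k) / x)) * ∏ k, br (q * z (lastPos hn k) / x) := by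
    simp only [← Finset.prod_mul_distrib]
    refine Finset.prod_congr rfl fun k _ => ?_
    rcases lt_trichotomy i k with h | rfl | h
    · simp [h, h.le, h.not_ge]; ring
    · simp
    · simp [h, h.le, h.not_ge, h.not_gt]
  linear_combination ((∏ j ∈ firstSet N n, br (z j / x)) * ∏ j, br (q ^ 2 * x * z j)) * this

theorem lastPos_notMem_firstSet (hn : n ≤ N) (i : Fin n) : lastPos hn i ∉ firstSet N n := by
  simp [firstSet, lastPos]

theorem den_mul_diagWeight (hn : n ≤ N) (i : Fin n) (x : ℂ) :
    den q z (insert (lastPos hn i) (firstSet N n)) {lastPos hn i} x *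
      diagWeight q (fun l => z (lastPos hn l)) i x = commonDen q z hn x := by
  rw [commonDen, den, den, diagWeight, Finset.prod_insert (lastPos_notMem_firstSet hn i),
    prod_eq_firstSet_lastPos hn fun j => br (z j / x), Finset.prod_singleton,
    Finset.prod_image fun _ _ _ _ h => (strictMono_lastPos hn).injective h]
  have : br (z (lastPos hn i) / x) * br (q * z (lastPos hn i) / x) *
      (∏ k, if k = i then 1 else br (z (lastPos hn k) / x) * br (q * z (lastPos hn k) / x)) =
      (∏ k, br (z (lastPos hn k) / x)) * ∏ k, br (q * z (lastPos hn k) / x) := by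
    rw [← Finset.prod_mul_distrib, ← Finset.mul_prod_erase _ _ (Finset.mem_univ i),
      ← Finset.mul_prod_erase _ (fun k => br (z (lastPos hn k) / x) * br (q * z (lastPos hn k) / x))
        (Finset.mem_univ i), if_pos rfl, one_mul]
    congr 1
    refine Finset.prod_congr rfl fun k hk => ?_
    rw [if_neg (Finset.ne_of_mem_erase hk)]
  linear_combination ((∏ j ∈ firstSet N n, br (z j / x)) * ∏ j, br (q ^ 2 * x * z j)) * this

theorem integrand_eq_of_den_mul {T U : Fin n → Finset (Fin N)} (f : (Fin n → ℂ) → ℂ)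
    {W : Fin n → ℂ → ℂ} {C : ℂ → ℂ} (hW : ∀ i x, den q z (T i) (U i) x * W i x = C x)
    {w : Fin n → ℂ} (hC : ∀ i, C (w i) ≠ 0) :
    integrand q z T U f w = (∏ l : Fin n, 1 / ((Real.pi : ℂ) * Complex.I * w l)) *
      (f w * (∏ i, W i (w i)) / ∏ i, C (w i)) := by
  have hW0 : ∏ i, W i (w i) ≠ 0 := Finset.prod_ne_zero_iff.2 fun i _ =>
    right_ne_zero_of_mul (by rw [hW i]; exact hC i)
  rw [integrand, ← Finset.prod_congr rfl fun i _ => hW i (w i), Finset.prod_mul_distrib,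
    mul_div_mul_right _ _ hW0]

/-- The numerator of the diagonal form. -/
def diagNum (q β : ℂ) {n : ℕ} (w : Fin n → ℂ) : ℂ :=
  antisymProd q w * ∏ i, br (β * w i) * br (q ^ 2 * w i * w i)

theorem differentiableAt_diagNum (hq : q ≠ 0) {β : ℂ} (hβ : β ≠ 0) {w : Fin n → ℂ}
    (hw : ∀ i, w i ≠ 0) : DifferentiableAt ℂ (diagNum q β) w := by
  have hp : ∀ k, DifferentiableAt ℂ (fun w : Fin n → ℂ => w k) w := fun k => by fun_prop
  refine (differentiableAt_antisymProd hq hw).mul (differentiableAt_prod fun i _ => ?_)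
  have hi := hw i
  exact (differentiableAt_br (by fun_prop) (by positivity)).mul
    (differentiableAt_br (by fun_prop) (by positivity))

theorem IsContour.eventually_mem (h : IsContour q z ρ) :
    ∀ᶠ t : ℂ in 𝓝[≠] 0, ∀ j, z j + t ∈ closedBall (z j) (ρ j) := by
  rw [eventually_all]
  intro j
  refine nhdsWithin_le_nhds ?_
  have : Tendsto (fun t : ℂ => z j + t) (𝓝 0) (𝓝 (z j)) := by
    simpa using (tendsto_const_nhds (x := z j)).add (tendsto_id (x := 𝓝 (0 : ℂ)))
  exact this (closedBall_mem_nhds _ (h.pos j))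

theorem IsContour.sq_ne_sq (h : IsContour q z ρ) {i j : Fin N} (hij : i ≠ j) :
    z i ^ 2 ≠ z j ^ 2 :=
  sq_ne_sq_of_br_div (h.ne_zero j) (h.br_div_ne_zero (h.mem_self j) (.inl hij))

theorem IsContour.eventually_sq_ne (h : IsContour q z ρ) :
    ∀ᶠ t : ℂ in 𝓝[≠] 0, ∀ i j, i ≠ j → (z i + t) ^ 2 ≠ (z j + t) ^ 2 := by
  simp only [eventually_all]
  intro i j hij
  refine nhdsWithin_le_nhds ?_
  have h1 : ContinuousAt (fun t : ℂ => (z i + t) ^ 2 - (z j + t) ^ 2) 0 := by fun_prop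
  have h2 := h1.eventually_ne (y := 0) (by
    simpa using sub_ne_zero.2 (h.sq_ne_sq hij))
  exact h2.mono fun t ht => sub_ne_zero.1 ht

/-- The multiple contour integral of the last component can be diagonalized. -/
theorem IsContour.multiContour_tri_mul (h : IsContour q z ρ) (hq : q ≠ 0) {β : ℂ} (hβ : β ≠ 0)
    (hn : n ≤ N) :
    multiContour z ρ (integrand q z (fun i => Finset.Iic (lastPos hn i))
        (fun i => Finset.Ici (lastPos hn i)) (xiNum q β)) *
      (∏ i : Fin n, ∏ j ∈ Finset.Ioi i, br (z (lastPos hn i) / z (lastPos hn j))) =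
    multiContour z ρ (integrand q z (fun i => insert (lastPos hn i) (firstSet N n))
        (fun i => {lastPos hn i}) (diagNum q β)) := by
  have ht1 := (h.tendsto_multiContour hq (T := fun i => Finset.Iic (lastPos hn i))
    (U := fun i => Finset.Ici (lastPos hn i)) fun w hw =>
      differentiableAt_xiNum hq hβ hw).mul_const
    (∏ i : Fin n, ∏ j ∈ Finset.Ioi i, br (z (lastPos hn i) / z (lastPos hn j)))
  have ht2 := h.tendsto_multiContour hq (T := fun i => insert (lastPos hn i) (firstSet N n))
    (U := fun i => {lastPos hn i}) fun w hw => differentiableAt_diagNum hq hβ hw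
  -- It suffices to compare the finite sums for fixed small `t ≠ 0`, where no denominator vanishes.
  refine tendsto_nhds_unique ht1 (ht2.congr' ?_)
  filter_upwards [h.eventually_mem, h.eventually_sq_ne, self_mem_nhdsWithin] with t hmem hsq ht0
  have ht0' : t ≠ 0 := ht0
  have hC : ∀ j, commonDen q z hn (z j + t) ≠ 0 := fun j =>
    h.den_ne_zero hq (hmem j) _ (.inr (by simpa using ht0'))
  set b : Fin n → ℂ := fun l => z (lastPos hn l) with hb
  -- The part shared by both integrands: `antisymProd` times factors that are symmetric in the
  -- variables.
  let A : (Fin n → ℂ) → ℂ := fun w => antisymProd q w *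
    ((∏ l : Fin n, 1 / ((Real.pi : ℂ) * Complex.I * w l)) *
      (∏ i, br (β * w i) * br (q ^ 2 * w i * w i)) / ∏ i, commonDen q z hn (w i))
  have hA : ∀ w (σ : Equiv.Perm (Fin n)), A (w ∘ σ) = (σ.sign : ℂ) * A w := by
    intro w σ
    simp only [A, antisymProd_comp, Function.comp]
    rw [Equiv.prod_comp σ fun l => 1 / ((Real.pi : ℂ) * Complex.I * w l),
      Equiv.prod_comp σ fun i => br (β * w i) * br (q ^ 2 * w i * w i),
      Equiv.prod_comp σ fun i => commonDen q z hn (w i)]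
    ring
  have key := sum_mul_eq_of_antisymm (A := A)
    (Φ := fun w => (∏ i : Fin n, ∏ j ∈ Finset.Ioi i, br (q * w j / w i)) *
      ∏ i, triWeight q b i (w i))
    (Φ' := fun w => ∏ i, diagWeight q b i (w i))
    (p := ∏ i : Fin n, ∏ j ∈ Finset.Ioi i, br (b i / b j)) (fun j => z j + t) hA (by
      -- Choices with coinciding centres are killed by `antisymProd`. For the others the shifted
      -- points have distinct squares, as `triSum_mul_eq_diagDet` requires.
      intro c hc
      have hinj : Function.Injective fun i => z (c i) + t := by
        by_contra hni
        exact hc (mul_eq_zero_of_left (antisymProd_eq_zero _ _ hni) _)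
      have hcinj : Function.Injective c := fun x y hxy => hinj (by simp only [hxy])
      have := triSum_mul_eq_diagDet hq b (fun i => z (c i) + t) (fun i => h.ne_zero _)
        (fun i => h.ne_zero_of_mem (hmem _))
        (fun i j hij => h.sq_ne_sq ((strictMono_lastPos hn).injective.ne hij))
        (fun i j hij => hsq _ _ (hcinj.ne hij))
        (fun i j => by
          have hw0 := h.ne_zero_of_mem (hmem (c j))
          have h1 := h.q_ne_zero hq (hmem (c j)) (k := lastPos hn i)
          have h2 := sq_ne_sq_of_br_div hw0 h1
          intro h3
          apply h2
          rw [mul_pow, h3]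
          field_simp)
      rw [diagDet_eq_sum] at this
      exact this)
  simp only [← Finset.mul_sum]
  rw [mul_assoc ((2 * Real.pi * Complex.I * t) ^ n)]
  congr 1
  refine Eq.trans ?_ (key.symm.trans ?_)
  · refine Finset.sum_congr rfl fun c _ => ?_
    rw [integrand_eq_of_den_mul _ (fun i x => den_mul_diagWeight hn i x) fun i => hC _]
    simp only [A, diagNum, Function.comp_def, b]
    ring
  · congr 1
    refine Finset.sum_congr rfl fun c _ => ?_
    rw [integrand_eq_of_den_mul _ (fun i x => den_mul_triWeight hn i x) fun i => hC _, xiNum_eq]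
    simp only [A, Function.comp_def, b]
    ring

end Last

/-! ### Value of the last component -/

section LastValue

variable {q : ℂ} {N n : ℕ} {z : Fin N → ℂ} {ρ : Fin N → ℝ}

/-- Indices are added in increasing order, so the new two-element sets correspond exactly to the
ordered pairs `(i, a)` with `i ∈ s`. -/
theorem prod_powersetCard_two_image (hz : Function.Injective z) (F : ℂ → ℂ) (M : Finset (Fin N)) :
    ∏ s ∈ (M.image z).powersetCard 2, F (∏ x ∈ s, x) =
      ∏ i, ∏ j ∈ Finset.Ioi i, if i ∈ M ∧ j ∈ M then F (z i * z j) else 1 := by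
  induction M using Finset.induction_on_max with
  | empty =>
    rw [Finset.image_empty, Finset.powersetCard_eq_empty.2 (by simp)]
    simp
  | insert a s ha ih =>
    have has : a ∉ s := fun h => lt_irrefl _ (ha a h)
    have h1 : z a ∉ s.image z := by
      simpa [hz.eq_iff] using has
    rw [Finset.image_insert, prod_powersetCard_two_insert F h1, ih,
      Finset.prod_image fun _ _ _ _ h => hz h]
    have h2 : ∏ i ∈ s, F (z a * z i) =
        ∏ i, ∏ j ∈ Finset.Ioi i, if i ∈ s ∧ j = a then F (z i * z j) else 1 := by
      rw [← Finset.prod_subset (Finset.subset_univ s)]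
      · refine Finset.prod_congr rfl fun i hi => ?_
        rw [Finset.prod_eq_single a]
        · simp [hi, mul_comm]
        · intro j _ hj
          simp [hj]
        · intro h
          exact absurd (Finset.mem_Ioi.2 (ha i hi)) h
      · intro i _ hi
        simp [hi]
    rw [h2]
    simp only [← Finset.prod_mul_distrib]
    refine Finset.prod_congr rfl fun i _ => Finset.prod_congr rfl fun j hj => ?_
    have hij : i < j := Finset.mem_Ioi.1 hj
    have e1 : (i ∈ insert a s ∧ j ∈ insert a s) ↔ (i ∈ s ∧ j ∈ s) ∨ (i ∈ s ∧ j = a) := by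
      simp only [Finset.mem_insert]
      constructor
      · rintro ⟨rfl | hi, rfl | hj'⟩
        · exact absurd hij (lt_irrefl _)
        · exact absurd (ha j hj') hij.not_gt
        · exact .inr ⟨hi, rfl⟩
        · exact .inl ⟨hi, hj'⟩
      · rintro (⟨h, h'⟩ | ⟨h, h'⟩) <;> simp [h, h']
    have e2 : ¬ ((i ∈ s ∧ j ∈ s) ∧ (i ∈ s ∧ j = a)) := by
      rintro ⟨⟨_, h⟩, ⟨_, rfl⟩⟩
      exact has h
    by_cases hA : i ∈ s ∧ j ∈ s
    · rw [if_pos hA, if_neg fun hB => e2 ⟨hA, hB⟩, if_pos (e1.2 (.inl hA)), mul_one]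
    · by_cases hB : i ∈ s ∧ j = a
      · rw [if_neg hA, if_pos hB, if_pos (e1.2 (.inr hB)), one_mul]
      · rw [if_neg hA, if_neg hB, if_neg fun h => (e1.1 h).elim hA hB, one_mul]

theorem IsContour.injective (h : IsContour q z ρ) : Function.Injective z := fun i j hij => by
  by_contra hne
  exact h.sq_ne_sq hne (by rw [hij])

theorem IsContour.generic (h : IsContour q z ρ) (hq : q ≠ 0) :
    Generic q (Finset.univ.image z) where
  ne_zero := by
    simp only [Finset.mem_image, Finset.mem_univ, true_and]
    rintro _ ⟨i, rfl⟩
    exact h.ne_zero i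
  br_div := by
    simp only [Finset.mem_image, Finset.mem_univ, true_and]
    rintro _ ⟨i, rfl⟩ _ ⟨j, rfl⟩ hij
    exact h.br_div_ne_zero (h.mem_self j) (.inl fun h => hij (by rw [h]))
  br_q_div := by
    simp only [Finset.mem_image, Finset.mem_univ, true_and]
    rintro _ ⟨i, rfl⟩ _ ⟨j, rfl⟩
    exact h.q_ne_zero hq (h.mem_self j)
  br_q_mul := by
    simp only [Finset.mem_image, Finset.mem_univ, true_and]
    rintro _ ⟨i, rfl⟩ _ ⟨j, rfl⟩
    exact h.q_mul_ne_zero hq (h.mem_self i)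

theorem card_firstSet (N n : ℕ) : (firstSet N n).card = N - n := by
  rw [firstSet, Fin.card_filter_val_lt, min_eq_right (Nat.sub_le N n)]

theorem residue_eq_resWeight (h : IsContour q z ρ) (β : ℂ) (hn : n ≤ N) (i : Fin n) {k : Fin N}
    (hk : k ∈ insert (lastPos hn i) (firstSet N n)) :
    br (β * z k) * br (q ^ 2 * z k * z k) *
        residue q z (insert (lastPos hn i) (firstSet N n)) {lastPos hn i} k =
      -resWeight q β ((firstSet N n).image z) (fun l => z (lastPos hn l)) (z (lastPos hn i))
        (z k) := by
  rw [residue, if_pos hk, resWeight, den, ← Finset.image_insert, ← Finset.image_erase h.injective,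
    Finset.prod_image fun _ _ _ _ e => h.injective e,
    Finset.prod_image fun _ _ _ _ e => h.injective e, Finset.prod_singleton,
    prod_eq_firstSet_lastPos hn fun j => br (q ^ 2 * z k * z j), div_eq_mul_inv, ← mul_assoc]
  simp only [mul_right_comm (q ^ 2) (z k)]
  ring

theorem IsContour.multiContour_diag (h : IsContour q z ρ) (hq : q ≠ 0) {β : ℂ} (hβ : β ≠ 0)
    (hn : n ≤ N) :
    multiContour z ρ (integrand q z (fun i => insert (lastPos hn i) (firstSet N n))
        (fun i => {lastPos hn i}) (diagNum q β)) =
      (-1) ^ n * resSum q β ((firstSet N n).image z) (fun l => z (lastPos hn l)) := by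
  rw [h.multiContour_eq hq fun w hw => differentiableAt_diagNum hq hβ hw, resSum]
  have h1 : (Fintype.piFinset fun i : Fin n => insert (z (lastPos hn i)) ((firstSet N n).image z)) =
      (Fintype.piFinset fun i : Fin n => insert (lastPos hn i) (firstSet N n)).image
        fun c l => z (c l) := by
    simp only [← Finset.image_insert]
    exact Fintype.piFinset_image _ _
  have hinj : Function.Injective fun (c : Fin n → Fin N) l => z (c l) := fun c c' hc =>
    funext fun l => h.injective (congrFun hc l)
  rw [h1, Finset.sum_image fun _ _ _ _ e => hinj e, Finset.mul_sum,
    ← Finset.sum_subset (Finset.subset_univ (Fintype.piFinset fun i : Fin n =>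
      insert (lastPos hn i) (firstSet N n)))]
  · refine Finset.sum_congr rfl fun c hc => ?_
    rw [Fintype.mem_piFinset] at hc
    rw [diagNum, mul_assoc, ← Finset.prod_mul_distrib,
      Finset.prod_congr rfl fun i _ => residue_eq_resWeight h β hn i (hc i), Finset.prod_neg,
      Finset.card_univ, Fintype.card_fin]
    ring
  · intro c _ hc
    rw [Fintype.mem_piFinset, not_forall] at hc
    obtain ⟨i, hi⟩ := hc
    rw [Finset.prod_eq_zero (Finset.mem_univ i) (if_neg hi), mul_zero]

/-- The factor `∏ [b_i/b_j]` in `resVal` cancels the one produced by the diagonalization. Then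
`pairRatio` turns `[q² z z]` into `[q z z]` for pairs in the first block, and the denominator of
`resVal` removes the mixed pairs. The sign comes from `[a/(q b)] = -[q b/a]`, once for each of the
`n (N - n)` mixed pairs. -/
theorem component_last (h : IsContour q z ρ) (hq : q ≠ 0) (hbq : br q ≠ 0) {β : ℂ} (hβ : β ≠ 0)
    (hn : n ≤ N) (hN : N - n = n ∨ N - n = n + 1) :
    component q β ρ z (lastPos hn) =
      (-1) ^ (n * (N - n)) * (∏ l, br (q * β * z (lastPos hn l))) * pairProd q z (N - n) := by
  set b : Fin n → ℂ := fun l => z (lastPos hn l) with hb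
  have hbinj : Function.Injective b := h.injective.comp (strictMono_lastPos hn).injective
  have hV : ∏ i : Fin n, ∏ j ∈ Finset.Ioi i, br (b i / b j) ≠ 0 :=
    Finset.prod_ne_zero_iff.2 fun i _ => Finset.prod_ne_zero_iff.2 fun j hj =>
      h.br_div_ne_zero (h.mem_self _)
        (.inl ((strictMono_lastPos hn).injective.ne (Finset.mem_Ioi.1 hj).ne))
  have hres : resSum q β ((firstSet N n).image z) b = resVal q β ((firstSet N n).image z) b := by
    refine resSum_eq_resVal ((h.generic hq).mono ?_) hbinj ?_ ?_
    · intro x hx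
      simp only [Finset.mem_union, Finset.mem_image, hb] at hx ⊢
      rcases hx with ⟨i, _, rfl⟩ | ⟨i, _, rfl⟩ <;> exact ⟨_, Finset.mem_univ _, rfl⟩
    · intro k hk
      obtain ⟨j, hj, hjk⟩ := Finset.mem_image.1 hk
      exact lastPos_notMem_firstSet hn k (h.injective hjk ▸ hj)
    · rw [Finset.card_image_of_injective _ h.injective, card_firstSet N n]
      exact hN
  have key := h.multiContour_tri_mul hq hβ hn
  rw [h.multiContour_diag hq hβ hn, hres, resVal, ← eq_div_iff hV] at key
  have hp : prefactor q z * pairRatio q ((firstSet N n).image z) =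
      (-1) ^ (n * (N - n)) * pairProd q z (N - n) *
        ∏ i, ∏ a ∈ (firstSet N n).image z, br (a / (q * b i)) * br (q ^ 2 * a * b i) := by
    have hs : ∏ i, ∏ a ∈ (firstSet N n).image z, br (a / (q * b i)) * br (q ^ 2 * a * b i) =
        (-1) ^ (n * (N - n)) * ∏ i : Fin N, ∏ j ∈ Finset.Ioi i,
          if (i : ℕ) < N - n ∧ ¬ (j : ℕ) < N - n then
            br (q * z j / z i) * br (q ^ 2 * z i * z j) else 1 := by
      have h1 : ∀ i, ∏ a ∈ (firstSet N n).image z, br (a / (q * b i)) * br (q ^ 2 * a * b i) =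
          (-1) ^ (N - n) * ∏ k ∈ Finset.Iio (lastPos hn i), if (k : ℕ) < N - n then
            br (q * z (lastPos hn i) / z k) * br (q ^ 2 * z k * z (lastPos hn i)) else 1 := by
        intro i
        rw [Finset.prod_image fun _ _ _ _ e => h.injective e]
        have h2 : firstSet N n =
            (Finset.Iio (lastPos hn i)).filter fun k : Fin N => (k : ℕ) < N - n := by
          ext k
          simp only [firstSet, Finset.mem_filter, Finset.mem_univ, true_and, Finset.mem_Iio,
            Fin.lt_def, lastPos]
          omega
        rw [← Finset.prod_filter, ← h2, ← card_firstSet N n, ← Finset.prod_const,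
          ← Finset.prod_mul_distrib]
        refine Finset.prod_congr rfl fun k _ => ?_
        rw [br_div_comm]
        ring
      simp only [h1]
      rw [Finset.prod_mul_distrib, Finset.prod_const, Finset.card_univ, Fintype.card_fin,
        ← pow_mul, mul_comm (N - n),
        prod_comp_eq_prod_ite (strictMono_lastPos hn) (lt_iff_not_exists_lastPos hn) fun i =>
          ∏ k ∈ Finset.Iio i, if (k : ℕ) < N - n then
            br (q * z i / z k) * br (q ^ 2 * z k * z i) else 1,
        ← prod_Iio_eq_prod_Ioi fun j i : Fin N => if (i : ℕ) < N - n ∧ ¬ (j : ℕ) < N - n then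
            br (q * z j / z i) * br (q ^ 2 * z i * z j) else 1]
      congr 1
      refine Finset.prod_congr rfl fun i _ => ?_
      by_cases hi : (i : ℕ) < N - n <;> simp [hi]
    have hsgn : ((-1 : ℂ) ^ (n * (N - n))) * (-1) ^ (n * (N - n)) = 1 := by
      rw [← mul_pow]
      simp
    have hpair : prefactor q z * pairRatio q ((firstSet N n).image z) =
        pairProd q z (N - n) * ∏ i : Fin N, ∏ j ∈ Finset.Ioi i,
          if (i : ℕ) < N - n ∧ ¬ (j : ℕ) < N - n then
            br (q * z j / z i) * br (q ^ 2 * z i * z j) else 1 := by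
      rw [pairRatio, prod_powersetCard_two_image h.injective fun x => br (q * x) / br (q ^ 2 * x),
        prefactor, pairProd]
      simp only [← Finset.prod_mul_distrib]
      refine Finset.prod_congr rfl fun i _ => Finset.prod_congr rfl fun j hj => ?_
      have hij : (i : ℕ) < j := Fin.lt_def.1 (Finset.mem_Ioi.1 hj)
      have h0 : br (q ^ 2 * (z i * z j)) ≠ 0 := by
        rw [← mul_assoc]
        exact h.q_mul_ne_zero hq (h.mem_self i)
      simp only [firstSet, Finset.mem_filter, Finset.mem_univ, true_and]
      by_cases hj' : (j : ℕ) < N - n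
      · have hi' : (i : ℕ) < N - n := hij.trans hj'
        simp only [hj', hi', and_self, if_true, not_true, and_false, if_false, mul_one]
        rw [mul_assoc (q ^ 2), mul_assoc q (z i) (z j)]
        exact (fun X R {Y : ℂ} hY => by field_simp :
          ∀ X R {Y : ℂ}, Y ≠ 0 → X * Y * (R / Y) = X * R) _ _ h0
      · by_cases hi' : (i : ℕ) < N - n <;> simp [hi', hj']
    rw [hpair, hs]
    linear_combination (- pairProd q z (N - n) * ∏ i : Fin N, ∏ j ∈ Finset.Ioi i,
          if (i : ℕ) < N - n ∧ ¬ (j : ℕ) < N - n then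
            br (q * z j / z i) * br (q ^ 2 * z i * z j) else 1) * hsgn
  have hD : ∏ i, ∏ a ∈ (firstSet N n).image z, br (a / (q * b i)) * br (q ^ 2 * a * b i) ≠ 0 := by
    refine Finset.prod_ne_zero_iff.2 fun i _ => Finset.prod_ne_zero_iff.2 fun a ha => ?_
    obtain ⟨k, _, rfl⟩ := Finset.mem_image.1 ha
    refine mul_ne_zero ?_ (h.q_mul_ne_zero hq (h.mem_self k))
    rw [br_div_comm, neg_ne_zero]
    exact h.q_ne_zero hq (h.mem_self k)
  rw [component_eq, key]
  have e : ∀ X V B R D : ℂ, V ≠ 0 → D ≠ 0 → (-br q) ^ n * X * ((-1) ^ n *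
      ((br q)⁻¹ ^ n * V * B * R / D) / V) = X * R / D * B := by
    intro X V B R D hV hD
    have h2 : (-br q) ^ n * (-1) ^ n * (br q)⁻¹ ^ n = 1 := by
      rw [← mul_pow, ← mul_pow]
      simp [hbq]
    have h3 : (-br q) ^ n * X * ((-1) ^ n * ((br q)⁻¹ ^ n * V * B * R / D) / V) =
        ((-br q) ^ n * (-1) ^ n * (br q)⁻¹ ^ n) * (X * R / D * B) * (V / V) := by ring
    rw [h3, h2, div_self hV]
    ring
  rw [e _ _ _ _ _ hV hD, hp, mul_div_cancel_right₀ _ hD]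
  ring

end LastValue

/-! ### Comparison of the first and of the last component -/

section Base

variable {q : ℂ} {N n : ℕ} {z : Fin N → ℂ}

/-- Holds because `e⁻¹ = e`. It will be used with `e = q³ s⁻²`. -/
theorem br_mul_inv_of_sq {e x y : ℂ} (he : e ^ 2 = 1) (hxy : y = e * x⁻¹) : br y = -e * br x := by
  have h0 : e ≠ 0 := by
    rintro rfl
    norm_num at he
  have : e⁻¹ = e := by
    rw [inv_eq_iff_eq_inv, eq_comm, inv_eq_of_mul_eq_one_right]
    rw [← sq, he]
  rw [hxy, br, br, mul_inv, this, inv_inv]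
  ring

theorem prod_pairs_rev (F : Fin N → Fin N → ℂ) :
    ∏ i : Fin N, ∏ j ∈ Finset.Ioi i, F i.rev j.rev = ∏ i, ∏ j ∈ Finset.Ioi i, F j i := by
  rw [← prod_Iio_eq_prod_Ioi, ← Equiv.prod_comp Fin.revPerm]
  refine Finset.prod_congr rfl fun i _ => ?_
  simp only [Fin.revPerm_apply, Fin.rev_rev]
  refine Finset.prod_nbij' Fin.rev Fin.rev ?_ ?_ (by simp) (by simp) (by simp)
  · intro j hj
    simpa using Fin.lt_rev_iff.1 (Finset.mem_Iio.1 hj)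
  · intro j hj
    simpa [Fin.rev_lt_iff] using hj

theorem prod_pairs_mixed (hn : n ≤ N) (x : ℂ) :
    (∏ i : Fin N, ∏ j ∈ Finset.Ioi i,
      if (i : ℕ) < N - n ∧ ¬ (j : ℕ) < N - n then x else 1) = x ^ (n * (N - n)) := by
  have h1 : ∀ i : Fin N, (∏ j ∈ Finset.Ioi i,
      if (i : ℕ) < N - n ∧ ¬ (j : ℕ) < N - n then x else 1) =
      if (i : ℕ) < N - n then x ^ n else 1 := by
    intro i
    by_cases hi : (i : ℕ) < N - n
    · rw [if_pos hi]
      have h2 := prod_comp_eq_prod_ite (strictMono_lastPos hn) (lt_iff_not_exists_lastPos hn)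
        fun _ => x
      rw [Finset.prod_const, Finset.card_univ, Fintype.card_fin] at h2
      rw [h2, Finset.prod_subset (Finset.subset_univ _)]
      · simp [hi]
      · intro j _ hj
        rw [Finset.mem_Ioi, not_lt, Fin.le_def] at hj
        rw [if_neg]
        omega
    · simp [hi]
  simp only [h1]
  rw [← Finset.prod_filter, Finset.prod_const, ← pow_mul]
  congr 2
  exact card_firstSet N n

/-- The reversal maps the first `n` positions to the last `n` and exchanges `[q z z]` with `[q² z
z]`. Each unmixed pair gives a factor `-e`. Since `(-e)² = 1`, the number of unmixed pairs may be
replaced by that of all pairs plus that of the mixed ones. -/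
theorem pairProd_rev {e : ℂ} (he : e ^ 2 = 1) {z' : Fin N → ℂ} (hn : n ≤ N)
    (h0 : ∀ i j, z' j / z' i = z i.rev / z j.rev)
    (h1 : ∀ i j, q * z' i * z' j = e * (q ^ 2 * z i.rev * z j.rev)⁻¹)
    (h2 : ∀ i j, q ^ 2 * z' i * z' j = e * (q * z i.rev * z j.rev)⁻¹) :
    pairProd q z' n = (∏ i : Fin N, ∏ _j ∈ Finset.Ioi i, -e) * (-e) ^ (n * (N - n)) *
      pairProd q z (N - n) := by
  rw [pairProd, pairProd, ← prod_pairs_mixed hn]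
  have h4 : ∀ i j : Fin N, (if (j : ℕ) < n then br (q * z' j / z' i) * br (q * z' i * z' j)
      else if (i : ℕ) < n then 1 else br (q * z' j / z' i) * br (q ^ 2 * z' i * z' j)) =
      if N - n ≤ (j.rev : ℕ) then -e * (br (q * z i.rev / z j.rev) *
        br (q ^ 2 * z j.rev * z i.rev))
      else if N - n ≤ (i.rev : ℕ) then 1
      else -e * (br (q * z i.rev / z j.rev) * br (q * z j.rev * z i.rev)) := by
    intro i j
    have hj : (j : ℕ) < n ↔ N - n ≤ (j.rev : ℕ) := by
      rw [Fin.val_rev]; omega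
    have hi : (i : ℕ) < n ↔ N - n ≤ (i.rev : ℕ) := by
      rw [Fin.val_rev]; omega
    simp only [hj, hi]
    rw [mul_div_assoc, h0, br_mul_inv_of_sq he (h1 i j), br_mul_inv_of_sq he (h2 i j),
      mul_div_assoc, mul_right_comm _ (z i.rev), mul_right_comm _ (z i.rev)]
    split_ifs <;> ring
  simp only [h4]
  rw [prod_pairs_rev fun i j : Fin N => if N - n ≤ (j : ℕ) then -e * (br (q * z i / z j) *
        br (q ^ 2 * z j * z i)) else if N - n ≤ (i : ℕ) then 1
      else -e * (br (q * z i / z j) * br (q * z j * z i))]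
  simp only [← Finset.prod_mul_distrib]
  refine Finset.prod_congr rfl fun i _ => Finset.prod_congr rfl fun j hj => ?_
  have hij : (i : ℕ) < j := Fin.lt_def.1 (Finset.mem_Ioi.1 hj)
  have hee : (-e) * (-e) = 1 := by rw [← he]; ring
  by_cases hj' : (j : ℕ) < N - n
  · have hi' : (i : ℕ) < N - n := hij.trans hj'
    simp [hj', hi'.not_ge, hj'.not_ge]
  · by_cases hi' : (i : ℕ) < N - n
    · rw [if_neg hi'.not_ge, if_pos (not_lt.1 hj'), if_pos ⟨hi', hj'⟩, if_neg hj', if_pos hi', hee,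
        mul_one]
    · simp [hi', hj', not_lt.1 hi']

/-- The factor `e ^ ((N + 1) * n)` is ε_N, `(-e) ^ n` comes from the brackets with β, and the rest
from `pairProd_rev`. For `N = 2n` and `N = 2n + 1` the total exponent of `e` is even, and so is `n +
N(N-1)/2`. -/
theorem sign_exponent {e : ℂ} (he : e ^ 2 = 1) (hN : N - n = n ∨ N - n = n + 1) :
    e ^ ((N + 1) * n) * ((-e) ^ n * ((∏ i : Fin N, ∏ _j ∈ Finset.Ioi i, -e) *
      (-e) ^ (n * (N - n)))) = (-1) ^ (n * (N - n)) := by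
  have hpairs : (∏ i : Fin N, ∏ _j ∈ Finset.Ioi i, -e) = (-e) ^ (N * (N - 1) / 2) := by
    simp only [Finset.prod_const, Fin.card_Ioi]
    rw [Finset.prod_pow_eq_pow_sum, Fin.sum_univ_eq_sum_range fun i => N - 1 - i,
      Finset.sum_range_reflect fun i => i, Finset.sum_range_id]
  have h1 : ∀ {x : ℂ}, x ^ 2 = 1 → ∀ {m k t : ℕ}, m = 2 * k + t → x ^ m = x ^ t := by
    rintro x hx m k t rfl
    rw [pow_add, pow_mul, hx, one_pow, one_mul]
  have hm : (-1 : ℂ) ^ 2 = 1 := by norm_num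
  rw [hpairs, ← pow_add, ← pow_add, neg_pow e, mul_left_comm, ← pow_add]
  rcases hN with hN | hN
  · have h2 : N * (N - 1) / 2 + n = 2 * (n * n) := by
      rcases Nat.eq_zero_or_pos n with rfl | hn
      · have : N = 0 := by omega
        simp [this]
      · obtain ⟨k, rfl⟩ : ∃ k, n = k + 1 := ⟨n - 1, by omega⟩
        have hNk : N = 2 * (k + 1) := by omega
        rw [hNk, mul_assoc, Nat.mul_div_cancel_left _ two_pos,
          show 2 * (k + 1) - 1 = 2 * k + 1 by omega]
        ring
    have hNk : N = 2 * n := by omega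
    obtain ⟨r, hr⟩ := Nat.even_mul_succ_self n
    rw [hN, h1 hm (k := n * n) (t := n * n) (by linarith),
      h1 he (k := 2 * (n * n) + r) (t := 0) ?_, pow_zero, mul_one]
    have h3 : (N + 1) * n = 2 * (n * n) + n := by rw [hNk]; ring
    rw [h3]
    linarith
  · have hNk : N = 2 * n + 1 := by omega
    have h2 : N * (N - 1) / 2 = (2 * n + 1) * n := by
      rw [hNk, Nat.add_sub_cancel, mul_left_comm, Nat.mul_div_cancel_left _ two_pos]
    rw [hN, h2, h1 hm (k := n * (n + 1)) (t := n * (n + 1)) (by ring), h1 he (t := 0)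
      (k := 5 * (n * (n + 1) / 2)) ?_, pow_zero, mul_one]
    have h3 : n * (n + 1) / 2 * 2 = n * (n + 1) :=
      Nat.div_mul_cancel (Nat.even_mul_succ_self n).two_dvd
    have h4 : (N + 1) * n = 2 * (n * (n + 1)) := by rw [hNk]; ring
    rw [h4]
    linarith

theorem component_last_eq_first {s β : ℂ} {ρ ρ' : Fin N → ℝ} (h : IsContour q z ρ) (hq : q ≠ 0)
    (hbq : br q ≠ 0) (hβ : β ≠ 0) (hs : s ^ 4 = q ^ 6)
    (h' : IsContour q (fun i => s⁻¹ * (z i.rev)⁻¹) ρ') (hn : n ≤ N)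
    (hN : N - n = n ∨ N - n = n + 1) :
    component q β ρ z (lastPos hn) = (q ^ 3 * s⁻¹ ^ 2) ^ ((N + 1) * n) *
      component q (q ^ 2 * s⁻¹ * β⁻¹) ρ' (fun i => s⁻¹ * (z i.rev)⁻¹) (Fin.castLE hn) := by
  have hs0 : s ≠ 0 := by
    rintro rfl
    exact pow_ne_zero 6 hq (by rw [← hs]; norm_num)
  have he : (q ^ 3 * s⁻¹ ^ 2) ^ 2 = 1 := by
    have : (q ^ 3 * s⁻¹ ^ 2) ^ 2 = q ^ 6 / s ^ 4 := by
      field_simp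
    rw [this, hs, div_self (pow_ne_zero 6 hq)]
  have hz := h.ne_zero
  rw [component_last h hq hbq hβ hn hN, component_first h' hq (by positivity) hn,
    pairProd_rev he hn (z := z), ← sign_exponent he hN]
  · have h1 : ∏ l : Fin n, br (q ^ 2 * s⁻¹ * β⁻¹ * (s⁻¹ * (z (Fin.castLE hn l).rev)⁻¹)) =
        (-(q ^ 3 * s⁻¹ ^ 2)) ^ n * ∏ l, br (q * β * z (lastPos hn l)) := by
      rw [← Equiv.prod_comp Fin.revPerm fun l => br (q * β * z (lastPos hn l))]
      have : (-(q ^ 3 * s⁻¹ ^ 2)) ^ n = ∏ _l : Fin n, (-(q ^ 3 * s⁻¹ ^ 2)) := by simp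
      rw [this, ← Finset.prod_mul_distrib]
      refine Finset.prod_congr rfl fun l _ => ?_
      have h2 : (Fin.castLE hn l).rev = lastPos hn (Fin.revPerm l) := by
        ext
        simp only [Fin.revPerm_apply, lastPos, Fin.val_rev, Fin.val_castLE]
        omega
      rw [h2]
      refine br_mul_inv_of_sq he ?_
      have := hz (lastPos hn (Fin.revPerm l))
      field_simp
    rw [h1]
    ring
  · intro i j
    have := hz i.rev
    have := hz j.rev
    field_simp
  · intro i j
    have := hz i.rev
    have := hz j.rev
    field_simp
  · intro i j
    have := hz i.rev
    have := hz j.rev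
    field_simp

end Base

/-! ### Exchange relations -/

section Exchange

variable {q β : ℂ} {N n : ℕ} {z : Fin N → ℂ} {ρ : Fin N → ℝ}

theorem IsContour.comp_perm (h : IsContour q z ρ) (τ : Equiv.Perm (Fin N)) :
    IsContour q (z ∘ τ) (ρ ∘ τ) where
  pos _ := h.pos _
  zero_notMem _ := h.zero_notMem _
  notMem _ _ hjk := h.notMem _ _ (τ.injective.ne hjk)
  neg_notMem _ _ := h.neg_notMem _ _
  q_mul_notMem _ _ := h.q_mul_notMem _ _
  neg_q_mul_notMem _ _ := h.neg_q_mul_notMem _ _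
  inv_notMem _ _ := h.inv_notMem _ _
  neg_inv_notMem _ _ := h.neg_inv_notMem _ _

theorem multiContour_comp_perm (τ : Equiv.Perm (Fin N)) (f : (Fin n → ℂ) → ℂ) :
    multiContour (z ∘ τ) (ρ ∘ τ) f = multiContour z ρ f := by
  exact Equiv.sum_comp (Equiv.arrowCongr (Equiv.refl (Fin n)) τ)
    fun c => torusIntegral f (fun l => z (c l)) fun l => ρ (c l)

theorem den_comp_perm (τ : Equiv.Perm (Fin N)) (T U : Finset (Fin N)) (w : ℂ) :
    den q (z ∘ τ) T U w = den q z (T.image τ) (U.image τ) w := by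
  rw [den, den, Finset.prod_image fun _ _ _ _ e => τ.injective e,
    Finset.prod_image fun _ _ _ _ e => τ.injective e, ← Equiv.prod_comp τ fun j => br (q ^ 2 * w * z j)]
  rfl

/-- A linear relation between the denominators of one variable gives a linear relation between the
contour integrals. -/
theorem IsContour.multiContour_linear (h : IsContour q z ρ) (hq : q ≠ 0)
    {T U T₁ U₁ T₂ U₂ : Fin n → Finset (Fin N)} {f : (Fin n → ℂ) → ℂ}
    (hf : ∀ w, (∀ i, w i ≠ 0) → DifferentiableAt ℂ f w) (k : Fin n)
    (h₁ : ∀ l, l ≠ k → T₁ l = T l ∧ U₁ l = U l) (h₂ : ∀ l, l ≠ k → T₂ l = T l ∧ U₂ l = U l)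
    {c c₁ c₂ : ℂ} (hk : ∀ j, ∀ w ∈ closedBall (z j) (ρ j), w ≠ z j →
      (den q z (T k) (U k) w)⁻¹ * c =
        c₁ * (den q z (T₁ k) (U₁ k) w)⁻¹ + c₂ * (den q z (T₂ k) (U₂ k) w)⁻¹) :
    multiContour z ρ (integrand q z T U f) * c =
      c₁ * multiContour z ρ (integrand q z T₁ U₁ f) +
        c₂ * multiContour z ρ (integrand q z T₂ U₂ f) := by
  have ht := (h.tendsto_multiContour hq (T := T) (U := U) hf).mul_const c
  have ht₁ := (h.tendsto_multiContour hq (T := T₁) (U := U₁) hf).const_mul c₁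
  have ht₂ := (h.tendsto_multiContour hq (T := T₂) (U := U₂) hf).const_mul c₂
  -- The relation `hk` is available only off the centres, which is enough for the limits of finite
  -- sums.
  refine tendsto_nhds_unique ht ((ht₁.add ht₂).congr' ?_)
  filter_upwards [h.eventually_mem, self_mem_nhdsWithin] with t hmem ht0
  have ht0' : t ≠ 0 := ht0
  rw [Finset.mul_sum, Finset.mul_sum, ← Finset.sum_add_distrib, Finset.sum_mul]
  refine Finset.sum_congr rfl fun d _ => ?_
  have hd := hk (d k) _ (hmem (d k)) (by simpa using ht0')
  rw [integrand_eq, integrand_eq, integrand_eq]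
  simp only [← Finset.mul_prod_erase _ _ (Finset.mem_univ k)]
  have e₁ : ∏ l ∈ Finset.univ.erase k,
      (2 * (z (d l) + t)⁻¹ * (den q z (T₁ l) (U₁ l) (z (d l) + t))⁻¹) =
      ∏ l ∈ Finset.univ.erase k,
      (2 * (z (d l) + t)⁻¹ * (den q z (T l) (U l) (z (d l) + t))⁻¹) := by
    refine Finset.prod_congr rfl fun l hl => ?_
    rw [(h₁ l (Finset.ne_of_mem_erase hl)).1, (h₁ l (Finset.ne_of_mem_erase hl)).2]
  have e₂ : ∏ l ∈ Finset.univ.erase k,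
      (2 * (z (d l) + t)⁻¹ * (den q z (T₂ l) (U₂ l) (z (d l) + t))⁻¹) =
      ∏ l ∈ Finset.univ.erase k,
      (2 * (z (d l) + t)⁻¹ * (den q z (T l) (U l) (z (d l) + t))⁻¹) := by
    refine Finset.prod_congr rfl fun l hl => ?_
    rw [(h₂ l (Finset.ne_of_mem_erase hl)).1, (h₂ l (Finset.ne_of_mem_erase hl)).2]
  rw [e₁, e₂]
  generalize (∏ l ∈ Finset.univ.erase k,
      (2 * (z (d l) + t)⁻¹ * (den q z (T l) (U l) (z (d l) + t))⁻¹)) = R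
  linear_combination (-(2 * Real.pi * Complex.I * t) ^ n * (2 * Real.pi * Complex.I)⁻¹ ^ n *
    f (fun i => z (d i) + t) * (2 * (z (d k) + t)⁻¹) * R) * hd

variable {i i' : Fin N}

theorem swap_lt_swap (hi : (i' : ℕ) = i + 1) {x y : Fin N} (hxy : x < y)
    (h : ¬ (x = i ∧ y = i')) : Equiv.swap i i' x < Equiv.swap i i' y := by
  simp only [Equiv.swap_apply_def]
  simp only [Fin.ext_iff, Fin.lt_def] at *
  split_ifs <;> omega

/-- An adjacent transposition permutes the ordered pairs other than `(i, i')`, and `[q² z_i z_{i'}]`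
is symmetric. So only `[q z_{i'}/z_i]` changes. -/
theorem prefactor_comp_swap (hi : (i' : ℕ) = i + 1) :
    prefactor q (z ∘ Equiv.swap i i') * br (q * z i' / z i) =
      prefactor q z * br (q * z i / z i') := by
  set τ := Equiv.swap i i' with hτ
  have hlt : i < i' := by rw [Fin.lt_def]; omega
  have hpairs : ∀ F : Fin N → Fin N → ℂ, ∏ x, ∏ y ∈ Finset.Ioi x, F x y =
      F i i' * ∏ p : Fin N × Fin N with p.1 < p.2 ∧ ¬ (p.1 = i ∧ p.2 = i'), F p.1 p.2 := by
    intro F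
    have h1 : ∏ x, ∏ y ∈ Finset.Ioi x, F x y =
        ∏ p : Fin N × Fin N with p.1 < p.2, F p.1 p.2 := by
      rw [Finset.prod_filter, Fintype.prod_prod_type]
      refine Finset.prod_congr rfl fun x _ => ?_
      rw [← Finset.prod_filter]
      congr 1
      ext y
      simp
    have h2 : (Finset.univ.filter fun p : Fin N × Fin N => p.1 < p.2) =
        insert (i, i') (Finset.univ.filter fun p : Fin N × Fin N =>
          p.1 < p.2 ∧ ¬ (p.1 = i ∧ p.2 = i')) := by
      ext ⟨x, y⟩
      simp only [Finset.mem_filter, Finset.mem_univ, true_and, Finset.mem_insert, Prod.mk.injEq]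
      constructor
      · intro h
        by_cases hxy : x = i ∧ y = i'
        · exact .inl hxy
        · exact .inr ⟨h, hxy⟩
      · rintro (⟨rfl, rfl⟩ | h)
        · exact hlt
        · exact h.1
    rw [h1, h2, Finset.prod_insert (by simp)]
  have hstable : ∏ p : Fin N × Fin N with p.1 < p.2 ∧ ¬ (p.1 = i ∧ p.2 = i'),
        br (q * z (τ p.2) / z (τ p.1)) * br (q ^ 2 * z (τ p.1) * z (τ p.2)) =
      ∏ p : Fin N × Fin N with p.1 < p.2 ∧ ¬ (p.1 = i ∧ p.2 = i'),
        br (q * z p.2 / z p.1) * br (q ^ 2 * z p.1 * z p.2) := by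
    have hmaps : ∀ p ∈ (Finset.univ.filter fun p : Fin N × Fin N =>
        p.1 < p.2 ∧ ¬ (p.1 = i ∧ p.2 = i')), (τ p.1, τ p.2) ∈ (Finset.univ.filter
        fun p : Fin N × Fin N => p.1 < p.2 ∧ ¬ (p.1 = i ∧ p.2 = i')) := by
      rintro ⟨x, y⟩ hp
      simp only [Finset.mem_filter, Finset.mem_univ, true_and] at hp ⊢
      refine ⟨swap_lt_swap hi hp.1 hp.2, ?_⟩
      rintro ⟨h1, h2⟩
      have hx : x = i' := by
        rw [← Equiv.swap_apply_left i i', ← hτ, ← τ.apply_eq_iff_eq, h1, hτ, Equiv.swap_apply_self]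
      have hy : y = i := by
        rw [← Equiv.swap_apply_right i i', ← hτ, ← τ.apply_eq_iff_eq, h2, hτ, Equiv.swap_apply_self]
      exact absurd (hx ▸ hy ▸ hp.1) hlt.not_gt
    exact Finset.prod_nbij' (fun p => (τ p.1, τ p.2)) (fun p => (τ p.1, τ p.2)) hmaps hmaps
      (by simp [hτ]) (by simp [hτ]) (by simp)
  rw [prefactor, prefactor, hpairs, hpairs]
  simp only [Function.comp]
  rw [hstable, hτ, Equiv.swap_apply_left, Equiv.swap_apply_right, mul_right_comm (q ^ 2) (z i)]
  ring

theorem component_comp_perm (τ : Equiv.Perm (Fin N)) (a : Fin n → Fin N) :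
    component q β (ρ ∘ τ) (z ∘ τ) a = (-br q) ^ n * prefactor q (z ∘ τ) *
      multiContour z ρ (integrand q z (fun l => (Finset.Iic (a l)).image τ)
        (fun l => (Finset.Ici (a l)).image τ) (xiNum q β)) := by
  rw [component_eq, multiContour_comp_perm]
  congr 2
  funext w
  rw [integrand, integrand]
  simp only [den_comp_perm]

theorem image_swap_Iic (hi : (i' : ℕ) = i + 1) {x : Fin N} (hx : x ≠ i) :
    (Finset.Iic x).image (Equiv.swap i i') = Finset.Iic x := by
  ext y
  simp only [Finset.mem_image, Finset.mem_Iic]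
  constructor
  · rintro ⟨u, hu, rfl⟩
    simp only [Equiv.swap_apply_def]
    simp only [Fin.ext_iff, Fin.le_def, ne_eq] at *
    split_ifs <;> omega
  · intro hy
    refine ⟨Equiv.swap i i' y, ?_, by simp⟩
    simp only [Equiv.swap_apply_def]
    simp only [Fin.ext_iff, Fin.le_def, ne_eq] at *
    split_ifs <;> omega

theorem image_swap_Ici (hi : (i' : ℕ) = i + 1) {x : Fin N} (hx : x ≠ i') :
    (Finset.Ici x).image (Equiv.swap i i') = Finset.Ici x := by
  ext y
  simp only [Finset.mem_image, Finset.mem_Ici]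
  constructor
  · rintro ⟨u, hu, rfl⟩
    simp only [Equiv.swap_apply_def]
    simp only [Fin.ext_iff, Fin.le_def, ne_eq] at *
    split_ifs <;> omega
  · intro hy
    refine ⟨Equiv.swap i i' y, ?_, by simp⟩
    simp only [Equiv.swap_apply_def]
    simp only [Fin.ext_iff, Fin.le_def, ne_eq] at *
    split_ifs <;> omega

theorem image_swap_Iic_self (hi : (i' : ℕ) = i + 1) :
    (Finset.Iic i).image (Equiv.swap i i') = insert i' (Finset.Iio i) := by
  ext y
  simp only [Finset.mem_image, Finset.mem_Iic, Finset.mem_insert, Finset.mem_Iio]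
  constructor
  · rintro ⟨u, hu, rfl⟩
    simp only [Equiv.swap_apply_def]
    simp only [Fin.ext_iff, Fin.le_def, Fin.lt_def] at *
    split_ifs <;> omega
  · intro hy
    refine ⟨Equiv.swap i i' y, ?_, by simp⟩
    simp only [Equiv.swap_apply_def]
    simp only [Fin.ext_iff, Fin.le_def, Fin.lt_def] at *
    split_ifs <;> omega

theorem image_swap_Ici_self (hi : (i' : ℕ) = i + 1) :
    (Finset.Ici i').image (Equiv.swap i i') = insert i (Finset.Ioi i') := by
  ext y
  simp only [Finset.mem_image, Finset.mem_Ici, Finset.mem_insert, Finset.mem_Ioi]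
  constructor
  · rintro ⟨u, hu, rfl⟩
    simp only [Equiv.swap_apply_def]
    simp only [Fin.ext_iff, Fin.le_def, Fin.lt_def] at *
    split_ifs <;> omega
  · intro hy
    refine ⟨Equiv.swap i i' y, ?_, by simp⟩
    simp only [Equiv.swap_apply_def]
    simp only [Fin.ext_iff, Fin.le_def, Fin.lt_def] at *
    split_ifs <;> omega

theorem Iic_eq_insert_insert (hi : (i' : ℕ) = i + 1) :
    Finset.Iic i' = insert i' (insert i (Finset.Iio i)) := by
  ext y
  simp only [Finset.mem_Iic, Finset.mem_insert, Finset.mem_Iio, Fin.ext_iff, Fin.le_def, Fin.lt_def]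
  omega

theorem Ici_eq_insert_insert (hi : (i' : ℕ) = i + 1) :
    Finset.Ici i = insert i (insert i' (Finset.Ioi i')) := by
  ext y
  simp only [Finset.mem_Ici, Finset.mem_insert, Finset.mem_Ioi, Fin.ext_iff, Fin.le_def, Fin.lt_def]
  omega

/-- With a down spin at `i` or `i'`, before or after the exchange, the denominator is one common
factor times three of the four brackets of `z_i`, `z_{i'}`, `q z_i`, `q z_{i'}` over `w`. The
exchange relations thus reduce to the three-term identity. -/
theorem den_Iic_left (hi : (i' : ℕ) = i + 1) (w : ℂ) :
    den q z (Finset.Iic i) (Finset.Ici i) w = den q z (Finset.Iio i) (Finset.Ioi i') w *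
      (br (z i / w) * br (q * z i / w) * br (q * z i' / w)) := by
  have h1 : i ∉ insert i' (Finset.Ioi i') := by
    simp only [Finset.mem_insert, Finset.mem_Ioi, Fin.ext_iff, Fin.lt_def]
    omega
  rw [Ici_eq_insert_insert hi, ← Finset.Iio_insert, den, den, Finset.prod_insert h1,
    Finset.prod_insert (by simp), Finset.prod_insert (by simp)]
  ring

theorem den_Iic_right (hi : (i' : ℕ) = i + 1) (w : ℂ) :
    den q z (Finset.Iic i') (Finset.Ici i') w = den q z (Finset.Iio i) (Finset.Ioi i') w *
      (br (z i / w) * br (z i' / w) * br (q * z i' / w)) := by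
  have h1 : i' ∉ insert i (Finset.Iio i) := by
    simp only [Finset.mem_insert, Finset.mem_Iio, Fin.ext_iff, Fin.lt_def]
    omega
  rw [Iic_eq_insert_insert hi, ← Finset.Ioi_insert, den, den, Finset.prod_insert h1,
    Finset.prod_insert (by simp), Finset.prod_insert (by simp)]
  ring

theorem den_image_left (hi : (i' : ℕ) = i + 1) (w : ℂ) :
    den q z ((Finset.Iic i).image (Equiv.swap i i')) ((Finset.Ici i).image (Equiv.swap i i')) w =
      den q z (Finset.Iio i) (Finset.Ioi i') w *
        (br (z i' / w) * br (q * z i / w) * br (q * z i' / w)) := by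
  have h1 : i ∉ insert i' (Finset.Ioi i') := by
    simp only [Finset.mem_insert, Finset.mem_Ioi, Fin.ext_iff, Fin.lt_def]
    omega
  have h2 : i' ∉ Finset.Iio i := by
    simp only [Finset.mem_Iio, Fin.lt_def]
    omega
  rw [image_swap_Iic_self hi, image_swap_Ici hi (by rw [Ne, Fin.ext_iff]; omega),
    Ici_eq_insert_insert hi, den, den, Finset.prod_insert h1, Finset.prod_insert h2,
    Finset.prod_insert (by simp)]
  ring

theorem den_image_right (hi : (i' : ℕ) = i + 1) (w : ℂ) :
    den q z ((Finset.Iic i').image (Equiv.swap i i')) ((Finset.Ici i').image (Equiv.swap i i')) w =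
      den q z (Finset.Iio i) (Finset.Ioi i') w *
        (br (z i / w) * br (z i' / w) * br (q * z i / w)) := by
  have h1 : i' ∉ insert i (Finset.Iio i) := by
    simp only [Finset.mem_insert, Finset.mem_Iio, Fin.ext_iff, Fin.lt_def]
    omega
  have h2 : i ∉ Finset.Ioi i' := by
    simp only [Finset.mem_Ioi, Fin.lt_def]
    omega
  rw [image_swap_Ici_self hi, image_swap_Iic hi (by rw [Ne, Fin.ext_iff]; omega),
    Iic_eq_insert_insert hi, den, den, Finset.prod_insert h1, Finset.prod_insert h2,
    Finset.prod_insert (by simp)]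
  ring

variable {a : Fin n → Fin N} {k : Fin n}

/-- Exchange of two parameters when the first of the two spins is down. -/
theorem IsContour.component_swap_left (h : IsContour q z ρ) (hq : q ≠ 0) (hβ : β ≠ 0)
    (hi : (i' : ℕ) = i + 1) (ha : Function.Injective a) (hk : a k = i) (hi' : ∀ l, a l ≠ i') :
    component q β (ρ ∘ Equiv.swap i i') (z ∘ Equiv.swap i i') a * br (q * z i' / z i) =
      br q * component q β ρ z a +
        br (z i / z i') * component q β ρ z (Function.update a k i') := by
  have hal : ∀ l, l ≠ k → a l ≠ i := fun l hl e => hl (ha (e.trans hk.symm))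
  have key := h.multiContour_linear hq (T := fun l => (Finset.Iic (a l)).image (Equiv.swap i i'))
    (U := fun l => (Finset.Ici (a l)).image (Equiv.swap i i')) (T₁ := fun l => Finset.Iic (a l))
    (U₁ := fun l => Finset.Ici (a l)) (T₂ := fun l => Finset.Iic (Function.update a k i' l))
    (U₂ := fun l => Finset.Ici (Function.update a k i' l)) (c := br (q * z i / z i'))
    (c₁ := br q) (c₂ := br (z i / z i'))
    (fun w hw => differentiableAt_xiNum hq hβ hw) k
    (fun l hl => ⟨(image_swap_Iic hi (hal l hl)).symm, (image_swap_Ici hi (hi' l)).symm⟩)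
    (fun l hl => by
      rw [Function.update_of_ne hl]
      exact ⟨(image_swap_Iic hi (hal l hl)).symm, (image_swap_Ici hi (hi' l)).symm⟩)
    (fun j w hw hwz => by
      simp only [Function.update_self, hk]
      rw [den_image_left hi, den_Iic_left hi, den_Iic_right hi]
      -- Up to common factors the three denominators lack `[z_i/w]`, `[z_{i'}/w]` and `[q z_i/w]`,
      -- which dictates `A`, `B`, `C`.
      have three := br_three_term (A := z i) (B := q * z i) (C := z i') (w := w) (h.ne_zero i)
        (mul_ne_zero hq (h.ne_zero i)) (h.ne_zero i') (h.ne_zero_of_mem hw)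
      rw [br_div_comm (z i') (z i), br_div_comm (z i) (q * z i),
        mul_div_cancel_right₀ _ (h.ne_zero i)] at three
      have n0 := h.den_ne_zero hq hw (T := Finset.Iio i) (Finset.Ioi i') (.inr hwz)
      have n1 := h.br_div_ne_zero hw (k := i) (.inr hwz)
      have n2 := h.br_div_ne_zero hw (k := i') (.inr hwz)
      have n3 := h.q_ne_zero hq hw (k := i)
      have n4 := h.q_ne_zero hq hw (k := i')
      generalize den q z (Finset.Iio i) (Finset.Ioi i') w = D at *
      generalize br (z i / w) = x at *
      generalize br (z i' / w) = x' at *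
      generalize br (q * z i / w) = y at *
      generalize br (q * z i' / w) = y' at *
      field_simp
      linear_combination three)
  rw [component_comp_perm, component_eq, component_eq]
  linear_combination ((-br q) ^ n * multiContour z ρ (integrand q z
    (fun l => (Finset.Iic (a l)).image (Equiv.swap i i'))
    (fun l => (Finset.Ici (a l)).image (Equiv.swap i i')) (xiNum q β))) *
    (prefactor_comp_swap (q := q) (z := z) hi) + ((-br q) ^ n * prefactor q z) * key

/-- Exchange of two parameters when the second of the two spins is down. -/
theorem IsContour.component_swap_right (h : IsContour q z ρ) (hq : q ≠ 0) (hβ : β ≠ 0)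
    (hi : (i' : ℕ) = i + 1) (ha : Function.Injective a) (hk : a k = i) (hi' : ∀ l, a l ≠ i') :
    component q β (ρ ∘ Equiv.swap i i') (z ∘ Equiv.swap i i') (Function.update a k i') *
        br (q * z i' / z i) =
      br q * component q β ρ z (Function.update a k i') +
        br (z i / z i') * component q β ρ z a := by
  have hal : ∀ l, l ≠ k → a l ≠ i := fun l hl e => hl (ha (e.trans hk.symm))
  have key := h.multiContour_linear hq
    (T := fun l => (Finset.Iic (Function.update a k i' l)).image (Equiv.swap i i'))
    (U := fun l => (Finset.Ici (Function.update a k i' l)).image (Equiv.swap i i'))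
    (T₁ := fun l => Finset.Iic (Function.update a k i' l))
    (U₁ := fun l => Finset.Ici (Function.update a k i' l)) (T₂ := fun l => Finset.Iic (a l))
    (U₂ := fun l => Finset.Ici (a l)) (c := br (q * z i / z i'))
    (c₁ := br q) (c₂ := br (z i / z i'))
    (fun w hw => differentiableAt_xiNum hq hβ hw) k
    (fun l hl => by
      rw [Function.update_of_ne hl]
      exact ⟨(image_swap_Iic hi (hal l hl)).symm, (image_swap_Ici hi (hi' l)).symm⟩)
    (fun l hl => by
      rw [Function.update_of_ne hl]
      exact ⟨(image_swap_Iic hi (hal l hl)).symm, (image_swap_Ici hi (hi' l)).symm⟩)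
    (fun j w hw hwz => by
      simp only [Function.update_self, hk]
      rw [den_image_right hi, den_Iic_left hi, den_Iic_right hi]
      -- Now the missing brackets are those of `q z_{i'}`, `q z_i` and `z_{i'}`.
      have three := br_three_term (A := q * z i') (B := q * z i) (C := z i') (w := w)
        (mul_ne_zero hq (h.ne_zero i')) (mul_ne_zero hq (h.ne_zero i)) (h.ne_zero i')
        (h.ne_zero_of_mem hw)
      rw [br_div_comm (z i') (q * z i'), mul_div_cancel_right₀ _ (h.ne_zero i'),
        mul_div_mul_left _ _ hq, br_div_comm (z i') (z i)] at three
      have n0 := h.den_ne_zero hq hw (T := Finset.Iio i) (Finset.Ioi i') (.inr hwz)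
      have n1 := h.br_div_ne_zero hw (k := i) (.inr hwz)
      have n2 := h.br_div_ne_zero hw (k := i') (.inr hwz)
      have n3 := h.q_ne_zero hq hw (k := i)
      have n4 := h.q_ne_zero hq hw (k := i')
      generalize den q z (Finset.Iio i) (Finset.Ioi i') w = D at *
      generalize br (z i / w) = x at *
      generalize br (z i' / w) = x' at *
      generalize br (q * z i / w) = y at *
      generalize br (q * z i' / w) = y' at *
      field_simp
      linear_combination three)
  rw [component_comp_perm, component_eq, component_eq]
  linear_combination ((-br q) ^ n * multiContour z ρ (integrand q z
    (fun l => (Finset.Iic (Function.update a k i' l)).image (Equiv.swap i i'))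
    (fun l => (Finset.Ici (Function.update a k i' l)).image (Equiv.swap i i')) (xiNum q β))) *
    (prefactor_comp_swap (q := q) (z := z) hi) + ((-br q) ^ n * prefactor q z) * key

end Exchange

/-! ### The parity relation -/

section Parity

variable {q : ℂ} {N n : ℕ}

/-- The positions of the down spins after the reversal of the chain. -/
def revPos (a : Fin n → Fin N) (l : Fin n) : Fin N := (a l.rev).rev

theorem revPos_revPos (a : Fin n → Fin N) : revPos (revPos a) = a := by
  funext l
  simp [revPos]

theorem strictMono_revPos {a : Fin n → Fin N} (ha : StrictMono a) : StrictMono (revPos a) :=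
  fun _ _ h => Fin.rev_lt_rev.2 (ha (Fin.rev_lt_rev.2 h))

theorem revPos_lastPos (hn : n ≤ N) : revPos (lastPos hn) = Fin.castLE hn := by
  funext l
  ext
  simp only [revPos, lastPos, Fin.val_rev, Fin.val_castLE]
  omega

/-- Take the largest `k` with `a k ≠ lastPos hn k`. All later down spins are packed at the right
end, so the site after `a k` is free. -/
theorem exists_move_right (hn : n ≤ N) {a : Fin n → Fin N} (ha : StrictMono a)
    (hne : a ≠ lastPos hn) : ∃ (k : Fin n) (i' : Fin N), (i' : ℕ) = a k + 1 ∧ (∀ l, a l ≠ i') ∧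
      StrictMono (Function.update a k i') := by
  classical
  have hS : (Finset.univ.filter fun k => a k ≠ lastPos hn k).Nonempty := by
    obtain ⟨k, hk⟩ := Function.ne_iff.1 hne
    exact ⟨k, by simpa using hk⟩
  set k := (Finset.univ.filter fun k => a k ≠ lastPos hn k).max' hS with hkdef
  have hk : a k ≠ lastPos hn k := by
    have := Finset.max'_mem _ hS
    simpa using this
  have hgt : ∀ l, k < l → a l = lastPos hn l := by
    intro l hl
    by_contra hl'
    exact absurd (Finset.le_max' _ l (by simpa using hl')) (not_le.2 hl)
  have hlt : (a k : ℕ) + 1 < N ∧ ∀ l, k < l → (a k : ℕ) + 1 < a l := by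
    have hle : (a k : ℕ) < N - n + k := by
      have h0 : (a k : ℕ) ≠ N - n + k := fun e => hk (Fin.ext e)
      by_cases hk1 : (k : ℕ) + 1 < n
      · have h1 : k < ⟨k + 1, hk1⟩ := by simp [Fin.lt_def]
        have h2 := Fin.lt_def.1 (ha h1)
        rw [hgt _ h1] at h2
        simp only [lastPos] at h2
        omega
      · have := (a k).2
        have := k.2
        omega
    refine ⟨by have := k.2; omega, fun l hl => ?_⟩
    rw [hgt l hl]
    have := Fin.lt_def.1 hl
    simp only [lastPos]
    omega
  refine ⟨k, ⟨a k + 1, hlt.1⟩, rfl, fun l hl => ?_, fun l l' hll => ?_⟩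
  · have hl1 : (a l : ℕ) = a k + 1 := by rw [hl]
    rcases lt_trichotomy l k with h | h | h
    · have := Fin.lt_def.1 (ha h)
      omega
    · rw [h] at hl1
      omega
    · have := hlt.2 l h
      omega
  · have hll' := Fin.lt_def.1 (ha hll)
    rw [Function.update_apply, Function.update_apply]
    split_ifs with h1 h2 h2
    · exact absurd (h1.trans h2.symm) hll.ne
    · subst h1
      exact Fin.lt_def.2 (hlt.2 _ hll)
    · subst h2
      rw [Fin.lt_def]
      exact hll'.trans (Nat.lt_succ_self _)
    · exact ha hll

variable {s β : ℂ}

/-- The reversal of the parameters. -/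
def revParam (s : ℂ) (z : Fin N → ℂ) (i : Fin N) : ℂ := s⁻¹ * (z i.rev)⁻¹

theorem revParam_comp_swap (z : Fin N → ℂ) (i i' : Fin N) :
    revParam s (z ∘ Equiv.swap i i') = revParam s z ∘ Equiv.swap i'.rev i.rev := by
  funext x
  simp only [revParam, Function.comp, Equiv.swap_apply_def]
  have h1 : x.rev = i ↔ x = i.rev := Fin.rev_eq_iff
  have h2 : x.rev = i' ↔ x = i'.rev := Fin.rev_eq_iff
  by_cases e1 : x = i.rev <;> by_cases e2 : x = i'.rev <;> simp_all

theorem component_eq_revParam (hq : q ≠ 0) (hbq : br q ≠ 0) (hβ : β ≠ 0) (hs : s ^ 4 = q ^ 6)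
    (hn : n ≤ N) (hN : N - n = n ∨ N - n = n + 1) {a : Fin n → Fin N} (ha : StrictMono a)
    {z : Fin N → ℂ} {ρ ρ' : Fin N → ℝ} (h : IsContour q z ρ) (h' : IsContour q (revParam s z) ρ') :
    component q β ρ z a = (q ^ 3 * s⁻¹ ^ 2) ^ ((N + 1) * n) *
      component q (q ^ 2 * s⁻¹ * β⁻¹) ρ' (revParam s z) (revPos a) := by
  have hs0 : s ≠ 0 := by
    rintro rfl
    exact pow_ne_zero 6 hq (by rw [← hs]; norm_num)
  -- Each move of a down spin to the right lowers this sum. The parameters are generalized because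
  -- the exchange relation also involves the component at the exchanged parameters.
  induction hm : ∑ l, (N - a l) using Nat.strong_induction_on generalizing a z ρ ρ' with
  | _ m ih =>
    by_cases hlast : a = lastPos hn
    · rw [hlast, revPos_lastPos]
      exact component_last_eq_first h hq hbq hβ hs h' hn hN
    obtain ⟨k, i', hi, hfree, ha'⟩ := exists_move_right hn ha hlast
    have hdec : ∑ l, (N - (Function.update a k i' l : ℕ)) < m := by
      rw [← hm]
      refine Finset.sum_lt_sum (fun l _ => ?_) ⟨k, Finset.mem_univ k, ?_⟩
      · rw [Function.update_apply]
        split_ifs with hl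
        · subst hl
          omega
        · exact le_rfl
      · rw [Function.update_self]
        have := (a k).2
        omega
    set i := a k with hik
    -- In the reversed chain the move goes to the left. Starting from the reversed `a'`, the spin
    -- moves right to reach the reversed `a`, which is the situation of `component_swap_left`.
    have hrev : revPos a = Function.update (revPos (Function.update a k i')) k.rev i.rev := by
      funext l
      rw [Function.update_apply]
      split_ifs with hl
      · subst hl
        simp [revPos, hik]
      · have : l.rev ≠ k := fun e => hl (by rw [← e, Fin.rev_rev])
        simp [revPos, Function.update_of_ne this]
    have hpos : ∀ l, revPos (Function.update a k i') l ≠ i.rev := by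
      intro l hl
      simp only [revPos, Fin.rev_inj, Function.update_apply] at hl
      split_ifs at hl with h1
      · rw [Fin.ext_iff] at hl
        omega
      · exact h1 (ha.injective hl)
    -- The unknown component `a` enters only through the last term; the other two belong to the
    -- moved configuration, at `z` and at the exchanged parameters.
    have E₁ := h.component_swap_right hq hβ hi ha.injective hik.symm hfree
    have E₂ := h'.component_swap_left (β := q ^ 2 * s⁻¹ * β⁻¹) hq (by positivity)
      (i := i'.rev) (i' := i.rev) (by simp only [Fin.val_rev]; omega)
      (strictMono_revPos ha').injective (k := k.rev) (by simp [revPos]) hpos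
    rw [← hrev, ← revParam_comp_swap] at E₂
    have hz := h.ne_zero i
    have hz' := h.ne_zero i'
    -- Inversion and reversal together preserve the coefficients, so `E₂` is the image of `E₁` term
    -- by term.
    have e1 : q * revParam s z i.rev / revParam s z i'.rev = q * z i' / z i := by
      simp only [revParam, Fin.rev_rev]
      field_simp
    have e2 : revParam s z i'.rev / revParam s z i.rev = z i / z i' := by
      simp only [revParam, Fin.rev_rev]
      field_simp
    rw [e1, e2] at E₂
    have I₁ := ih _ hdec ha' h h' rfl
    have I₂ := ih _ hdec ha' (h.comp_perm (Equiv.swap i i'))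
      (ρ' := ρ' ∘ Equiv.swap i'.rev i.rev) (by
        rw [revParam_comp_swap]
        exact h'.comp_perm _) rfl
    have hne : br (z i / z i') ≠ 0 := h.br_div_ne_zero (h.mem_self i')
      (.inl fun e => by rw [Fin.ext_iff] at e; omega)
    rw [I₁, I₂] at E₁
    -- The induction hypothesis matches two of the three terms; the third follows after division by
    -- `[z_i/z_{i'}] ≠ 0`.
    rw [← mul_right_inj' hne]
    linear_combination (-1 : ℂ) * E₁ + (q ^ 3 * s⁻¹ ^ 2) ^ ((N + 1) * n) * E₂

theorem config_revPos (a : Fin n → Fin N) : (fun i => config a i.rev) = config (revPos a) := by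
  funext i
  have : i.rev ∈ Set.range a ↔ i ∈ Set.range (revPos a) := by
    constructor
    · rintro ⟨l, hl⟩
      exact ⟨l.rev, by simp [revPos, hl]⟩
    · rintro ⟨l, rfl⟩
      exact ⟨l.rev, by simp [revPos]⟩
  simp only [config, this]

end Parity

end SpinChain

/-! ### The parity relation for the vectors -/

theorem mainTheorem8 (N : ℕ) (hN : 1 ≤ N) (q s β : ℂ)
    (hq0 : q ≠ 0) (hq1 : q ≠ 1) (hq2 : q ≠ -1) (hβ : β ≠ 0) (hs : s ^ 4 = q ^ 6)
    (z : Fin N → ℂ) (ρ ρ' : Fin N → ℝ)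
    (hρ : SpinChain.IsContour q z ρ)
    (hρ' : SpinChain.IsContour q (fun i => s⁻¹ * (z i.rev)⁻¹) ρ') :
    SpinChain.parity N (SpinChain.Psi q β ρ z) =
      (q ^ 3 * s⁻¹ ^ 2) ^ ((N + 1) * (N / 2)) •
        SpinChain.Psi q (q ^ 2 * s⁻¹ * β⁻¹) ρ' (fun i => s⁻¹ * (z i.rev)⁻¹) := by
  classical
  rw [SpinChain.Psi, SpinChain.Psi, map_sum, Finset.smul_sum]
  -- Reversal is an involution on increasing position tuples, so the two sums are matched component
  -- by component.
  refine Finset.sum_nbij' SpinChain.revPos SpinChain.revPos ?_ ?_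
    (fun a _ => SpinChain.revPos_revPos a) (fun a _ => SpinChain.revPos_revPos a) ?_
  · intro a ha
    simp only [Finset.mem_filter, Finset.mem_univ, true_and] at ha ⊢
    exact SpinChain.strictMono_revPos ha
  · intro a ha
    simp only [Finset.mem_filter, Finset.mem_univ, true_and] at ha ⊢
    exact SpinChain.strictMono_revPos ha
  · intro a ha
    simp only [Finset.mem_filter, Finset.mem_univ, true_and] at ha
    rw [map_smul, SpinChain.parity_ket, SpinChain.config_revPos, smul_smul,
      SpinChain.component_eq_revParam hq0 (SpinChain.br_ne_zero hq0 hq1 hq2) hβ hs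
        (Nat.div_le_self N 2) (by omega) ha hρ hρ']
    rfl

end
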